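/- Let $\Bbbk$ be an algebraically closed field of characteristic $2$. Let $C$ be a smooth curve of genus $2$ over $\Bbbk$, given (with a Weierstrass point placed at infinity) by $y^2+h(x)y=f(x)$ with $\deg f=5$, $\deg h\le 2$, and assume that $C$ has $2$-rank $1$, i.e. that its Jacobian $J(C)$ has exactly two $2$-torsion points. Let $X\subset\mathbb{P}^3$ be the Kummer quartic surface of $C$, i.e. the image of $J(C)/(\pm 1)$ under the map given by the linear system $|2\Theta|$. A line $\ell\subset\mathbb{P}^3$ is called a bitangent line of a quartic surface $X$ if $\ell\subset X$ or if $X$ cuts out on $\ell$ a divisor $2a+2b$ (possibly $a=b$); let $\mathrm{Bit}(X)$ be the variety of bitangent lines in the Grassmannian $G_1(\mathbb{P}^3)$ of lines, which is embedded in $\mathbb{P}^5$ by the Plücker embedding. A subvariety of $G_1(\mathbb{P}^3)$ is said to have bidegree $(m,n)$ if exactly $m$ of its lines pass through a general point of $\mathbb{P}^3$ and exactly $n$ of its lines lie in a general plane. A plane is a trope of $X$ if it cuts $X$ along a conic taken with multiplicity $2$. For an involution $\sigma$ of $X$ that is the restriction of a Cremona involution of $\mathbb{P}^3$, let $S(\sigma)\subset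 G_1(\mathbb{P}^3)$ be the closure of the set of lines $\langle p,\sigma(p)\rangle$, where $p\in X$ is a point at which $\sigma$ is defined and $\sigma(p)\neq p$; call $\sigma$ a bitangent involution if for a general point $p\in X$ one has $\sigma(p)\ne p$ and $X$ cuts out on the line $\langle p,\sigma(p)\rangle$ the divisor $2p+2\sigma(p)$. Then $\mathrm{Bit}(X)$ has bidegree $(2,4)$. Moreover, there are projective coordinates $[x,y,z,w]$ and constants $\alpha,\beta\in\Bbbk$, $\beta\ne0$, in which $X$ is the surface $$X_1=V\left(\beta^2x^4+\alpha^2x^2z^2+x^2zw+xyz^2+y^2w^2+z^4\right),$$ and for all such coordinates and constants the following holds. The planes $x=0$ and $z=0$ are tropes of $X_1$; the Cremona involutions $$\sigma_1\colon[x,y,z,w]\mapsto[xz^2,yz^2,\beta x^2z,\beta x^2w],\qquad \sigma_2\colon[x,y,z,w]\mapsto[x^2z,x^2w,xz^2,yz^2]$$ restrict to bitangent involutions of $X_1$; and $\mathrm{Bit}(X_1)$ has exactly four irreducible components: the plane of lines contained in $x=0$, the plane of lines contained in $z=0$, and the surfaces $S(\sigma_1)$ and $S(\sigma_2)$. In the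 Plücker embedding, $S(\sigma_1)$ is a smooth quadric surface and $S(\sigma_2)$ is a quadric cone. -/

import Mathlib

noncomputable section

namespace KummerBit

/-! ### Projective spaces, lines and the Zariski topology -/

section Projective

variable (k : Type*) [Field k]

/-- Projective space of dimension `n - 1`, with homogeneous coordinates indexed by `Fin n`. -/
abbrev PSpace (n : ℕ) : Type _ := Projectivization k (Fin n → k)

/-- The Zariski topology on projective space: a basis of open sets is given by the
complements of the hypersurfaces `G = 0`, for `G` a homogeneous form. -/
instance zariskiTopology (n : ℕ) : TopologicalSpace (PSpace k n) :=
  TopologicalSpace.generateFrom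
    {U | ∃ (G : MvPolynomial (Fin n) k) (d : ℕ), G.IsHomogeneous d ∧
      U = {p | MvPolynomial.eval p.rep G ≠ 0}}

/-- The Grassmannian of lines in projective 3-space (two-dimensional subspaces of `k ^ 4`). -/
def Line : Type _ := {L : Submodule k (Fin 4 → k) // Module.finrank k L = 2}

end Projective

section Lines

variable {k : Type*} [Field k]

/-- The `2 × 2` minors `(p₁₂, p₁₃, p₁₄, p₂₃, p₂₄, p₃₄)` of the matrix with rows `u`, `v`. -/
def minors (u v : Fin 4 → k) : Fin 6 → k :=
  ![u 0 * v 1 - u 1 * v 0, u 0 * v 2 - u 2 * v 0, u 0 * v 3 - u 3 * v 0,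
    u 1 * v 2 - u 2 * v 1, u 1 * v 3 - u 3 * v 1, u 2 * v 3 - u 3 * v 2]

theorem minors_ne_zero {u v : Fin 4 → k} (h : LinearIndependent k ![u, v]) :
    minors u v ≠ 0 := by
  intro h0
  have e : ∀ i j, u i * v j = u j * v i := by
    have m := fun i => congrFun h0 i
    have m0 := m 0
    have m1 := m 1
    have m2 := m 2
    have m3 := m 3
    have m4 := m 4
    have m5 := m 5
    simp [minors, sub_eq_zero] at m0 m1 m2 m3 m4 m5
    intro i j
    fin_cases i <;> fin_cases j <;> simp <;> first | assumption | (symm; assumption)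
  rw [LinearIndependent.pair_iff] at h
  have hu : ∀ i, u i = 0 := fun i => by
    have := h (v i) (-(u i)) (by
      ext j
      simp only [Pi.add_apply, Pi.smul_apply, smul_eq_mul, Pi.zero_apply]
      linear_combination -(e i j))
    simpa using this.2
  have := h 1 0 (by ext j; simp [hu j])
  simp at this

/-- The Plücker embedding of the Grassmannian of lines in projective 5-space. -/
def plucker (L : Line k) : PSpace k 6 :=
  let b := Module.finBasisOfFinrankEq k L.1 L.2
  Projectivization.mk k (minors (b 0 : Fin 4 → k) (b 1 : Fin 4 → k)) (by
    apply minors_ne_zero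
    have h := b.linearIndependent.map' L.1.subtype (Submodule.ker_subtype _)
    have e : ![(b 0 : Fin 4 → k), (b 1 : Fin 4 → k)] = L.1.subtype ∘ b := by
      funext i
      fin_cases i <;> rfl
    rw [e]
    exact h)

/-- The Zariski topology of the Grassmannian, induced by the Plücker embedding. -/
instance lineTopology : TopologicalSpace (Line k) :=
  TopologicalSpace.induced plucker (zariskiTopology k 6)

/-- The lines contained in the plane `∑ aᵢ xᵢ = 0` (a `β`-plane when `a ≠ 0`). -/
def betaPlane (a : Fin 4 → k) : Set (Line k) :=
  {L | ∀ v ∈ L.1, a ⬝ᵥ v = 0}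

/-- The lines through the point `P` (an `α`-plane). -/
def alphaPlane (P : PSpace k 4) : Set (Line k) :=
  {L | P.submodule ≤ L.1}

/-- `S` has bidegree `(m, n)`: exactly `m` lines of `S` pass through a general point, and
exactly `n` lines of `S` lie in a general plane. -/
def HasBidegree (S : Set (Line k)) (m n : ℕ) : Prop :=
  (∃ U : Set (PSpace k 4), IsOpen U ∧ U.Nonempty ∧
    ∀ P ∈ U, (S ∩ alphaPlane P).encard = m) ∧
  (∃ U : Set (PSpace k 4), IsOpen U ∧ U.Nonempty ∧
    ∀ H ∈ U, (S ∩ betaPlane H.rep).encard = n)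

/-- The irreducible components of a subset of a topological space: its maximal irreducible
subsets. -/
def componentsOf {T : Type*} [TopologicalSpace T] (A : Set T) : Set (Set T) :=
  {Z | Maximal (fun Y => Y ⊆ A ∧ IsIrreducible Y) Z}

/-- The vectors of `W` that represent singular points of the quadric `Q = 0` in `ℙ(W)`,
together with `0`. -/
def singularVectors {n : ℕ} (W : Submodule k (Fin n → k)) (Q : QuadraticForm k (Fin n → k)) :
    Set (Fin n → k) :=
  {v | v ∈ W ∧ Q v = 0 ∧ ∀ w ∈ W, QuadraticMap.polar Q v w = 0}

/-- `Z` is a smooth quadric surface in a three-dimensional linear subspace. -/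
def IsSmoothQuadricSurface {n : ℕ} (Z : Set (PSpace k n)) : Prop :=
  ∃ (W : Submodule k (Fin n → k)) (Q : QuadraticForm k (Fin n → k)),
    Module.finrank k W = 4 ∧ Z = {p | p.rep ∈ W ∧ Q p.rep = 0} ∧ singularVectors W Q = {0}

/-- `Z` is a quadric cone in a three-dimensional linear subspace: a quadric surface with
exactly one singular point, its vertex. -/
def IsQuadricCone {n : ℕ} (Z : Set (PSpace k n)) : Prop :=
  ∃ (W : Submodule k (Fin n → k)) (Q : QuadraticForm k (Fin n → k)),
    Module.finrank k W = 4 ∧ Z = {p | p.rep ∈ W ∧ Q p.rep = 0} ∧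
    ∃ e : Fin n → k, e ≠ 0 ∧ singularVectors W Q = (Submodule.span k {e} : Set (Fin n → k))

end Lines

/-! ### Bitangent lines, tropes and bitangent involutions -/

section Surfaces

variable {k : Type*} [Field k]

/-- The homogeneous ideal of a subset of projective space. -/
def vanishingIdeal {n : ℕ} (X : Set (PSpace k n)) : Ideal (MvPolynomial (Fin n) k) :=
  Ideal.span {G | ∃ d : ℕ, G.IsHomogeneous d ∧ ∀ p ∈ X, MvPolynomial.eval p.rep G = 0}

/-- Substitution of the parametrization `[s, t] ↦ s u + t v` of the line `⟨u, v⟩`. -/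
def restrictLine (u v : Fin 4 → k) :
    MvPolynomial (Fin 4) k →ₐ[k] MvPolynomial (Fin 2) k :=
  MvPolynomial.aeval fun i =>
    MvPolynomial.C (u i) * MvPolynomial.X 0 + MvPolynomial.C (v i) * MvPolynomial.X 1

/-- `L` is a bitangent line of `X`: it is contained in `X`, or `X` cuts out on `L` a divisor
of the form `2a + 2b + D'` with `D'` effective (`a = b` is allowed). Here `l₁`, `l₂` are
the linear forms on `L` that vanish at `a`, `b`. -/
def IsBitangentLine (X : Set (PSpace k 4)) (L : Line k) : Prop :=
  (∀ p : PSpace k 4, p.submodule ≤ L.1 → p ∈ X) ∨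
  ∃ u v : Fin 4 → k, L.1 = Submodule.span k {u, v} ∧
    ∃ l₁ l₂ : MvPolynomial (Fin 2) k, l₁.IsHomogeneous 1 ∧ l₁ ≠ 0 ∧
      l₂.IsHomogeneous 1 ∧ l₂ ≠ 0 ∧
      ∀ G ∈ vanishingIdeal X, (l₁ * l₂) ^ 2 ∣ restrictLine u v G

/-- The variety of bitangent lines of `X`. -/
def Bit (X : Set (PSpace k 4)) : Set (Line k) := {L | IsBitangentLine X L}

/-- The plane `∑ aᵢ xᵢ = 0` is a trope of `X`: it cuts `X`, as a scheme, along a conic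
taken with multiplicity two. -/
def IsTrope (X : Set (PSpace k 4)) (a : Fin 4 → k) : Prop :=
  a ≠ 0 ∧
  ∃ Q : MvPolynomial (Fin 4) k, Q.IsHomogeneous 2 ∧
    Q ∉ Ideal.span {∑ i, MvPolynomial.C (a i) * MvPolynomial.X i} ∧
    vanishingIdeal X ⊔ Ideal.span {∑ i, MvPolynomial.C (a i) * MvPolynomial.X i} =
      Ideal.span {Q ^ 2, ∑ i, MvPolynomial.C (a i) * MvPolynomial.X i}

/-- The vector obtained by evaluating the forms `T` at `v`. -/
def evalMap (T : Fin 4 → MvPolynomial (Fin 4) k) (v : Fin 4 → k) : Fin 4 → k :=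
  fun i => MvPolynomial.eval v (T i)

/-- The forms `T` of the same degree define a Cremona involution: as a rational map of
projective 3-space it is not the identity, and its square is the identity. -/
def IsCremonaInvolution (T : Fin 4 → MvPolynomial (Fin 4) k) : Prop :=
  (∃ d : ℕ, ∀ i, (T i).IsHomogeneous d) ∧
  (∃ i j, T i * MvPolynomial.X j ≠ T j * MvPolynomial.X i) ∧
  ∃ c : MvPolynomial (Fin 4) k, c ≠ 0 ∧
    ∀ i, MvPolynomial.aeval T (T i) = c * MvPolynomial.X i

/-- The Cremona involution `T` restricts to a bitangent involution `σ` of `X`: on a dense open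
subset of `X`, the map `T` is defined, preserves that subset, is the inverse of itself,
has no fixed points, and the line joining `x` and `σ x` cuts out on `X` the divisor
`2 x + 2 σ x` (in the parametrization `s u + t T u`, where `x = [u]`, this is the
divisor `s² t² = 0`). -/
def IsBitangentInvolution (X : Set (PSpace k 4)) (T : Fin 4 → MvPolynomial (Fin 4) k) : Prop :=
  IsCremonaInvolution T ∧
  ∃ U : Set (PSpace k 4), IsOpen U ∧ X ⊆ closure (U ∩ X) ∧
    ∀ x ∈ U ∩ X, ∃ h : evalMap T x.rep ≠ 0,
      Projectivization.mk k (evalMap T x.rep) h ∈ U ∩ X ∧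
      Projectivization.mk k (evalMap T x.rep) h ≠ x ∧
      (∃ c : k, c ≠ 0 ∧ evalMap T (evalMap T x.rep) = c • x.rep) ∧
      (vanishingIdeal X).map (restrictLine x.rep (evalMap T x.rep)) =
        Ideal.span {(MvPolynomial.X 0 * MvPolynomial.X 1) ^ 2}

/-- The congruence `S(σ)`: the Zariski closure of the set of lines `⟨x, σ x⟩`, where `x` runs
over the points of `X` at which `T` is defined and `σ x ≠ x` (automatic below, because
`L.1` has dimension two). -/
def involutionCongruence (X : Set (PSpace k 4)) (T : Fin 4 → MvPolynomial (Fin 4) k) :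
    Set (Line k) :=
  closure {L | ∃ x ∈ X, L.1 = Submodule.span k {x.rep, evalMap T x.rep}}

/-- The quartic form `β²x⁴ + α²x²z² + x²zw + xyz² + y²w² + z⁴`, with `x, y, z, w` the
coordinates number `0, 1, 2, 3`. -/
def quarticForm (α β : k) : MvPolynomial (Fin 4) k :=
  let x := MvPolynomial.X 0
  let y := MvPolynomial.X 1
  let z := MvPolynomial.X 2
  let w := MvPolynomial.X 3
  MvPolynomial.C (β ^ 2) * x ^ 4 + MvPolynomial.C (α ^ 2) * x ^ 2 * z ^ 2 + x ^ 2 * z * w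
    + x * y * z ^ 2 + y ^ 2 * w ^ 2 + z ^ 4

/-- The quartic surface `V(β²x⁴ + α²x²z² + x²zw + xyz² + y²w² + z⁴)`. -/
def quarticSurface (α β : k) : Set (PSpace k 4) :=
  {p | MvPolynomial.eval p.rep (quarticForm α β) = 0}

/-- `σ₁ : [x, y, z, w] ↦ [xz², yz², βx²z, βx²w]`. -/
def sigma₁ (β : k) : Fin 4 → MvPolynomial (Fin 4) k :=
  let x := MvPolynomial.X 0
  let y := MvPolynomial.X 1
  let z := MvPolynomial.X 2
  let w := MvPolynomial.X 3
  ![x * z ^ 2, y * z ^ 2, MvPolynomial.C β * x ^ 2 * z, MvPolynomial.C β * x ^ 2 * w]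

/-- `σ₂ : [x, y, z, w] ↦ [x²z, x²w, xz², yz²]`. -/
def sigma₂ : Fin 4 → MvPolynomial (Fin 4) k :=
  let x := MvPolynomial.X 0
  let y := MvPolynomial.X 1
  let z := MvPolynomial.X 2
  let w := MvPolynomial.X 3
  ![x ^ 2 * z, x ^ 2 * w, x * z ^ 2, y * z ^ 2]

end Surfaces

/-! ### Curves of genus two, their Jacobians and Kummer surfaces -/

/-- A smooth curve of genus two, given by an affine equation `y² + h(x) y = f(x)` with
`deg f = 5` and `deg h ≤ 2`; the smooth projective model has exactly one more point `∞`, a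
Weierstrass point. Over an algebraically closed field every smooth projective curve of genus two
has such an equation. -/
structure GenusTwoCurve (k : Type*) [Field k] where
  h : Polynomial k
  f : Polynomial k
  natDegree_h : h.natDegree ≤ 2
  natDegree_f : f.natDegree = 5
  smooth : ∀ a b : k, b ^ 2 + h.eval a * b = f.eval a →
    2 * b + h.eval a ≠ 0 ∨ h.derivative.eval a * b - f.derivative.eval a ≠ 0

namespace GenusTwoCurve

variable {k : Type*} [Field k] (C : GenusTwoCurve k)

/-- The polynomial `Y² + h Y - f` in `Y` over `k[x]`. -/
def poly : Polynomial (Polynomial k) :=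
  Polynomial.X ^ 2 + (Polynomial.C C.h * Polynomial.X - Polynomial.C C.f)

theorem degree_poly_tail :
    (Polynomial.C C.h * Polynomial.X - Polynomial.C C.f).degree < ((2 : ℕ) : WithBot ℕ) := by
  refine lt_of_le_of_lt (Polynomial.degree_sub_le _ _) (max_lt ?_ ?_)
  · exact lt_of_le_of_lt (Polynomial.degree_C_mul_X_le _) (by norm_num)
  · exact lt_of_le_of_lt Polynomial.degree_C_le (by norm_num)

theorem monic_poly : C.poly.Monic :=
  Polynomial.monic_X_pow_add C.degree_poly_tail

theorem natDegree_poly : C.poly.natDegree = 2 := by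
  apply Polynomial.natDegree_eq_of_degree_eq_some
  unfold poly
  rw [Polynomial.degree_add_eq_left_of_degree_lt] <;> rw [Polynomial.degree_X_pow]
  exact C.degree_poly_tail

theorem irreducible_poly : Irreducible C.poly := by
  rw [C.monic_poly.irreducible_iff_roots_eq_zero_of_degree_le_three
    (by rw [C.natDegree_poly]) (by rw [C.natDegree_poly]; norm_num)]
  rw [Multiset.eq_zero_iff_forall_notMem]
  intro p hp
  have hr := Polynomial.isRoot_of_mem_roots hp
  have e : p ^ 2 + C.h * p = C.f := by
    have : p ^ 2 + (C.h * p - C.f) = 0 := by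
      simpa [poly, Polynomial.IsRoot] using hr
    linear_combination this
  have hd := C.natDegree_f
  rw [← e] at hd
  have h2 := C.natDegree_h
  have hm : (C.h * p).natDegree ≤ 2 + p.natDegree :=
    Polynomial.natDegree_mul_le.trans (by omega)
  rcases Nat.lt_or_ge 2 p.natDegree with h3 | h3
  · rw [Polynomial.natDegree_add_eq_left_of_natDegree_lt] at hd
    · rw [Polynomial.natDegree_pow] at hd
      omega
    · rw [Polynomial.natDegree_pow]
      omega
  · have := Polynomial.natDegree_add_le (p ^ 2) (C.h * p)
    rw [Polynomial.natDegree_pow] at this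
    have hmx : max (2 * p.natDegree) (C.h * p).natDegree ≤ 4 := max_le (by omega) (by omega)
    omega

/-- The ring of regular functions on the affine curve `C ∖ {∞}`. -/
abbrev CoordRing : Type _ := AdjoinRoot C.poly

instance : IsDomain C.CoordRing :=
  AdjoinRoot.isDomain_of_prime C.irreducible_poly.prime

/-- The group of points of the Jacobian variety `J(C)`. As `∞` is a single rational point,
restriction of divisors to `C ∖ {∞}` identifies `J(C)(k) = Pic⁰(C)` with the ideal class group of
the coordinate ring of the affine curve. -/
abbrev Jacobian : Type _ := ClassGroup C.CoordRing

/-- The curve has `2`-rank `r`: the group `J(C)[2]` of `2`-torsion points has order `2 ^ r`. -/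
def HasTwoRank (r : ℕ) : Prop :=
  Nat.card {D : C.Jacobian // D ^ 2 = 1} = 2 ^ r

/-- The value of the map defined by the complete linear system `|2Θ|` on `J(C)` at the class of
`(x₁, y₁) + (x₂, y₂) - 2∞`. Its coordinates `1, x₁ + x₂, x₁x₂` and
`(F₀(x₁, x₂) - 2y₁y₂ - h(x₁)y₂ - h(x₂)y₁) / (x₁ - x₂)²` form a basis of the space of sections. -/
def kummerVector (x₁ y₁ x₂ y₂ : k) : Fin 4 → k :=
  let s := x₁ + x₂
  let p := x₁ * x₂
  let c := fun i => C.f.coeff i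
  let F₀ := 2 * c 0 + c 1 * s + 2 * c 2 * p + c 3 * s * p + 2 * c 4 * p ^ 2 + c 5 * s * p ^ 2
  ![1, s, p,
    (F₀ - 2 * y₁ * y₂ - C.h.eval x₁ * y₂ - C.h.eval x₂ * y₁) / (x₁ - x₂) ^ 2]

/-- The Kummer quartic surface of `C`: the image of `J(C)`, or of its quotient by the negation
involution, in projective 3-space under the map given by `|2Θ|`. It is the closure of the image
of the dense set of classes `(x₁, y₁) + (x₂, y₂) - 2∞` with `x₁ ≠ x₂`. -/
def kummerSurface : Set (PSpace k 4) :=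
  closure {q | ∃ x₁ y₁ x₂ y₂ : k,
    y₁ ^ 2 + C.h.eval x₁ * y₁ = C.f.eval x₁ ∧ y₂ ^ 2 + C.h.eval x₂ * y₂ = C.f.eval x₂ ∧
    x₁ ≠ x₂ ∧ q.submodule = Submodule.span k {C.kummerVector x₁ y₁ x₂ y₂}}

end GenusTwoCurve

end KummerBit

end

noncomputable section

namespace KummerBit

open Polynomial

/-! ### The shape of `h` for a curve of two-rank one -/

section SquareDecomposition

variable {k : Type*} [Field k]

/-! Shape of `h`. A root `a` of `h` is the abscissa of a ramification point of the double cover `x`,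
and the ideal of that point squares to `(x - a)`; norms down to `k[x]` show that these classes are
nontrivial and that distinct roots give distinct ones (`exists_three_le_twoTorsion`). If `h` is a
nonzero constant, a two-torsion class `I² = (g)` yields a logarithmic differential `dg / g = r dx`
with `r` regular, hence fixed by the Cartier operator. A degree count leaves only `r = 0`, so `g` is
a square and `I` is principal (`jacobian_eq_one_of_sq_eq_one`). Thus two-rank 1 forces `h = c(x -
a)` or `h = c(x - a)²`.

Normal form. For points `(x₁, y₁)`, `(x₂, y₂)` the quantity `N = h(x₁) y₂ + h(x₂) y₁` satisfies a
monic quadratic equation over `k[x₁, x₂]`. Put `N = ξ (x₁ + x₂)² + F₀` and move the root of `h` to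
the origin: the equation becomes `(x₁ + x₂)²` times a quartic form in `1`, `x₁ + x₂`, `x₁ x₂`, `ξ`.
The simple and the double root give the same shape, with `1` and the translated product exchanged;
smoothness of `C` makes the needed coefficients nonzero, and rescaling gives the normal form.

Bitangents. In characteristic 2 a binary quartic is a square exactly when its coefficients of `s³t`
and `st³` vanish. For the normal form this says that `u₀² p₃₄ + u₂² p₁₂ = 0` for every `u` on the
line. Either `p₁₂ = p₃₄ = 0`, or `x = 0` or `z = 0` on the line, or `p₁₃ = 0` and `p₁₄ = p₂₃`
(`Bit_quarticSurface`). On the first family the Plücker relation is a smooth quadric, on the last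
the cone `p₁₂ p₃₄ = p₁₄²`.

Everything else is read off from these equations. Each family is parametrized by polynomials, hence
irreducible; a general line of the quadric or the cone joins a point of the surface to its image
under `σ₁` or `σ₂`. Counting lines through a point or in a plane family by family gives `0 + 0 + 1 +
1` and `1 + 1 + 1 + 1`, and the bidegree is invariant under linear changes of coordinates. -/

theorem sq_add_X_mul_sq_natDegree (P Q : k[X]) (hQ : Q ≠ 0) :
    2 * Q.natDegree + 1 ≤ (P ^ 2 + X * Q ^ 2).natDegree := by
  have hx : (X * Q ^ 2 : k[X]).natDegree = 2 * Q.natDegree + 1 := by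
    rw [natDegree_X_mul (pow_ne_zero _ hQ), natDegree_pow]
  have hp : (P ^ 2).natDegree = 2 * P.natDegree := natDegree_pow _ _
  -- The two degrees have opposite parity, so the leading terms cannot cancel.
  rcases lt_or_ge (P ^ 2).natDegree (X * Q ^ 2 : k[X]).natDegree with h | h
  · rw [natDegree_add_eq_right_of_natDegree_lt h]; omega
  · rw [natDegree_add_eq_left_of_natDegree_lt (by omega)]; omega

theorem sq_add_X_mul_sq_eq_zero {P Q : k[X]} (h : P ^ 2 + X * Q ^ 2 = 0) : P = 0 ∧ Q = 0 := by
  have hQ : Q = 0 := by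
    by_contra hQ
    have := sq_add_X_mul_sq_natDegree P Q hQ
    rw [h] at this
    simp at this
  subst hQ
  simpa using h

/-- For `Q ≠ 0` the left side has degree at least `2 * Q.natDegree + 1`, which exceeds the degree of
`Q`. -/
theorem sq_add_X_mul_sq_eq_self {P Q : k[X]} {c : k} (h : C c * (P ^ 2 + X * Q ^ 2) = Q)
    (hc : c ≠ 0) : Q = 0 := by
  by_contra hQ
  have := sq_add_X_mul_sq_natDegree P Q hQ
  have h2 := congrArg natDegree h
  rw [natDegree_C_mul hc] at h2
  omega

/-- Since `k` is perfect, `k[X]` is spanned by `1` and `X` over its subring of squares. -/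
theorem exists_eq_sq_add_X_mul_sq [CharP k 2] [IsAlgClosed k] (F : k[X]) :
    ∃ P Q : k[X], F = P ^ 2 + X * Q ^ 2 := by
  induction F using Polynomial.induction_on' with
  | add p q hp hq =>
    obtain ⟨P, Q, rfl⟩ := hp
    obtain ⟨P', Q', rfl⟩ := hq
    refine ⟨P + P', Q + Q', ?_⟩
    rw [CharTwo.add_sq, CharTwo.add_sq]
    ring
  | monomial n a =>
    obtain ⟨b, rfl⟩ := IsAlgClosed.exists_pow_nat_eq a (n := 2) (by norm_num)
    rcases Nat.even_or_odd' n with ⟨m, rfl | rfl⟩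
    · refine ⟨C b * X ^ m, 0, ?_⟩
      rw [← C_mul_X_pow_eq_monomial, C_pow]
      ring
    · refine ⟨0, C b * X ^ m, ?_⟩
      rw [← C_mul_X_pow_eq_monomial, C_pow]
      ring

end SquareDecomposition

/-! ### The coordinate ring as a free `k[x]`-module with basis `1`, `y`. -/

namespace GenusTwoCurve

variable {k : Type*} [Field k] (C : GenusTwoCurve k)

/-- The function `x` on the affine curve, and more generally the polynomials in `x`. -/
def ofPoly : k[X] →+* C.CoordRing := AdjoinRoot.of C.poly

/-- The function `y` on the affine curve. -/
def yCoord : C.CoordRing := AdjoinRoot.root C.poly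

theorem yCoord_sq : C.yCoord ^ 2 + C.ofPoly C.h * C.yCoord = C.ofPoly C.f := by
  have h : (X ^ 2 + (Polynomial.C C.h * X - Polynomial.C C.f)).eval₂ (AdjoinRoot.of C.poly)
      (AdjoinRoot.root C.poly) = 0 := AdjoinRoot.eval₂_root C.poly
  simp only [eval₂_add, eval₂_sub, eval₂_mul, eval₂_pow, eval₂_X, eval₂_C] at h
  unfold yCoord ofPoly
  linear_combination h

theorem exists_eq_add_mul_yCoord (r : C.CoordRing) :
    ∃ A B : k[X], r = C.ofPoly A + C.ofPoly B * C.yCoord := by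
  obtain ⟨p, rfl⟩ := AdjoinRoot.mk_surjective r
  have h2 : (p %ₘ C.poly).natDegree ≤ 1 := by
    have := natDegree_modByMonic_lt p C.monic_poly (by
      intro h; have := C.natDegree_poly; rw [h] at this; simp at this)
    rw [C.natDegree_poly] at this
    omega
  refine ⟨(p %ₘ C.poly).coeff 0, (p %ₘ C.poly).coeff 1, ?_⟩
  have h3 : AdjoinRoot.mk C.poly p = AdjoinRoot.mk C.poly (p %ₘ C.poly) := by
    rw [AdjoinRoot.mk_eq_mk]
    exact ⟨p /ₘ C.poly, by linear_combination -(modByMonic_add_div p C.poly)⟩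
  rw [h3]
  nth_rewrite 1 [eq_X_add_C_of_natDegree_le_one h2]
  simp [ofPoly, yCoord]
  ring

theorem add_mul_yCoord_eq_zero {A B : k[X]} (h : C.ofPoly A + C.ofPoly B * C.yCoord = 0) :
    A = 0 ∧ B = 0 := by
  have e : AdjoinRoot.mk C.poly (Polynomial.C B * X + Polynomial.C A) = 0 := by
    rw [← h]; simp [ofPoly, yCoord]; ring
  have h0 : Polynomial.C B * X + Polynomial.C A = (0 : k[X][X]) := by
    by_contra hne
    refine AdjoinRoot.mk_ne_zero_of_degree_lt C.monic_poly hne ?_ e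
    rw [degree_eq_natDegree C.monic_poly.ne_zero, C.natDegree_poly]
    exact lt_of_le_of_lt degree_linear_le (by norm_num)
  constructor
  · simpa using congrArg (fun p => coeff p 0) h0
  · simpa using congrArg (fun p => coeff p 1) h0

theorem add_mul_yCoord_inj {A B A' B' : k[X]}
    (h : C.ofPoly A + C.ofPoly B * C.yCoord = C.ofPoly A' + C.ofPoly B' * C.yCoord) :
    A = A' ∧ B = B' := by
  have := C.add_mul_yCoord_eq_zero (A := A - A') (B := B - B') (by
    rw [map_sub, map_sub]; linear_combination h)
  exact ⟨sub_eq_zero.1 this.1, sub_eq_zero.1 this.2⟩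

theorem ofPoly_injective : Function.Injective C.ofPoly := fun A A' h =>
  (C.add_mul_yCoord_inj (A := A) (A' := A') (B := 0) (B' := 0) (by simpa using h)).1

variable [CharP k 2]

instance : CharP C.CoordRing 2 :=
  (RingHom.charP_iff_charP (C.ofPoly.comp Polynomial.C) 2).1 inferInstance

/-- Squaring is additive and `y² = h y + f`. The `y`-coefficient of a square is therefore a square
times `h`; this is what makes a constant `h` special. -/
theorem add_mul_yCoord_sq (A B : k[X]) :
    (C.ofPoly A + C.ofPoly B * C.yCoord) ^ 2 =
      C.ofPoly (A ^ 2 + B ^ 2 * C.f) + C.ofPoly (B ^ 2 * C.h) * C.yCoord := by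
  rw [CharTwo.add_sq]
  simp only [map_add, map_mul, map_pow]
  have := C.yCoord_sq
  have h2 : (2 : C.CoordRing) = 0 := CharTwo.two_eq_zero
  linear_combination (C.ofPoly B) ^ 2 * this - (C.ofPoly B) ^ 2 * C.ofPoly C.h * C.yCoord * h2

/-- The curve `y² = f` is singular above every root of `f'`, and `f'` has a root because its
coefficient `5 f₅` in degree 4 is not zero. -/
theorem h_ne_zero [IsAlgClosed k] : C.h ≠ 0 := by
  intro h0
  have hd : C.f.derivative.degree ≠ 0 := by
    intro hd
    have h4 : C.f.derivative.coeff 4 = C.f.coeff 5 * 5 := by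
      rw [coeff_derivative]; norm_num
    have h5 : C.f.coeff 5 ≠ 0 := by
      rw [← C.natDegree_f]
      exact leadingCoeff_ne_zero.2 (fun h => by have := C.natDegree_f; rw [h] at this; simp at this)
    have : (5 : k) ≠ 0 := by
      have : (2 : k) = 0 := CharTwo.two_eq_zero
      have e : (5 : k) = 1 := by linear_combination 2 * this
      rw [e]; exact one_ne_zero
    have h6 : C.f.derivative.coeff 4 = 0 :=
      coeff_eq_zero_of_natDegree_lt (by rw [natDegree_eq_of_degree_eq_some hd]; norm_num)
    rw [h4] at h6
    exact (mul_ne_zero h5 this) h6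
  obtain ⟨a, ha⟩ := IsAlgClosed.exists_root _ hd
  obtain ⟨b, hb⟩ := IsAlgClosed.exists_pow_nat_eq (C.f.eval a) (n := 2) (by norm_num)
  have := C.smooth a b (by rw [h0]; simpa using hb)
  rw [h0] at this
  have h2 : (2 : k) = 0 := CharTwo.two_eq_zero
  rw [IsRoot] at ha
  simp [h2, ha] at this

/-! ### Constant `h`: the coordinate ring over its subring of squares. -/

section ConstantH

variable {C} {c : k}

/-- The `y`-coefficient of the relation is `c (B² + x B'²)`, which kills `B` and `B'`; what remains
is the same relation in `k[x]`. -/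
theorem sq_add_mul_sq_eq_zero (hc : c ≠ 0) (hh : C.h = Polynomial.C c) {p q : C.CoordRing} (h : p ^ 2 + C.ofPoly X * q ^ 2 = 0) :
    p = 0 ∧ q = 0 := by
  obtain ⟨A, B, rfl⟩ := C.exists_eq_add_mul_yCoord p
  obtain ⟨A', B', rfl⟩ := C.exists_eq_add_mul_yCoord q
  rw [C.add_mul_yCoord_sq, C.add_mul_yCoord_sq, hh] at h
  have := C.add_mul_yCoord_eq_zero
    (A := A ^ 2 + B ^ 2 * C.f + X * (A' ^ 2 + B' ^ 2 * C.f))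
    (B := Polynomial.C c * (B ^ 2 + X * B' ^ 2)) (by
      rw [← h]; simp only [map_add, map_mul, map_pow]; ring)
  have hB := sq_add_X_mul_sq_eq_zero
    ((mul_eq_zero.1 this.2).resolve_left (by simpa using hc))
  rw [hB.1, hB.2] at this
  have hA := sq_add_X_mul_sq_eq_zero (P := A) (Q := A') (by simpa using this.1)
  simp [hA.1, hA.2, hB.1, hB.2]

/-- The hypothesis says that `q dx` is fixed by the Cartier operator, which sends `(p² + x q²) dx`
to `q dx`. Degrees exclude a nonzero fixed point, first in the `y`-coefficient and then in the other
one. -/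
theorem eq_zero_of_sq_add_mul_sq_eq_self (hc : c ≠ 0) (hh : C.h = Polynomial.C c) {p q : C.CoordRing}
    (h : p ^ 2 + C.ofPoly X * q ^ 2 = q) : q = 0 := by
  obtain ⟨A, B, rfl⟩ := C.exists_eq_add_mul_yCoord p
  obtain ⟨A', B', rfl⟩ := C.exists_eq_add_mul_yCoord q
  rw [C.add_mul_yCoord_sq, C.add_mul_yCoord_sq, hh] at h
  have := C.add_mul_yCoord_inj
    (A := A ^ 2 + B ^ 2 * C.f + X * (A' ^ 2 + B' ^ 2 * C.f))
    (B := Polynomial.C c * (B ^ 2 + X * B' ^ 2)) (A' := A') (B' := B') (by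
      rw [← h]; simp only [map_add, map_mul, map_pow]; ring)
  have hB' := sq_add_X_mul_sq_eq_self this.2 hc
  rw [hB'] at this
  have hB : B = 0 := by simpa [hc] using this.2
  rw [hB] at this
  have hA := sq_add_X_mul_sq_eq_self (P := A) (Q := A') (c := 1) (by simpa using this.1) one_ne_zero
  simp [hA, hB']

theorem exists_eq_sq_add_mul_sq [IsAlgClosed k] (hc : c ≠ 0) (hh : C.h = Polynomial.C c)
    (r : C.CoordRing) :
    ∃ p q, r = p ^ 2 + C.ofPoly X * q ^ 2 := by
  obtain ⟨A, B, rfl⟩ := C.exists_eq_add_mul_yCoord r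
  obtain ⟨P, Q, hB⟩ := exists_eq_sq_add_X_mul_sq (Polynomial.C c⁻¹ * B)
  have hB' : B = Polynomial.C c * (P ^ 2 + X * Q ^ 2) := by
    rw [← hB, ← mul_assoc, ← Polynomial.C_mul, mul_inv_cancel₀ hc]; simp
  -- Squaring `P y` and `Q y` adds `(P² + x Q²) f` to the part free of `y`; this is compensated in
  -- advance.
  obtain ⟨P', Q', hA⟩ := exists_eq_sq_add_X_mul_sq (A + (P ^ 2 + X * Q ^ 2) * C.f)
  refine ⟨C.ofPoly P' + C.ofPoly P * C.yCoord, C.ofPoly Q' + C.ofPoly Q * C.yCoord, ?_⟩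
  rw [C.add_mul_yCoord_sq, C.add_mul_yCoord_sq, hh, hB']
  have hA' : A = P' ^ 2 + X * Q' ^ 2 + (P ^ 2 + X * Q ^ 2) * C.f := by
    rw [← hA, add_assoc, CharTwo.add_self_eq_zero, add_zero]
  rw [hA']
  simp only [map_add, map_mul, map_pow]
  ring

end ConstantH

end GenusTwoCurve

/-! ### Constant `h`: the Jacobian has no two-torsion. -/

namespace GenusTwoCurve

variable {k : Type*} [Field k] (C : GenusTwoCurve k) [CharP k 2]

/-- The field of rational functions on the curve. -/
abbrev FunctionField : Type _ := FractionRing C.CoordRing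

/-- The fractional ideals of the coordinate ring. -/
abbrev FracIdeal : Type _ := FractionalIdeal (nonZeroDivisors C.CoordRing) C.FunctionField

section ConstantH

variable {C} {c : k}

instance : CharP (C.FunctionField) 2 :=
  charP_of_injective_algebraMap (IsFractionRing.injective C.CoordRing _) 2

theorem fraction_sq_add_mul_sq_eq_zero (hc : c ≠ 0) (hh : C.h = Polynomial.C c)
    {p q : C.FunctionField}
    (h : p ^ 2 + algebraMap _ _ (C.ofPoly X) * q ^ 2 = 0) : p = 0 ∧ q = 0 := by
  obtain ⟨p₁, d₁, hd₁, rfl⟩ := IsFractionRing.div_surjective (A := C.CoordRing) p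
  obtain ⟨q₁, d₂, hd₂, rfl⟩ := IsFractionRing.div_surjective (A := C.CoordRing) q
  have n₁ : algebraMap C.CoordRing (C.FunctionField) d₁ ≠ 0 :=
    IsFractionRing.to_map_ne_zero_of_mem_nonZeroDivisors hd₁
  have n₂ : algebraMap C.CoordRing (C.FunctionField) d₂ ≠ 0 :=
    IsFractionRing.to_map_ne_zero_of_mem_nonZeroDivisors hd₂
  have := sq_add_mul_sq_eq_zero hc hh (p := p₁ * d₂) (q := q₁ * d₁) (by
    apply IsFractionRing.injective C.CoordRing (C.FunctionField)
    simp only [map_add, map_mul, map_pow, map_zero]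
    field_simp at h
    linear_combination h)
  have m₁ : d₁ ≠ 0 := nonZeroDivisors.ne_zero hd₁
  have m₂ : d₂ ≠ 0 := nonZeroDivisors.ne_zero hd₂
  simp only [mul_eq_zero, m₁, m₂, or_false] at this
  simp [this.1, this.2]

/-- Let `I² = (g)` and `g = a² + x b²` with `a, b ∈ I`. Then `dg / g = r dx` with `r = b² / g`
regular. Logarithmic differentials are fixed by the Cartier operator, so `r = p² + x q²` equals `q`.
The fixed point vanishes, hence `b = 0`, `g = a²` and `I = (a)`. -/
theorem jacobian_eq_one_of_sq_eq_one [IsAlgClosed k] (hc : c ≠ 0) (hh : C.h = Polynomial.C c)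
    (D : C.Jacobian) (hD : D ^ 2 = 1) : D = 1 := by
  revert hD
  refine ClassGroup.induction (C.FunctionField) (fun I hD => ?_) D
  set x : C.FunctionField := algebraMap _ _ (C.ofPoly X) with hx
  have dec : ∀ r : C.CoordRing, ∃ p q : C.CoordRing,
      algebraMap C.CoordRing C.FunctionField r = algebraMap _ _ p ^ 2 + x * algebraMap _ _ q ^ 2 := by
    intro r
    obtain ⟨p, q, rfl⟩ := exists_eq_sq_add_mul_sq hc hh r
    exact ⟨p, q, by simp [hx]⟩
  have two : (2 : C.FunctionField) = 0 := CharTwo.two_eq_zero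
  rw [← map_pow, ClassGroup.mk_eq_one_iff] at hD
  obtain ⟨g, hg⟩ := hD.principal
  have hI2 : ((I ^ 2 : (C.FracIdeal)ˣ) : C.FracIdeal) = I * I := by
    rw [pow_two]; rfl
  rw [hI2] at hg
  have mem2 : ∀ u ∈ (I : C.FracIdeal), ∀ v ∈ (I : C.FracIdeal),
      ∃ r : C.CoordRing, u * v = algebraMap _ _ r * g := by
    intro u hu v hv
    have : u * v ∈ Submodule.span C.CoordRing {g} := by
      rw [← hg]; exact FractionalIdeal.mul_mem_mul hu hv
    obtain ⟨r, hr⟩ := Submodule.mem_span_singleton.1 this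
    exact ⟨r, by rw [← hr, Algebra.smul_def]⟩
  have gmem : g ∈ (I : C.FracIdeal) * I := by
    have : g ∈ (((I : C.FracIdeal) * I : C.FracIdeal) : Submodule C.CoordRing C.FunctionField) := by
      rw [hg]; exact Submodule.mem_span_singleton_self g
    exact this
  have ginv : ∀ j ∈ ((I⁻¹ : (C.FracIdeal)ˣ) : C.FracIdeal),
      ∃ r : C.CoordRing, j * j * g = algebraMap _ _ r := by
    intro j hj
    have h1 : j * j * g ∈ (((I⁻¹ : (C.FracIdeal)ˣ) : C.FracIdeal) *
        ((I⁻¹ : (C.FracIdeal)ˣ) : C.FracIdeal)) *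
        ((I : C.FracIdeal) * I) :=
      FractionalIdeal.mul_mem_mul (FractionalIdeal.mul_mem_mul hj hj) gmem
    have h2 : (((I⁻¹ : (C.FracIdeal)ˣ) : C.FracIdeal) *
        ((I⁻¹ : (C.FracIdeal)ˣ) : C.FracIdeal)) *
        ((I : C.FracIdeal) * I) = 1 := by
      rw [← Units.val_mul, ← Units.val_mul, ← Units.val_mul]
      simp
    rw [h2] at h1
    obtain ⟨r, hr⟩ := (FractionalIdeal.mem_one_iff _).1 h1
    exact ⟨r, hr.symm⟩
  have smem : ∀ (r : C.CoordRing) (u : C.FunctionField), u ∈ (I : C.FracIdeal) →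
      u * algebraMap _ _ r ∈ (I : C.FracIdeal) := by
    intro r u hu
    rw [mul_comm, ← Algebra.smul_def]
    exact Submodule.smul_mem (I : C.FracIdeal).1 r hu
  -- Squaring is additive, so it suffices to decompose `z² g` for `z = i j`, where `j² g` lies in
  -- the coordinate ring. The case `z = 1` then splits `g` itself with both components in `I`.
  have key : ∀ z : C.FunctionField, z ∈ (I : C.FracIdeal) *
      ((I⁻¹ : (C.FracIdeal)ˣ) : C.FracIdeal) →
      ∃ a ∈ (I : C.FracIdeal), ∃ b ∈ (I : C.FracIdeal),
        z ^ 2 * g = a ^ 2 + x * b ^ 2 := by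
    intro z hz
    refine FractionalIdeal.mul_induction_on hz ?_ ?_
    · intro i hi j hj
      obtain ⟨r, hr⟩ := ginv j hj
      obtain ⟨p, q, hpq⟩ := dec r
      refine ⟨i * algebraMap _ _ p, smem _ _ hi, i * algebraMap _ _ q, smem _ _ hi, ?_⟩
      linear_combination i ^ 2 * hr + i ^ 2 * hpq
    · rintro z z' ⟨a, ha, b, hb, h⟩ ⟨a', ha', b', hb', h'⟩
      refine ⟨a + a', Submodule.add_mem _ ha ha', b + b', Submodule.add_mem _ hb hb', ?_⟩
      linear_combination h + h' + (z * z' * g - a * a' - x * b * b') * two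
  obtain ⟨a, ha, b, hb, hab⟩ := key 1 (by
    rw [← Units.val_mul, mul_inv_cancel]; exact FractionalIdeal.one_mem_one _)
  rw [one_pow, one_mul] at hab
  have g0 : g ≠ 0 := by
    intro h0
    have h1 : ((I ^ 2 : (C.FracIdeal)ˣ) : C.FracIdeal) = 0 := by
      rw [hI2]
      apply FractionalIdeal.coeToSubmodule_injective
      beta_reduce
      rw [hg, h0]
      simp
    exact (I ^ 2).ne_zero h1
  obtain ⟨r, hr⟩ := mem2 b hb b hb
  obtain ⟨p, q, hpq⟩ := exists_eq_sq_add_mul_sq hc hh r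
  have hpq' : algebraMap C.CoordRing C.FunctionField r = algebraMap _ _ p ^ 2 + x * algebraMap _ _ q ^ 2 := by
    rw [hpq]; simp [hx]
  set p' := algebraMap C.CoordRing C.FunctionField p
  set q' := algebraMap C.CoordRing C.FunctionField q
  -- The product `(p² + x q²)(a² + x b²)` is `(a p + b q x)² + x (b p + a q)²`. As it equals `b²`,
  -- uniqueness gives `a p + b q x = b` and `b p = a q`.
  have e := fraction_sq_add_mul_sq_eq_zero hc hh (p := a * p' + b * q' * x + b)
    (q := b * p' + a * q') (by
      rw [← hx]
      rw [hab, hpq'] at hr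
      linear_combination -hr + (b ^ 2 + a * p' * b * q' * x + a * p' * b + b ^ 2 * q' * x
        + x * b * p' * a * q') * two)
  -- Indeed `b² = b (a p + b q x) = a² q + x b² q = q g`, so `r = q`.
  have hq : algebraMap C.CoordRing C.FunctionField r = q' := by
    apply mul_right_cancel₀ g0
    rw [← hr, hab]
    linear_combination b * e.1 - a * e.2 - (b ^ 2 * q' * x) * two
  have hq0 : q = 0 := eq_zero_of_sq_add_mul_sq_eq_self hc hh (p := p) (by
    rw [← hpq]; exact IsFractionRing.injective C.CoordRing C.FunctionField hq)
  have b0 : b = 0 := by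
    have : b * b = 0 := by rw [hr, hq]; simp [q', hq0]
    simpa using this
  rw [b0] at hab
  have hga : g = a ^ 2 := by rw [hab]; ring
  have a0 : a ≠ 0 := by rintro rfl; exact g0 (by rw [hga]; ring)
  rw [ClassGroup.mk_eq_one_iff]
  refine ⟨a, ?_⟩
  apply le_antisymm
  -- Here `(u / a)²` is regular, say `p² + x q²`; uniqueness over the function field gives `u / a =
  -- p`.
  · intro u hu
    obtain ⟨r, hr⟩ := mem2 u hu u hu
    obtain ⟨p, q, hpq⟩ := dec r
    have e := fraction_sq_add_mul_sq_eq_zero hc hh (p := u / a + algebraMap _ _ p)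
      (q := algebraMap _ _ q) (by
        rw [← hx]
        have : (u / a) ^ 2 = algebraMap _ _ r := by
          field_simp
          rw [← hga]; linear_combination hr
        linear_combination this + hpq + (u / a * algebraMap _ _ p + algebraMap _ _ p ^ 2 +
          x * algebraMap _ _ q ^ 2) * two)
    have : u / a = algebraMap _ _ p := by linear_combination e.1 - algebraMap _ _ p * two
    rw [Submodule.mem_span_singleton]
    refine ⟨p, ?_⟩
    rw [Algebra.smul_def, ← this]
    field_simp
  · rw [Submodule.span_singleton_le_iff_mem]
    exact ha

end ConstantH

end GenusTwoCurve

/-! ### Norms, and the two-torsion classes given by the roots of `h`. -/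

namespace GenusTwoCurve

variable {k : Type*} [Field k] (C : GenusTwoCurve k)

/-- The norm to `k[x]` of `A + B y`. -/
def normForm (A B : k[X]) : k[X] := A ^ 2 + C.h * A * B + B ^ 2 * C.f

/-- The degree of `A²` is even and that of `B² f` is odd, while `h A B` has degree below the mean of
the two. So nothing cancels the larger leading term, and `B² f` already has degree at least 5. -/
theorem five_le_natDegree_normForm {A B : k[X]} (hB : B ≠ 0) :
    5 ≤ (C.normForm A B).natDegree := by
  have hf : C.f ≠ 0 := fun h => by have := C.natDegree_f; rw [h] at this; simp at this
  have h1 : (B ^ 2 * C.f).natDegree = 2 * B.natDegree + 5 := by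
    rw [natDegree_mul (pow_ne_zero _ hB) hf, natDegree_pow, C.natDegree_f]
  have h2 : (A ^ 2).natDegree = 2 * A.natDegree := natDegree_pow _ _
  have h3 : (C.h * A * B).natDegree ≤ 2 + A.natDegree + B.natDegree := by
    have := C.natDegree_h
    have h4 := natDegree_mul_le (p := C.h * A) (q := B)
    have h5 := natDegree_mul_le (p := C.h) (q := A)
    omega
  unfold normForm
  rcases Nat.lt_or_ge (2 * A.natDegree) (2 * B.natDegree + 5) with h | h
  · rw [natDegree_add_eq_right_of_natDegree_lt]
    · omega
    · have := natDegree_add_le (A ^ 2) (C.h * A * B)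
      have : max (A ^ 2).natDegree (C.h * A * B).natDegree < 2 * B.natDegree + 5 :=
        max_lt (by omega) (by omega)
      omega
  · rw [add_assoc, natDegree_add_eq_left_of_natDegree_lt]
    · omega
    · have := natDegree_add_le (C.h * A * B) (B ^ 2 * C.f)
      have : max (C.h * A * B).natDegree (B ^ 2 * C.f).natDegree < 2 * A.natDegree :=
        max_lt (by omega) (by omega)
      omega

variable [CharP k 2]

/-- The hyperelliptic involution. -/
def conj : C.CoordRing →+* C.CoordRing :=
  AdjoinRoot.lift C.ofPoly (C.yCoord + C.ofPoly C.h) (by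
    have h := C.yCoord_sq
    have two : (2 : C.CoordRing) = 0 := CharTwo.two_eq_zero
    simp only [poly, eval₂_add, eval₂_sub, eval₂_mul, eval₂_pow, eval₂_X, eval₂_C]
    linear_combination h + (C.ofPoly C.h * C.yCoord + C.ofPoly C.h ^ 2) * two)

theorem mul_conj (A B : k[X]) :
    (C.ofPoly A + C.ofPoly B * C.yCoord) * C.conj (C.ofPoly A + C.ofPoly B * C.yCoord) =
      C.ofPoly (C.normForm A B) := by
  have h := C.yCoord_sq
  have h1 : ∀ P, C.conj (C.ofPoly P) = C.ofPoly P := fun P => AdjoinRoot.lift_of _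
  have h2 : C.conj C.yCoord = C.yCoord + C.ofPoly C.h := AdjoinRoot.lift_root _
  have two : (2 : C.CoordRing) = 0 := CharTwo.two_eq_zero
  simp only [map_add, map_mul, h1, h2, normForm, map_pow]
  linear_combination (C.ofPoly B) ^ 2 * h + C.ofPoly A * C.ofPoly B * C.yCoord * two

/-- Take norms in `g² ε = d` with `ε` a unit: the norm of the polynomial `d` is `d²`, and the norm
of a unit is a unit. -/
theorem exists_normForm_sq_eq {d : k[X]} {g : C.CoordRing}
    (h : Ideal.span {g} * Ideal.span {g} = Ideal.span {C.ofPoly d}) :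
    ∃ A B n : k[X], IsUnit n ∧ C.normForm A B ^ 2 * n = d ^ 2 := by
  rw [Ideal.span_singleton_mul_span_singleton, Ideal.span_singleton_eq_span_singleton] at h
  obtain ⟨ε, hε⟩ := h
  obtain ⟨A, B, hg⟩ := C.exists_eq_add_mul_yCoord g
  obtain ⟨A₁, B₁, h₁⟩ := C.exists_eq_add_mul_yCoord ε
  obtain ⟨A₂, B₂, h₂⟩ := C.exists_eq_add_mul_yCoord (ε⁻¹ : C.CoordRingˣ)
  have h3 : ∀ P, C.conj (C.ofPoly P) = C.ofPoly P := fun P => AdjoinRoot.lift_of _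
  have e := C.mul_conj A B
  have e₁ := C.mul_conj A₁ B₁
  have e₂ := C.mul_conj A₂ B₂
  rw [← hg] at e
  rw [← h₁] at e₁
  rw [← h₂] at e₂
  refine ⟨A, B, C.normForm A₁ B₁, IsUnit.of_mul_eq_one (C.normForm A₂ B₂) ?_, ?_⟩
  · apply C.ofPoly_injective
    rw [map_mul, ← e₁, ← e₂, map_one]
    have : (ε : C.CoordRing) * (ε⁻¹ : C.CoordRingˣ) = 1 := ε.mul_inv
    calc _ = ((ε : C.CoordRing) * (ε⁻¹ : C.CoordRingˣ)) *
        C.conj ((ε : C.CoordRing) * (ε⁻¹ : C.CoordRingˣ)) := by rw [map_mul]; ring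
      _ = 1 := by rw [this]; simp
  · apply C.ofPoly_injective
    rw [map_mul, map_pow, ← e₁, ← e, map_pow]
    calc _ = (g * g * ε) * C.conj (g * g * ε) := by simp only [map_mul]; ring
      _ = _ := by rw [hε, h3]; ring

omit [CharP k 2] in
theorem natDegree_mul_of_isUnit_right {P n : k[X]} (hn : IsUnit n) :
    (P * n).natDegree = P.natDegree := by
  obtain ⟨c, hc, rfl⟩ := Polynomial.isUnit_iff.1 hn
  exact natDegree_mul_C hc.ne_zero

/-- The norm of `g` would have degree 1. That is below 5, so `B = 0`, and then the norm is `A²`, of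
even degree. -/
theorem not_span_sq_eq_linear {a : k} {g : C.CoordRing} :
    Ideal.span {g} * Ideal.span {g} ≠ Ideal.span {C.ofPoly (X - Polynomial.C a)} := by
  intro h
  obtain ⟨A, B, n, hn, e⟩ := C.exists_normForm_sq_eq h
  have hd := congrArg natDegree e
  rw [natDegree_pow, natDegree_X_sub_C, natDegree_mul_of_isUnit_right hn, natDegree_pow] at hd
  rcases eq_or_ne B 0 with rfl | hB
  · simp [normForm] at hd
  · have := C.five_le_natDegree_normForm (A := A) hB
    omega

/-- The norm of `g` would have degree 2, so `g` would be a polynomial of degree 1 in `x` that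
vanishes at both `a` and `b`. -/
theorem not_span_sq_eq_quadratic {a b : k} (hab : a ≠ b) {g : C.CoordRing} :
    Ideal.span {g} * Ideal.span {g} ≠
      Ideal.span {C.ofPoly ((X - Polynomial.C a) * (X - Polynomial.C b))} := by
  intro h
  obtain ⟨A, B, n, hn, e⟩ := C.exists_normForm_sq_eq h
  have hd := congrArg natDegree e
  rw [natDegree_pow, natDegree_mul (X_sub_C_ne_zero a) (X_sub_C_ne_zero b), natDegree_X_sub_C,
    natDegree_X_sub_C, natDegree_mul_of_isUnit_right hn, natDegree_pow] at hd
  rcases eq_or_ne B 0 with rfl | hB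
  · simp only [normForm, mul_zero, add_zero, ne_eq, OfNat.ofNat_ne_zero, not_false_eq_true,
      zero_pow, zero_mul, natDegree_pow] at hd e
    have hA : A.natDegree = 1 := by omega
    have hr : ∀ t : k, (t - a) * (t - b) = 0 → A.eval t = 0 := by
      intro t ht
      have e1 := congrArg (eval t) e
      simp only [eval_mul, eval_pow, eval_sub, eval_X, eval_C, ht] at e1
      have hn' : n.eval t ≠ 0 := (hn.map (evalRingHom t)).ne_zero
      simpa [hn'] using e1
    have ha := hr a (by simp)
    have hb := hr b (by simp)
    rw [eq_X_add_C_of_natDegree_le_one hA.le] at ha hb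
    simp only [eval_add, eval_mul, eval_C, eval_X] at ha hb
    have h1 : A.coeff 1 ≠ 0 := by
      rw [← hA]
      exact leadingCoeff_ne_zero.2 (fun h0 => by rw [h0] at hA; simp at hA)
    apply hab
    apply mul_left_cancel₀ h1
    linear_combination ha - hb
  · have := C.five_le_natDegree_normForm (A := A) hB
    omega

/-- The ideal of the point `(a, b)`. -/
def pointIdeal (a b : k) : Ideal C.CoordRing :=
  Ideal.span {C.ofPoly (X - Polynomial.C a), C.yCoord - C.ofPoly (Polynomial.C b)}

/-- Over a root of `h` the cover `x` is ramified, so `x - a` has a double zero at the point.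
Dividing `h` and `f - f(a)` by `x - a`, twice, makes this explicit; `h₁(a)` and `f₁(a)` are the
derivatives at `a`. -/
theorem pointIdeal_mul_self {a b : k} (ha : C.h.eval a = 0) (hb : b ^ 2 = C.f.eval a) :
    C.pointIdeal a b * C.pointIdeal a b = Ideal.span {C.ofPoly (X - Polynomial.C a)} := by
  have two : (2 : k) = 0 := CharTwo.two_eq_zero
  have two' : (2 : C.CoordRing) = 0 := CharTwo.two_eq_zero
  have hs := C.smooth a b (by rw [ha, hb]; ring)
  rw [ha, two] at hs
  simp only [zero_mul, add_zero, ne_eq, not_true_eq_false, false_or] at hs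
  obtain ⟨h₁, hh₁⟩ := dvd_iff_isRoot.2 ha
  obtain ⟨f₁, hf₁⟩ := dvd_iff_isRoot.2 (show IsRoot (C.f - Polynomial.C (C.f.eval a)) a by simp)
  obtain ⟨h₂, hh₂⟩ := dvd_iff_isRoot.2 (show IsRoot (h₁ - Polynomial.C (h₁.eval a)) a by simp)
  obtain ⟨f₂, hf₂⟩ := dvd_iff_isRoot.2 (show IsRoot (f₁ - Polynomial.C (f₁.eval a)) a by simp)
  have hd : C.h.derivative.eval a = h₁.eval a := by rw [hh₁]; simp [derivative_mul]
  have fd : C.f.derivative.eval a = f₁.eval a := by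
    have : C.f = (X - Polynomial.C a) * f₁ + Polynomial.C (C.f.eval a) := by rw [← hf₁]; ring
    rw [this]; simp [derivative_mul]
  rw [hd, fd] at hs
  have e1 := congrArg C.ofPoly hh₁
  have e2 := congrArg C.ofPoly hf₁
  have e3 := congrArg C.ofPoly hh₂
  have e4 := congrArg C.ofPoly hf₂
  rw [← hb] at e2
  have hy := C.yCoord_sq
  set x := C.ofPoly (X - Polynomial.C a)
  set y := C.yCoord
  set b' := C.ofPoly (Polynomial.C b)
  rw [map_mul] at e1 e2 e3 e4
  rw [map_sub] at e2 e3 e4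
  have hbb : C.ofPoly (Polynomial.C (b ^ 2)) = b' ^ 2 := by simp [b']
  rw [hbb] at e2
  set m := C.ofPoly (Polynomial.C (h₁.eval a)) with hm
  set l := C.ofPoly (Polynomial.C (f₁.eval a)) with hl
  have key : (y - b') ^ 2 = x * (C.ofPoly h₁ * y + C.ofPoly f₁) := by
    linear_combination hy + y * e1 + e2 - (y * b' - b' ^ 2 + C.ofPoly C.h * y) * two'
  -- With `x` standing for the function `x - a`: modulo `x²` and `x (y - b')`, the square `(y -
  -- b')²` is `(m b' - l) x`. Smoothness makes this constant nonzero, so `x` lies in the square of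
  -- the ideal.
  have key2 : (m * b' - l) * x = (y - b') * (y - b') - (x * x) * (C.ofPoly h₂ * y + C.ofPoly f₂)
      - (x * (y - b')) * m := by
    linear_combination -key - x * y * e3 - x * e4 - x * l * two'
  apply le_antisymm
  · rw [pointIdeal, Ideal.span_pair_mul_span_pair, Ideal.span_le]
    intro z hz
    simp only [Set.mem_insert_iff, Set.mem_singleton_iff] at hz
    rw [SetLike.mem_coe, Ideal.mem_span_singleton]
    rcases hz with rfl | rfl | rfl | rfl
    · exact dvd_mul_right _ _
    · exact dvd_mul_right _ _
    · exact dvd_mul_left _ _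
    · rw [← pow_two, key]; exact dvd_mul_right _ _
  · rw [Ideal.span_singleton_le_iff_mem]
    have m1 : x ∈ C.pointIdeal a b := Ideal.subset_span (by simp [x])
    have m2 : y - b' ∈ C.pointIdeal a b := Ideal.subset_span (by simp [y, b'])
    have hu : C.ofPoly (Polynomial.C (h₁.eval a * b - f₁.eval a)⁻¹) * (m * b' - l) = 1 := by
      rw [hm, hl, ← map_mul, ← map_mul, ← map_sub, ← map_sub, ← map_mul, ← map_mul,
        inv_mul_cancel₀ hs, map_one, map_one]
    have : x = C.ofPoly (Polynomial.C (h₁.eval a * b - f₁.eval a)⁻¹) * ((m * b' - l) * x) := by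
      rw [← mul_assoc, hu, one_mul]
    rw [this, key2]
    refine Ideal.mul_mem_left _ _ (Ideal.sub_mem _ (Ideal.sub_mem _ ?_ ?_) ?_)
    · exact Ideal.mul_mem_mul m2 m2
    · exact Ideal.mul_mem_right _ _ (Ideal.mul_mem_mul m1 m1)
    · exact Ideal.mul_mem_right _ _ (Ideal.mul_mem_mul m1 m2)

omit [CharP k 2] in
theorem exists_unit_eq_coeIdeal {J : Ideal C.CoordRing} {d : C.CoordRing} (hd : d ≠ 0)
    (hJ : J * J = Ideal.span {d}) : ∃ U : C.FracIdealˣ, (U : C.FracIdeal) = (J : C.FracIdeal) := by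
  have hd' : algebraMap C.CoordRing C.FunctionField d ≠ 0 := by simpa using hd
  have : (J : C.FracIdeal) * ((J : C.FracIdeal) *
      FractionalIdeal.spanSingleton _ (algebraMap C.CoordRing C.FunctionField d)⁻¹) = 1 := by
    rw [← mul_assoc, ← FractionalIdeal.coeIdeal_mul, hJ,
      FractionalIdeal.coeIdeal_span_singleton, FractionalIdeal.spanSingleton_mul_spanSingleton,
      mul_inv_cancel₀ hd', FractionalIdeal.spanSingleton_one]
  exact ⟨Units.mkOfMulEqOne _ _ this, rfl⟩

omit [CharP k 2] in
theorem exists_eq_span_of_mk_eq_one {J : Ideal C.CoordRing} {U : C.FracIdealˣ}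
    (hU : (U : C.FracIdeal) = (J : C.FracIdeal)) (h : ClassGroup.mk C.FunctionField U = 1) :
    ∃ g, J = Ideal.span {g} := by
  rw [ClassGroup.mk_eq_one_iff, hU, FractionalIdeal.coe_coeIdeal,
    IsFractionRing.coeSubmodule_isPrincipal] at h
  exact ⟨_, (Ideal.span_singleton_generator J).symm⟩

/-- These are the classes of two ramification points. Each is its own inverse, so if they agreed,
`J₁ J₂` would be principal with square generated by `(x - a)(x - b)`. -/
theorem exists_three_le_twoTorsion [IsAlgClosed k] {a b : k} (hab : a ≠ b) (ha : C.h.eval a = 0)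
    (hb : C.h.eval b = 0) :
    ∃ D₁ D₂ : C.Jacobian, D₁ ^ 2 = 1 ∧ D₂ ^ 2 = 1 ∧ D₁ ≠ 1 ∧ D₂ ≠ 1 ∧ D₁ ≠ D₂ := by
  have hx : ∀ t : k, C.ofPoly (X - Polynomial.C t) ≠ 0 := fun t => by
    rw [Ne, map_eq_zero_iff _ C.ofPoly_injective]; exact X_sub_C_ne_zero t
  have main : ∀ t : k, C.h.eval t = 0 → ∃ (J : Ideal C.CoordRing) (U : C.FracIdealˣ),
      J * J = Ideal.span {C.ofPoly (X - Polynomial.C t)} ∧ (U : C.FracIdeal) = (J : C.FracIdeal) ∧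
      ClassGroup.mk C.FunctionField U ^ 2 = 1 ∧ ClassGroup.mk C.FunctionField U ≠ 1 := by
    intro t ht
    obtain ⟨s, hs⟩ := IsAlgClosed.exists_pow_nat_eq (C.f.eval t) (n := 2) (by norm_num)
    have hJ := C.pointIdeal_mul_self ht hs
    obtain ⟨U, hU⟩ := C.exists_unit_eq_coeIdeal (hx t) hJ
    refine ⟨_, U, hJ, hU, ?_, ?_⟩
    · rw [← map_pow, ClassGroup.mk_eq_one_iff, pow_two, Units.val_mul, hU,
        ← FractionalIdeal.coeIdeal_mul, hJ, FractionalIdeal.coe_coeIdeal,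
        IsFractionRing.coeSubmodule_isPrincipal]
      exact ⟨_, rfl⟩
    · intro h
      obtain ⟨g, hg⟩ := C.exists_eq_span_of_mk_eq_one hU h
      rw [hg] at hJ
      exact C.not_span_sq_eq_linear hJ
  obtain ⟨J₁, U₁, hJ₁, hU₁, s₁, n₁⟩ := main a ha
  obtain ⟨J₂, U₂, hJ₂, hU₂, s₂, n₂⟩ := main b hb
  refine ⟨_, _, s₁, s₂, n₁, n₂, fun h => ?_⟩
  obtain ⟨g, hg⟩ := C.exists_eq_span_of_mk_eq_one (J := J₁ * J₂) (U := U₁ * U₂)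
    (by rw [Units.val_mul, hU₁, hU₂, FractionalIdeal.coeIdeal_mul])
    (by rw [map_mul, ← h, ← pow_two, s₁])
  refine C.not_span_sq_eq_quadratic hab (g := g) ?_
  rw [← hg, mul_mul_mul_comm, hJ₁, hJ₂, Ideal.span_singleton_mul_span_singleton, map_mul]

/-- A two-torsion group of order 2 excludes a constant `h`, where it is trivial, and two distinct
roots, where it has at least three elements including `1`. -/
theorem h_eq_of_hasTwoRank_one [IsAlgClosed k] (hC : C.HasTwoRank 1) :
    ∃ a c : k, c ≠ 0 ∧ (C.h = Polynomial.C c * (X - Polynomial.C a) ∨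
      C.h = Polynomial.C c * (X - Polynomial.C a) ^ 2) := by
  have card : Nat.card {D : C.Jacobian // D ^ 2 = 1} = 2 := by simpa [HasTwoRank] using hC
  have h0 := C.h_ne_zero
  have hdeg : C.h.degree ≠ 0 := by
    intro h
    obtain ⟨c, hc⟩ : ∃ c, C.h = Polynomial.C c := ⟨_, eq_C_of_degree_eq_zero h⟩
    have hc0 : c ≠ 0 := by rintro rfl; simp at hc; exact h0 hc
    have : Subsingleton {D : C.Jacobian // D ^ 2 = 1} := ⟨fun x y => Subtype.ext (by
      rw [jacobian_eq_one_of_sq_eq_one hc0 hc x.1 x.2, jacobian_eq_one_of_sq_eq_one hc0 hc y.1 y.2])⟩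
    have := Finite.card_le_one_iff_subsingleton.2 this
    omega
  obtain ⟨a, ha⟩ := IsAlgClosed.exists_root _ hdeg
  have uniq : ∀ b, C.h.eval b = 0 → b = a := by
    intro b hb
    by_contra hab
    obtain ⟨D₁, D₂, s₁, s₂, n₁, n₂, n⟩ := C.exists_three_le_twoTorsion hab hb ha
    obtain ⟨u, v, huv, hall⟩ := Nat.card_eq_two_iff.1 card
    have m : ∀ D : C.Jacobian, D ^ 2 = 1 → D = u ∨ D = v := by
      intro D hD
      have : (⟨D, hD⟩ : {D : C.Jacobian // D ^ 2 = 1}) ∈ ({u, v} : Set _) := by rw [hall]; trivial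
      rcases this with h | h
      · exact Or.inl (congrArg Subtype.val h)
      · exact Or.inr (congrArg Subtype.val h)
    have m0 := m 1 (one_pow 2)
    have m1 := m D₁ s₁
    have m2 := m D₂ s₂
    grind
  obtain ⟨q, hq⟩ := dvd_iff_isRoot.2 ha
  have q0 : q ≠ 0 := by rintro rfl; simp at hq; exact h0 hq
  have hqd : q.natDegree ≤ 1 := by
    have := C.natDegree_h
    rw [hq, natDegree_mul (X_sub_C_ne_zero a) q0, natDegree_X_sub_C] at this
    omega
  by_cases hqc : q.degree = 0
  · obtain ⟨c, hc⟩ : ∃ c, q = Polynomial.C c := ⟨_, eq_C_of_degree_eq_zero hqc⟩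
    refine ⟨a, c, by rintro rfl; simp at hc; exact q0 hc, Or.inl ?_⟩
    rw [hq, hc]; ring
  · obtain ⟨b, hb⟩ := IsAlgClosed.exists_root _ hqc
    have hba : b = a := uniq b (by rw [hq, eval_mul, hb.eq_zero, mul_zero])
    subst hba
    obtain ⟨r, hr⟩ := dvd_iff_isRoot.2 hb
    have r0 : r ≠ 0 := by rintro rfl; simp at hr; exact q0 hr
    have hrd : r.natDegree = 0 := by
      rw [hr, natDegree_mul (X_sub_C_ne_zero b) r0, natDegree_X_sub_C] at hqd
      omega
    obtain ⟨c, hc⟩ : ∃ c, r = Polynomial.C c := ⟨_, eq_C_of_natDegree_eq_zero hrd⟩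
    refine ⟨b, c, by rintro rfl; simp at hc; exact r0 hc, Or.inr ?_⟩
    rw [hq, hr, hc]; ring

end GenusTwoCurve

end KummerBit

namespace KummerBit

open MvPolynomial

/-! ### The Zariski topology on projective space -/

section Zariski

variable {k : Type*} [Field k] {n : ℕ}

theorem eval_smul_of_isHomogeneous {σ : Type*} {G : MvPolynomial σ k} {d : ℕ}
    (hG : G.IsHomogeneous d) (c : k) (v : σ → k) : eval (c • v) G = c ^ d * eval v G := by
  rw [eval_eq, eval_eq, Finset.mul_sum]
  refine Finset.sum_congr rfl fun m hm => ?_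
  have hd : ∑ i ∈ m.support, m i = d := by
    have := hG (mem_support_iff.1 hm)
    rw [Finsupp.weight_apply, Finsupp.sum] at this
    simpa using this
  simp only [Pi.smul_apply, smul_eq_mul, mul_pow, Finset.prod_mul_distrib]
  rw [Finset.prod_pow_eq_pow_sum, hd]
  ring

theorem eval_rep_eq_zero_iff {G : MvPolynomial (Fin n) k} {d : ℕ} (hG : G.IsHomogeneous d)
    {p : PSpace k n} {v : Fin n → k} {c : k} (hc : c ≠ 0) (hv : v = c • p.rep) :
    eval p.rep G = 0 ↔ eval v G = 0 := by
  rw [hv, eval_smul_of_isHomogeneous hG]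
  simp [hc]

theorem mk_rep_smul {v : Fin n → k} (hv : v ≠ 0) :
    ∃ c : k, c ≠ 0 ∧ v = c • (Projectivization.mk k v hv).rep := by
  obtain ⟨a, ha⟩ := Projectivization.exists_smul_eq_mk_rep k v hv
  refine ⟨(a⁻¹ : kˣ), Units.ne_zero _, ?_⟩
  rw [← ha, ← Units.smul_def, inv_smul_smul]

theorem mk_eq_of_smul {v : Fin n → k} (hv : v ≠ 0) {p : PSpace k n} {c : k} (h : v = c • p.rep) :
    Projectivization.mk k v hv = p := by
  have e := Projectivization.mk_rep p
  rw [← e, Projectivization.mk_eq_mk_iff']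
  exact ⟨c, h.symm⟩

theorem isOpen_eval_ne_zero {G : MvPolynomial (Fin n) k} {d : ℕ} (hG : G.IsHomogeneous d) :
    IsOpen {p : PSpace k n | eval p.rep G ≠ 0} :=
  TopologicalSpace.isOpen_generateFrom_of_mem ⟨G, d, hG, rfl⟩

theorem isClosed_eval_eq_zero {G : MvPolynomial (Fin n) k} {d : ℕ} (hG : G.IsHomogeneous d) :
    IsClosed {p : PSpace k n | eval p.rep G = 0} := by
  rw [← isOpen_compl_iff]
  exact isOpen_eval_ne_zero hG

theorem isTopologicalBasis_zariski :
    TopologicalSpace.IsTopologicalBasis {U : Set (PSpace k n) |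
      ∃ (G : MvPolynomial (Fin n) k) (d : ℕ), G.IsHomogeneous d ∧
        U = {p | eval p.rep G ≠ 0}} where
  exists_subset_inter := by
    rintro _ ⟨G, d, hG, rfl⟩ _ ⟨H, e, hH, rfl⟩ x hx
    refine ⟨_, ⟨G * H, d + e, hG.mul hH, rfl⟩, ?_, ?_⟩
    · simpa using hx
    · intro p hp
      simpa using hp
  sUnion_eq := by
    refine Set.eq_univ_of_forall fun p => Set.mem_sUnion.2 ⟨_, ⟨1, 0, isHomogeneous_one _ _, rfl⟩, ?_⟩
    simp
  eq_generateFrom := rfl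

theorem mem_closure_iff_eval {S : Set (PSpace k n)} {p : PSpace k n} :
    p ∈ closure S ↔ ∀ (G : MvPolynomial (Fin n) k) (d : ℕ), G.IsHomogeneous d →
      (∀ q ∈ S, eval q.rep G = 0) → eval p.rep G = 0 := by
  rw [isTopologicalBasis_zariski.mem_closure_iff]
  constructor
  · intro h G d hG hS
    by_contra hp
    obtain ⟨q, hq, hqS⟩ := h _ ⟨G, d, hG, rfl⟩ hp
    exact hq (hS q hqS)
  · rintro h _ ⟨G, d, hG, rfl⟩ hp
    by_contra hne
    refine hp (h G d hG fun q hq => ?_)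
    by_contra hq'
    exact hne ⟨q, hq', hq⟩

end Zariski

/-! ### The ideal of the quartic surface -/

section Quartic

variable {k : Type*} [Field k]

/-- The value of the quartic form at a vector. -/
def quarticFun (α β : k) (v : Fin 4 → k) : k :=
  β ^ 2 * v 0 ^ 4 + α ^ 2 * v 0 ^ 2 * v 2 ^ 2 + v 0 ^ 2 * v 2 * v 3 + v 0 * v 1 * v 2 ^ 2
    + v 1 ^ 2 * v 3 ^ 2 + v 2 ^ 4

theorem eval_quarticForm (α β : k) (v : Fin 4 → k) :
    eval v (quarticForm α β) = quarticFun α β v := by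
  simp [quarticForm, quarticFun]

theorem quarticForm_isHomogeneous (α β : k) : (quarticForm α β).IsHomogeneous 4 := by
  have hX := fun i => isHomogeneous_X k (i : Fin 4)
  have hC := fun c : k => isHomogeneous_C (Fin 4) c
  unfold quarticForm
  refine (((((IsHomogeneous.add ?_ ?_).add ?_).add ?_).add ?_).add ?_)
  · exact (hC _).mul ((hX 0).pow 4)
  · exact ((hC _).mul ((hX 0).pow 2)).mul ((hX 2).pow 2)
  · exact (((hX 0).pow 2).mul (hX 2)).mul (hX 3)
  · exact ((hX 0).mul (hX 1)).mul ((hX 2).pow 2)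
  · exact ((hX 1).pow 2).mul ((hX 3).pow 2)
  · exact (hX 2).pow 4

theorem mk_mem_quarticSurface {α β : k} {v : Fin 4 → k} (hv : v ≠ 0) :
    Projectivization.mk k v hv ∈ quarticSurface α β ↔ quarticFun α β v = 0 := by
  obtain ⟨c, hc, h⟩ := mk_rep_smul hv
  rw [← eval_quarticForm]
  exact eval_rep_eq_zero_iff (quarticForm_isHomogeneous α β) hc h

/-- Pseudo-division by the quartic form, which is quadratic in the last variable. -/
theorem quarticForm_pseudoDivision (α β : k) (G : MvPolynomial (Fin 4) k) :
    ∃ (m : ℕ) (A B : MvPolynomial (Fin 3) k), quarticForm α β ∣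
      X 1 ^ (2 * m) * G - (rename Fin.castSucc A * X 3 + rename Fin.castSucc B) := by
  have hX : ∀ i : Fin 3, (rename Fin.castSucc (X i : MvPolynomial (Fin 3) k)) =
      X (i.castSucc : Fin 4) := fun i => rename_X _ _
  have h0 : rename Fin.castSucc (X 0 : MvPolynomial (Fin 3) k) = X (0 : Fin 4) := hX 0
  have h1 : rename Fin.castSucc (X 1 : MvPolynomial (Fin 3) k) = X (1 : Fin 4) := hX 1
  have h2 : rename Fin.castSucc (X 2 : MvPolynomial (Fin 3) k) = X (2 : Fin 4) := hX 2
  induction G using MvPolynomial.induction_on with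
  | C a => exact ⟨0, 0, C a, by simp⟩
  | add p q hp hq =>
    obtain ⟨m, A, B, t, ht⟩ := hp
    obtain ⟨m', A', B', t', ht'⟩ := hq
    refine ⟨m + m', X 1 ^ (2 * m') * A + X 1 ^ (2 * m) * A',
      X 1 ^ (2 * m') * B + X 1 ^ (2 * m) * B', X 1 ^ (2 * m') * t + X 1 ^ (2 * m) * t', ?_⟩
    simp only [map_add, map_mul, map_pow, h1, mul_add, pow_add]
    linear_combination X 1 ^ (2 * m') * ht + X 1 ^ (2 * m) * ht'
  | mul_X p i hp =>
    obtain ⟨m, A, B, t, ht⟩ := hp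
    induction i using Fin.lastCases with
    | cast i =>
      refine ⟨m, A * X i, B * X i, t * X i.castSucc, ?_⟩
      simp only [map_mul, hX]
      linear_combination X i.castSucc * ht
    | last =>
      -- Multiplying `A w + B` by `w` creates `A w²`; a further factor `y²` lets the quartic form
      -- replace `y² w²` by terms of degree at most one in `w`.
      refine ⟨m + 1, B * X 1 ^ 2 - A * X 0 ^ 2 * X 2,
        -A * (C (β ^ 2) * X 0 ^ 4 + C (α ^ 2) * X 0 ^ 2 * X 2 ^ 2 + X 0 * X 1 * X 2 ^ 2 + X 2 ^ 4),
        X 1 ^ 2 * t * X 3 + rename Fin.castSucc A, ?_⟩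
      have hl : (X (Fin.last 3) : MvPolynomial (Fin 4) k) = X 3 := rfl
      simp only [map_add, map_sub, map_neg, map_mul, map_pow, h0, h1, h2, rename_C, mul_add,
        pow_add, hl] at ht ⊢
      simp only [quarticForm, map_pow] at ht ⊢
      linear_combination X 1 ^ 2 * X 3 * ht

theorem dvd_of_dvd_prime_pow_mul {R : Type*} [CommRing R] [IsDomain R] {p F G : R} (hp : Prime p)
    (hF : ¬ p ∣ F) {n : ℕ} (h : F ∣ p ^ n * G) : F ∣ G := by
  obtain ⟨q, hq⟩ := h
  obtain ⟨r, rfl⟩ := hp.pow_dvd_of_dvd_mul_left n hF ⟨G, hq.symm⟩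
  refine ⟨r, mul_left_cancel₀ (pow_ne_zero n hp.ne_zero) ?_⟩
  rw [hq]; ring

variable [IsAlgClosed k] [CharP k 2]

omit [CharP k 2] in
theorem exists_quadratic_root {a b c : k} (ha : a ≠ 0) : ∃ t, a * t ^ 2 + b * t + c = 0 := by
  obtain ⟨t, ht⟩ := IsAlgClosed.exists_root
    (Polynomial.C a * Polynomial.X ^ 2 + Polynomial.C b * Polynomial.X + Polynomial.C c)
    (by rw [Polynomial.degree_quadratic ha]; norm_num)
  exact ⟨t, by simpa using ht⟩

/-- A polynomial vanishing on a dense open part of the quartic surface is a multiple of the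
quartic form. -/
theorem quarticForm_dvd_of_vanishing {α β : k} {H : MvPolynomial (Fin 3) k} (hH : H ≠ 0)
    {G : MvPolynomial (Fin 4) k}
    (h : ∀ x y z w : k, x ≠ 0 → y ≠ 0 → z ≠ 0 → eval ![x, y, z] H ≠ 0 →
      quarticFun α β ![x, y, z, w] = 0 → eval ![x, y, z, w] G = 0) :
    quarticForm α β ∣ G := by
  have : Infinite k := IsAlgClosed.instInfinite
  obtain ⟨m, A, B, hAB⟩ := quarticForm_pseudoDivision α β G
  have key : ∀ v : Fin 3 → k, v 0 ≠ 0 → v 1 ≠ 0 → v 2 ≠ 0 → eval v H ≠ 0 →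
      eval v A = 0 ∧ eval v B = 0 := by
    intro v h0 h1 h2 hv
    have ev : v = ![v 0, v 1, v 2] := by ext i; fin_cases i <;> rfl
    rw [ev] at hv ⊢
    set x := v 0
    set y := v 1
    set z := v 2
    have lin : ∀ w, quarticFun α β ![x, y, z, w] = 0 →
        eval ![x, y, z] A * w + eval ![x, y, z] B = 0 := by
      intro w hw
      obtain ⟨t, ht⟩ := hAB
      have e := congrArg (eval ![x, y, z, w]) ht
      have hc : (![x, y, z, w] ∘ Fin.castSucc : Fin 3 → k) = ![x, y, z] := by
        ext i; fin_cases i <;> rfl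
      simp only [map_sub, map_mul, map_add, eval_rename, hc, eval_quarticForm, hw, zero_mul,
        h x y z w h0 h1 h2 hv hw, mul_zero, eval_X] at e
      have : (![x, y, z, w] : Fin 4 → k) 3 = w := rfl
      rw [this] at e
      linear_combination -e
    -- For `x y z ≠ 0` the quartic is quadratic in `w` with the distinct roots `w` and `w + x² z /
    -- y²`; the remainder `A w + B` vanishes at both, hence identically.
    obtain ⟨w, hw⟩ := exists_quadratic_root (a := y ^ 2) (b := x ^ 2 * z)
      (c := β ^ 2 * x ^ 4 + α ^ 2 * x ^ 2 * z ^ 2 + x * y * z ^ 2 + z ^ 4) (pow_ne_zero 2 h1)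
    have l1 := lin w (by simp [quarticFun]; linear_combination hw)
    have l2 := lin (w + x ^ 2 * z / y ^ 2) (by
      simp [quarticFun]
      field_simp
      have two : (2 : k) = 0 := CharTwo.two_eq_zero
      linear_combination y ^ 2 * hw + (x ^ 2 * z * y ^ 2 * w + x ^ 4 * z ^ 2) * two)
    have hA : eval ![x, y, z] A * (x ^ 2 * z / y ^ 2) = 0 := by linear_combination l2 - l1
    have hA' : eval ![x, y, z] A = 0 := by
      have : x ^ 2 * z / y ^ 2 ≠ 0 := by positivity
      simpa [this] using hA
    refine ⟨hA', ?_⟩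
    rw [hA'] at l1
    simpa using l1
  have hne : X 0 * X 1 * X 2 * H ≠ 0 :=
    mul_ne_zero (mul_ne_zero (mul_ne_zero (X_ne_zero _) (X_ne_zero _)) (X_ne_zero _)) hH
  have hz : ∀ P : MvPolynomial (Fin 3) k, (∀ v : Fin 3 → k, v 0 ≠ 0 → v 1 ≠ 0 → v 2 ≠ 0 →
      eval v H ≠ 0 → eval v P = 0) → P = 0 := by
    intro P hP
    have : X 0 * X 1 * X 2 * H * P = 0 := by
      apply MvPolynomial.funext
      intro v
      simp only [map_mul, eval_X, map_zero]
      by_cases hv : v 0 * v 1 * v 2 * eval v H = 0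
      · rw [hv, zero_mul]
      · simp only [mul_eq_zero, not_or] at hv
        rw [hP v hv.1.1.1 hv.1.1.2 hv.1.2 hv.2, mul_zero]
    exact (mul_eq_zero.1 this).resolve_left hne
  have hA := hz A fun v h0 h1 h2 hv => (key v h0 h1 h2 hv).1
  have hB := hz B fun v h0 h1 h2 hv => (key v h0 h1 h2 hv).2
  rw [hA, hB] at hAB
  -- The power of `y` introduced by pseudo-division can be cancelled: the quartic form is nonzero at
  -- `[0, 0, 1, 0]`, so `y` does not divide it.
  refine dvd_of_dvd_prime_pow_mul (p := X 1) (n := 2 * m) X_prime ?_ (by simpa using hAB)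
  rintro ⟨t, ht⟩
  have := congrArg (eval ![0, 0, 1, 0]) ht
  rw [eval_quarticForm] at this
  simp [quarticFun] at this

theorem vanishingIdeal_quarticSurface (α β : k) :
    vanishingIdeal (quarticSurface α β) = Ideal.span {quarticForm α β} := by
  apply le_antisymm
  · refine Ideal.span_le.2 ?_
    rintro G ⟨d, hG, h⟩
    rw [SetLike.mem_coe, Ideal.mem_span_singleton]
    refine quarticForm_dvd_of_vanishing (H := 1) one_ne_zero ?_
    intro x y z w hx _ _ _ hF
    have hv : (![x, y, z, w] : Fin 4 → k) ≠ 0 := fun h => hx (congrFun h 0)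
    obtain ⟨c, hc, e⟩ := mk_rep_smul hv
    exact (eval_rep_eq_zero_iff hG hc e).1 (h _ ((mk_mem_quarticSurface hv).2 hF))
  · refine Ideal.span_le.2 ?_
    rintro _ rfl
    exact Ideal.subset_span ⟨4, quarticForm_isHomogeneous α β, fun p hp => hp⟩

theorem quarticSurface_subset_closure {α β : k} {H : MvPolynomial (Fin 3) k} (hH : H ≠ 0)
    {T : Set (PSpace k 4)}
    (h : ∀ (x y z w : k), x ≠ 0 → y ≠ 0 → z ≠ 0 → eval ![x, y, z] H ≠ 0 →
      quarticFun α β ![x, y, z, w] = 0 → ∀ p : PSpace k 4, ∀ c : k, c ≠ 0 →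
      ![x, y, z, w] = c • p.rep → p ∈ T) :
    quarticSurface α β ⊆ closure T := by
  intro p hp
  rw [mem_closure_iff_eval]
  intro G d hG hT
  obtain ⟨t, rfl⟩ : quarticForm α β ∣ G := by
    refine quarticForm_dvd_of_vanishing hH ?_
    intro x y z w hx hy hz hH hF
    have hv : (![x, y, z, w] : Fin 4 → k) ≠ 0 := fun h => hx (congrFun h 0)
    obtain ⟨c, hc, e⟩ := mk_rep_smul hv
    exact (eval_rep_eq_zero_iff hG hc e).1 (hT _ (h x y z w hx hy hz hH hF _ c hc e))
  rw [map_mul, show eval p.rep (quarticForm α β) = 0 from hp, zero_mul]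

end Quartic

/-! ### Lines and their Plücker coordinates -/

section PluckerCoordinates

variable {k : Type*} [Field k]

theorem minors_smul_add (u v : Fin 4 → k) (a b c d : k) :
    minors (a • u + b • v) (c • u + d • v) = (a * d - b * c) • minors u v := by
  ext i
  fin_cases i <;> simp [minors] <;> ring

theorem linearIndependent_of_minors_ne_zero {u v : Fin 4 → k} (h : minors u v ≠ 0) :
    LinearIndependent k ![u, v] := by
  rw [LinearIndependent.pair_iff]
  intro s t hst
  have e1 := minors_smul_add u v s t 0 1
  have e2 := minors_smul_add u v 1 0 s t
  rw [hst] at e1 e2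
  have z1 : minors (0 : Fin 4 → k) ((0 : k) • u + (1 : k) • v) = 0 := by
    ext i; fin_cases i <;> simp [minors]
  have z2 : minors ((1 : k) • u + (0 : k) • v) (0 : Fin 4 → k) = 0 := by
    ext i; fin_cases i <;> simp [minors]
  rw [z1] at e1
  rw [z2] at e2
  have f1 := (smul_eq_zero.1 e1.symm).resolve_right h
  have f2 := (smul_eq_zero.1 e2.symm).resolve_right h
  constructor
  · simpa using f1
  · simpa using f2

theorem finrank_span_pair {u v : Fin 4 → k} (h : LinearIndependent k ![u, v]) :
    Module.finrank k (Submodule.span k {u, v}) = 2 := by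
  have := finrank_span_eq_card h
  rwa [Matrix.range_cons, Matrix.range_cons, Matrix.range_empty, Set.union_empty,
    Set.singleton_union, Fintype.card_fin] at this

/-- The line through two distinct points. -/
def lineThrough (u v : Fin 4 → k) (h : minors u v ≠ 0) : Line k :=
  ⟨Submodule.span k {u, v}, finrank_span_pair (linearIndependent_of_minors_ne_zero h)⟩

theorem Line.exists_basis (L : Line k) :
    ∃ u v : Fin 4 → k, u ∈ L.1 ∧ v ∈ L.1 ∧ L.1 = Submodule.span k {u, v} ∧
      minors u v = (plucker L).rep := by
  set b := Module.finBasisOfFinrankEq k L.1 L.2 with hb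
  have hspan : L.1 = Submodule.span k {(b 0 : Fin 4 → k), (b 1 : Fin 4 → k)} := by
    have h := b.span_eq
    have h2 := congrArg (Submodule.map L.1.subtype) h
    rw [Submodule.map_span, Submodule.map_top, Submodule.range_subtype, ← Set.range_comp] at h2
    refine h2.symm.trans ?_
    congr 1
    ext x
    simp [Fin.exists_fin_two, eq_comm]
  have hm : minors (b 0 : Fin 4 → k) (b 1 : Fin 4 → k) ≠ 0 := by
    apply minors_ne_zero
    have h := b.linearIndependent.map' L.1.subtype (Submodule.ker_subtype _)
    have e : ![(b 0 : Fin 4 → k), (b 1 : Fin 4 → k)] = L.1.subtype ∘ b := by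
      funext i
      fin_cases i <;> rfl
    rw [e]
    exact h
  have hp : plucker L = Projectivization.mk k (minors (b 0 : Fin 4 → k) (b 1 : Fin 4 → k)) hm := rfl
  obtain ⟨c, hc⟩ := Projectivization.exists_smul_eq_mk_rep k _ hm
  rw [← hp] at hc
  refine ⟨(c : k) • (b 0 : Fin 4 → k), b 1, L.1.smul_mem _ (b 0).2, (b 1).2, ?_, ?_⟩
  · nth_rewrite 1 [hspan]
    rw [Submodule.span_insert, Submodule.span_insert, Submodule.span_singleton_smul_eq c.isUnit]
  · have := minors_smul_add (b 0 : Fin 4 → k) (b 1) c 0 0 1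
    simp only [zero_smul, add_zero, one_smul, zero_add, mul_one, mul_zero, sub_zero] at this
    rw [this, ← hc]; rfl

theorem Line.exists_minors_eq (L : Line k) {u v : Fin 4 → k} (hu : u ∈ L.1) (hv : v ∈ L.1) :
    ∃ c : k, minors u v = c • (plucker L).rep := by
  obtain ⟨u₀, v₀, -, -, hL, hm⟩ := L.exists_basis
  rw [hL, Submodule.mem_span_pair] at hu hv
  obtain ⟨a, b, rfl⟩ := hu
  obtain ⟨c, d, rfl⟩ := hv
  exact ⟨_, by rw [minors_smul_add, hm]⟩

/-- The rows of the skew-symmetric matrix of Plücker coordinates are points of the line. -/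
theorem Line.rows_mem (L : Line k) :
    ![0, (plucker L).rep 0, (plucker L).rep 1, (plucker L).rep 2] ∈ L.1 ∧
    ![-(plucker L).rep 0, 0, (plucker L).rep 3, (plucker L).rep 4] ∈ L.1 ∧
    ![-(plucker L).rep 1, -(plucker L).rep 3, 0, (plucker L).rep 5] ∈ L.1 ∧
    ![-(plucker L).rep 2, -(plucker L).rep 4, -(plucker L).rep 5, 0] ∈ L.1 := by
  obtain ⟨u, v, hu, hv, -, hm⟩ := L.exists_basis
  rw [← hm]
  have h : ∀ i : Fin 4, u i • v - v i • u ∈ L.1 := fun i =>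
    L.1.sub_mem (L.1.smul_mem _ hv) (L.1.smul_mem _ hu)
  refine ⟨?_, ?_, ?_, ?_⟩
  · convert h 0 using 1; ext i; fin_cases i <;> simp [minors] <;> ring
  · convert h 1 using 1; ext i; fin_cases i <;> simp [minors] <;> ring
  · convert h 2 using 1; ext i; fin_cases i <;> simp [minors] <;> ring
  · convert h 3 using 1; ext i; fin_cases i <;> simp [minors] <;> ring

theorem Line.eq_of_le {L L' : Line k} (h : L.1 ≤ L'.1) : L = L' :=
  Subtype.ext (Submodule.eq_of_le_of_finrank_eq h (by rw [L.2, L'.2]))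

theorem Line.eq_lineThrough {L : Line k} {u v : Fin 4 → k} (h : minors u v ≠ 0)
    (hu : u ∈ L.1) (hv : v ∈ L.1) : L = lineThrough u v h := by
  symm
  apply Line.eq_of_le
  rw [lineThrough, Submodule.span_le]
  rintro x (rfl | rfl) <;> assumption

theorem plucker_lineThrough {u v : Fin 4 → k} (h : minors u v ≠ 0) :
    ∃ c : k, c ≠ 0 ∧ minors u v = c • (plucker (lineThrough u v h)).rep := by
  obtain ⟨c, hc⟩ := (lineThrough u v h).exists_minors_eq (u := u) (v := v)
    (Submodule.subset_span (by simp)) (Submodule.subset_span (by simp))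
  refine ⟨c, ?_, hc⟩
  rintro rfl
  exact h (by simpa using hc)

theorem Line.minors_eq_of_span {L : Line k} {u v : Fin 4 → k} (h : L.1 = Submodule.span k {u, v}) :
    ∃ c : k, c ≠ 0 ∧ minors u v = c • (plucker L).rep := by
  obtain ⟨u₀, v₀, hu, hv, -, hm⟩ := L.exists_basis
  rw [h, Submodule.mem_span_pair] at hu hv
  obtain ⟨a, b, rfl⟩ := hu
  obtain ⟨c, d, rfl⟩ := hv
  rw [minors_smul_add] at hm
  have h0 : a * d - b * c ≠ 0 := by
    intro h0
    rw [h0, zero_smul] at hm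
    exact (plucker L).rep_nonzero hm.symm
  exact ⟨_, inv_ne_zero h0, by rw [← hm, inv_smul_smul₀ h0]⟩

theorem Line.exists_minors_ne_zero {L : Line k} {a : Fin 4 → k} (ha : a ∈ L.1) (h0 : a ≠ 0) :
    ∃ v ∈ L.1, minors a v ≠ 0 := by
  obtain ⟨u₀, v₀, hu, hv, hL, hm⟩ := L.exists_basis
  rw [hL, Submodule.mem_span_pair] at ha
  obtain ⟨s, t, rfl⟩ := ha
  have hr := (plucker L).rep_nonzero
  by_cases hs : s = 0
  · refine ⟨u₀, hu, ?_⟩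
    have := minors_smul_add u₀ v₀ s t 1 0
    rw [one_smul, zero_smul, add_zero] at this
    rw [this, hm]
    refine smul_ne_zero ?_ hr
    rintro h
    apply h0
    have ht : t = 0 := by simpa using h
    simp [hs, ht]
  · refine ⟨v₀, hv, ?_⟩
    have := minors_smul_add u₀ v₀ s t 0 1
    rw [one_smul, zero_smul, zero_add] at this
    rw [this, hm]
    refine smul_ne_zero ?_ hr
    simpa using hs

theorem plucker_relation (L : Line k) :
    (plucker L).rep 0 * (plucker L).rep 5 - (plucker L).rep 1 * (plucker L).rep 4 +
      (plucker L).rep 2 * (plucker L).rep 3 = 0 := by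
  obtain ⟨u, v, -, -, -, hm⟩ := L.exists_basis
  rw [← hm]
  simp [minors]
  ring

/-- Every point of the Klein quadric is a line. -/
theorem exists_line_of_plucker_relation {q : Fin 6 → k} (hq : q ≠ 0)
    (h : q 0 * q 5 - q 1 * q 4 + q 2 * q 3 = 0) :
    ∃ (u v : Fin 4 → k) (c : k), c ≠ 0 ∧ minors u v = c • q := by
  by_cases h0 : q 0 = 0
  · by_cases h1 : q 1 = 0
    · by_cases h2 : q 2 = 0
      · by_cases h3 : q 3 = 0
        · by_cases h4 : q 4 = 0
          · have h5 : q 5 ≠ 0 := fun h5 => hq (by ext i; fin_cases i <;> assumption)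
            refine ⟨![0, 0, 1, 0], ![0, 0, 0, q 5], 1, one_ne_zero, ?_⟩
            ext i; fin_cases i <;> simp [minors, h0, h1, h2, h3, h4]
          · refine ⟨![-q 0, 0, q 3, q 4], ![-q 2, -q 4, -q 5, 0], q 4, h4, ?_⟩
            ext i; fin_cases i <;> simp [minors, h0, h1, h2, h3]
        · refine ⟨![-q 0, 0, q 3, q 4], ![-q 1, -q 3, 0, q 5], q 3, h3, ?_⟩
          ext i; fin_cases i <;> simp [minors, h0, h1, h2]; ring
      · refine ⟨![0, q 0, q 1, q 2], ![-q 2, -q 4, -q 5, 0], q 2, h2, ?_⟩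
        rw [h0, h1] at h
        have h3 : q 3 = 0 := by simpa [h2] using h
        ext i; fin_cases i <;> simp [minors, h0, h1, h3]
    · refine ⟨![0, q 0, q 1, q 2], ![-q 1, -q 3, 0, q 5], q 1, h1, ?_⟩
      ext i; fin_cases i <;> simp [minors, h0] <;>
        first | ring1 | linear_combination -h + q 5 * h0 | linear_combination h - q 5 * h0
  · refine ⟨![0, q 0, q 1, q 2], ![-q 0, 0, q 3, q 4], q 0, h0, ?_⟩
    ext i; fin_cases i <;> simp [minors] <;> first | ring1 | linear_combination -h

theorem exists_plucker_eq {p : PSpace k 6}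
    (h : p.rep 0 * p.rep 5 - p.rep 1 * p.rep 4 + p.rep 2 * p.rep 3 = 0) :
    ∃ L : Line k, plucker L = p := by
  obtain ⟨u, v, c, hc, e⟩ := exists_line_of_plucker_relation p.rep_nonzero h
  have hm : minors u v ≠ 0 := by rw [e]; exact smul_ne_zero hc p.rep_nonzero
  refine ⟨lineThrough u v hm, ?_⟩
  obtain ⟨d, hd, e'⟩ := plucker_lineThrough hm
  rw [← mk_eq_of_smul hm e', mk_eq_of_smul hm e]

theorem Line.forall_minors_iff (L : Line k) (i : Fin 6) :
    (∀ u ∈ L.1, ∀ v ∈ L.1, minors u v i = 0) ↔ (plucker L).rep i = 0 := by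
  constructor
  · intro h
    obtain ⟨u, v, hu, hv, -, hm⟩ := L.exists_basis
    rw [← hm]; exact h u hu v hv
  · intro h u hu v hv
    obtain ⟨c, hc⟩ := L.exists_minors_eq hu hv
    rw [hc]; simp [h]

theorem Line.forall_minors_sub_iff (L : Line k) (i j : Fin 6) :
    (∀ u ∈ L.1, ∀ v ∈ L.1, minors u v i = minors u v j) ↔
      (plucker L).rep i = (plucker L).rep j := by
  constructor
  · intro h
    obtain ⟨u, v, hu, hv, -, hm⟩ := L.exists_basis
    rw [← hm]; exact h u hu v hv
  · intro h u hu v hv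
    obtain ⟨c, hc⟩ := L.exists_minors_eq hu hv
    rw [hc]; simp [h]

theorem isClosed_plucker {G : MvPolynomial (Fin 6) k} {d : ℕ} (hG : G.IsHomogeneous d) :
    IsClosed {L : Line k | eval (plucker L).rep G = 0} :=
  (isClosed_eval_eq_zero hG).preimage continuous_induced_dom

/-- A family of lines whose Plücker coordinates are polynomial functions of parameters lies in
the closure of any of its subsets that contains the lines with general parameters. -/
theorem subset_closure_of_parametrization [Infinite k] {m : ℕ}
    {P : Fin 6 → MvPolynomial (Fin m) k}
    {H : MvPolynomial (Fin m) k} (hH : H ≠ 0) {S T : Set (Line k)}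
    (hS : ∀ L ∈ S, ∃ (v : Fin m → k) (c : k), c ≠ 0 ∧
      (fun i => eval v (P i)) = c • (plucker L).rep)
    (hT : ∀ v : Fin m → k, eval v H ≠ 0 → ∃ L ∈ T, ∃ c : k, c ≠ 0 ∧
      (fun i => eval v (P i)) = c • (plucker L).rep) : S ⊆ closure T := by
  intro L hL
  rw [closure_induced (f := plucker), mem_closure_iff_eval]
  intro G d hG hGT
  -- The pulled-back form vanishes wherever `H` does not, so its product with `H` is the zero
  -- polynomial.
  have hz : H * aeval P G = 0 := by
    apply MvPolynomial.funext
    intro v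
    rw [map_mul, map_zero]
    by_cases hv : eval v H = 0
    · rw [hv, zero_mul]
    · obtain ⟨L', hL', c, hc, e⟩ := hT v hv
      have h1 := (eval_rep_eq_zero_iff hG hc e).1 (hGT _ ⟨L', hL', rfl⟩)
      have h2 : eval v (aeval P G) = eval (fun i => eval v (P i)) G := by
        rw [← aeval_eq_eval, ← aeval_eq_eval, ← AlgHom.comp_apply, comp_aeval]
      rw [h2, h1, mul_zero]
  have hz' := (mul_eq_zero.1 hz).resolve_left hH
  obtain ⟨v, c, hc, e⟩ := hS L hL
  rw [eval_rep_eq_zero_iff hG hc e]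
  have h2 : eval v (aeval P G) = eval (fun i => eval v (P i)) G := by
    rw [← aeval_eq_eval, ← aeval_eq_eval, ← AlgHom.comp_apply, comp_aeval]
  rw [← h2, hz', map_zero]

/-- The family behaves like the image of an affine space: open sets meeting it contain basic ones
whose forms pull back to nonzero polynomials, and the product of two of these with `H` is nonzero
because the polynomial ring is a domain. -/
theorem isIrreducible_of_parametrization [Infinite k] {m : ℕ}
    {P : Fin 6 → MvPolynomial (Fin m) k}
    {H : MvPolynomial (Fin m) k} (hH : H ≠ 0) {S : Set (Line k)}
    (hS : ∀ L ∈ S, ∃ (v : Fin m → k) (c : k), c ≠ 0 ∧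
      (fun i => eval v (P i)) = c • (plucker L).rep)
    (hT : ∀ v : Fin m → k, eval v H ≠ 0 → ∃ L ∈ S, ∃ c : k, c ≠ 0 ∧
      (fun i => eval v (P i)) = c • (plucker L).rep) : IsIrreducible S := by
  have h2 : ∀ v G, eval v (aeval P G) = eval (fun i => eval v (P i)) G := by
    intro v G
    rw [← aeval_eq_eval, ← aeval_eq_eval, ← AlgHom.comp_apply, comp_aeval]
  constructor
  · by_contra hne
    rw [Set.not_nonempty_iff_eq_empty] at hne
    apply hH
    apply MvPolynomial.funext
    intro v
    rw [map_zero]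
    by_contra hv
    obtain ⟨L, hL, -⟩ := hT v hv
    rw [hne] at hL
    exact hL
  · have hb := (isTopologicalBasis_zariski (k := k) (n := 6)).induced (plucker (k := k))
    have hw : ∀ U : Set (Line k), IsOpen U → (S ∩ U).Nonempty →
        ∃ (G : MvPolynomial (Fin 6) k) (d : ℕ), G.IsHomogeneous d ∧ aeval P G ≠ 0 ∧
          ∀ L : Line k, eval (plucker L).rep G ≠ 0 → L ∈ U := by
      rintro U hU ⟨L, hLS, hLU⟩
      obtain ⟨_, ⟨_, ⟨G, d, hG, rfl⟩, rfl⟩, hL, hsub⟩ := hb.exists_subset_of_mem_open hLU hU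
      refine ⟨G, d, hG, ?_, fun L' hL' => hsub hL'⟩
      intro h0
      obtain ⟨v, c, hc, e⟩ := hS L hLS
      apply hL
      rw [eval_rep_eq_zero_iff hG hc e, ← h2, h0, map_zero]
    intro U V hU hV hSU hSV
    obtain ⟨G₁, d₁, hG₁, n₁, s₁⟩ := hw U hU hSU
    obtain ⟨G₂, d₂, hG₂, n₂, s₂⟩ := hw V hV hSV
    have hne : H * aeval P G₁ * aeval P G₂ ≠ 0 := mul_ne_zero (mul_ne_zero hH n₁) n₂
    obtain ⟨v, hv⟩ : ∃ v, eval v (H * aeval P G₁ * aeval P G₂) ≠ 0 := by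
      by_contra hcon
      push Not at hcon
      exact hne (MvPolynomial.funext fun v => by rw [hcon v, map_zero])
    simp only [map_mul, mul_ne_zero_iff, h2] at hv
    obtain ⟨L, hL, c, hc, e⟩ := hT v hv.1.1
    refine ⟨L, hL, s₁ L ?_, s₂ L ?_⟩
    · rw [Ne, eval_rep_eq_zero_iff hG₁ hc e]; exact hv.1.2
    · rw [Ne, eval_rep_eq_zero_iff hG₂ hc e]; exact hv.2

end PluckerCoordinates

/-- An irreducible subset of a finite union of closed sets lies in one of them, so the maximal ones
are found among the four pieces; incomparability makes each piece maximal. -/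
theorem componentsOf_eq_of_four {T : Type*} [TopologicalSpace T] {A B₁ B₂ B₃ B₄ : Set T}
    (hA : A = B₁ ∪ B₂ ∪ B₃ ∪ B₄)
    (c₁ : IsClosed B₁) (c₂ : IsClosed B₂) (c₃ : IsClosed B₃) (c₄ : IsClosed B₄)
    (i₁ : IsIrreducible B₁) (i₂ : IsIrreducible B₂) (i₃ : IsIrreducible B₃)
    (i₄ : IsIrreducible B₄)
    (h : ∀ X ∈ ({B₁, B₂, B₃, B₄} : Set (Set T)), ∀ Y ∈ ({B₁, B₂, B₃, B₄} : Set (Set T)),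
      X ⊆ Y → X = Y) :
    componentsOf A = {B₁, B₂, B₃, B₄} := by
  classical
  have hirr : ∀ X ∈ ({B₁, B₂, B₃, B₄} : Set (Set T)), X ⊆ A ∧ IsIrreducible X := by
    rintro X (rfl | rfl | rfl | rfl) <;> refine ⟨?_, by assumption⟩ <;> rw [hA] <;>
      intro t ht <;> simp [ht]
  have hle : ∀ Y, Y ⊆ A → IsIrreducible Y → ∃ X ∈ ({B₁, B₂, B₃, B₄} : Set (Set T)), Y ⊆ X := by
    intro Y hY hYi
    rw [isIrreducible_iff_sUnion_isClosed] at hYi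
    obtain ⟨X, hX, hYX⟩ := hYi {B₁, B₂, B₃, B₄} (by
      intro z hz
      simp only [Finset.mem_insert, Finset.mem_singleton] at hz
      rcases hz with rfl | rfl | rfl | rfl <;> assumption) (by
      rw [hA] at hY
      intro t ht
      rcases hY ht with ((h | h) | h) | h
      all_goals simp [h])
    exact ⟨X, by simpa using hX, hYX⟩
  ext X
  constructor
  · intro hX
    obtain ⟨Y, hY, hXY⟩ := hle X hX.1.1 hX.1.2
    have := hX.2 (hirr Y hY) hXY
    rw [show X = Y from Set.Subset.antisymm hXY this]
    exact hY
  · intro hX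
    refine ⟨hirr X hX, fun Y hY hXY => ?_⟩
    obtain ⟨Z, hZ, hYZ⟩ := hle Y hY.1 hY.2
    rw [h X hX Z hZ (hXY.trans hYZ)]
    exact hYZ

/-! ### The bitangent lines of the quartic surface -/

section BitangentLines

variable {k : Type*} [Field k]

theorem eval_restrictLine (u v : Fin 4 → k) (G : MvPolynomial (Fin 4) k) (p : Fin 2 → k) :
    eval p (restrictLine u v G) = eval (p 0 • u + p 1 • v) G := by
  rw [restrictLine, ← aeval_eq_eval, ← aeval_eq_eval, ← AlgHom.comp_apply, comp_aeval]
  congr 2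
  ext i
  simp
  ring

/-- The coefficient of `s³t` in the restriction of the quartic form to `s u + t v`. -/
def oddCoeff (u v : Fin 4 → k) : k :=
  u 0 ^ 2 * (v 2 * u 3 + u 2 * v 3) + u 2 ^ 2 * (v 0 * u 1 + u 0 * v 1)

/-- The coefficient of `s²t²` in the restriction of the quartic form to `s u + t v`. -/
def midCoeff (α : k) (u v : Fin 4 → k) : k :=
  α ^ 2 * (u 0 ^ 2 * v 2 ^ 2 + v 0 ^ 2 * u 2 ^ 2) + (u 0 ^ 2 * v 2 * v 3 + v 0 ^ 2 * u 2 * u 3)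
    + (u 2 ^ 2 * v 0 * v 1 + v 2 ^ 2 * u 0 * u 1) + (u 1 ^ 2 * v 3 ^ 2 + v 1 ^ 2 * u 3 ^ 2)

/-- In characteristic 2 `oddCoeff u v` is `u₀² p₃₄ + u₂² p₁₂`. A change of basis scales the Plücker
coordinates by the determinant, and squares are additive in `u`. -/
theorem oddCoeff_combination [CharP k 2] {u v : Fin 4 → k} (h : oddCoeff u v = 0)
    (h' : oddCoeff v u = 0) (a b c d : k) : oddCoeff (a • u + b • v) (c • u + d • v) = 0 := by
  simp only [oddCoeff, Pi.add_apply, Pi.smul_apply, smul_eq_mul] at h h' ⊢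
  grind

variable [CharP k 2]

theorem quarticFun_smul_add (α β : k) (u v : Fin 4 → k) (s t : k) :
    quarticFun α β (s • u + t • v) = quarticFun α β u * s ^ 4 + oddCoeff u v * s ^ 3 * t +
      midCoeff α u v * s ^ 2 * t ^ 2 + oddCoeff v u * s * t ^ 3 + quarticFun α β v * t ^ 4 := by
  have two : (2 : k) = 0 := CharTwo.two_eq_zero
  simp only [quarticFun, oddCoeff, midCoeff, Pi.add_apply, Pi.smul_apply, smul_eq_mul]
  grind

variable [IsAlgClosed k]

theorem restrictLine_quarticForm (α β : k) (u v : Fin 4 → k) :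
    restrictLine u v (quarticForm α β) = C (quarticFun α β u) * X 0 ^ 4 +
      C (oddCoeff u v) * X 0 ^ 3 * X 1 + C (midCoeff α u v) * X 0 ^ 2 * X 1 ^ 2 +
      C (oddCoeff v u) * X 0 * X 1 ^ 3 + C (quarticFun α β v) * X 1 ^ 4 := by
  have : Infinite k := IsAlgClosed.instInfinite
  apply MvPolynomial.funext
  intro p
  rw [eval_restrictLine, eval_quarticForm, quarticFun_smul_add]
  simp

omit [CharP k 2] in
-- This splits the binary quadratic form with coefficients `a`, `b`, `c` into two linear forms.
theorem exists_factorization (a b c : k) :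
    ∃ p q r s : k, a = p * r ∧ b = p * s + q * r ∧ c = q * s := by
  by_cases ha : a = 0
  · exact ⟨0, 1, b, c, by simp [ha], by simp, by simp⟩
  · obtain ⟨t, ht⟩ := exists_quadratic_root (b := b) (c := c) ha
    exact ⟨1, -t, a, b + a * t, by ring, by ring, by linear_combination ht⟩

/-- Both partial derivatives of a constant times a square vanish in characteristic 2; evaluated at
`[1, 0]` and `[0, 1]`, they give the two odd coefficients. -/
theorem oddCoeff_eq_zero_of_sq {α β : k} {u v : Fin 4 → k} {m : MvPolynomial (Fin 2) k} {c : k}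
    (h : restrictLine u v (quarticForm α β) = C c * m ^ 2) :
    oddCoeff u v = 0 ∧ oddCoeff v u = 0 := by
  have two : (2 : MvPolynomial (Fin 2) k) = 0 := CharTwo.two_eq_zero
  have two' : (2 : k) = 0 := CharTwo.two_eq_zero
  rw [restrictLine_quarticForm] at h
  have hp : ∀ i, pderiv i (C c * m ^ 2) = 0 := by
    intro i
    simp [two]
  have h0 := congrArg (pderiv 0) h
  have h1 := congrArg (pderiv 1) h
  rw [hp] at h0 h1
  simp only [map_add, pderiv_mul, pderiv_C, pderiv_pow, pderiv_X_self,
    pderiv_X_of_ne (show (1 : Fin 2) ≠ 0 by decide),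
    pderiv_X_of_ne (show (0 : Fin 2) ≠ 1 by decide)] at h0 h1
  constructor
  · have := congrArg (eval ![1, 0]) h1
    simpa using this
  · have := congrArg (eval ![0, 1]) h0
    simpa using this

/-- The divisors `2a + 2b` are those of squares of binary quadratic forms. Over a perfect field of
characteristic 2 a binary quartic without `s³t` and `st³` is such a square, its root being taken
coefficientwise; the zero quartic corresponds to a line inside the surface. -/
theorem mem_Bit_quarticSurface_iff {α β : k} {L : Line k} :
    L ∈ Bit (quarticSurface α β) ↔ ∀ u ∈ L.1, ∀ v ∈ L.1, oddCoeff u v = 0 := by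
  have : Infinite k := IsAlgClosed.instInfinite
  have fin : ∀ u v : Fin 4 → k, L.1 = Submodule.span k {u, v} → oddCoeff u v = 0 →
      oddCoeff v u = 0 → ∀ u ∈ L.1, ∀ v ∈ L.1, oddCoeff u v = 0 := by
    intro u v hL h h' a ha b hb
    rw [hL, Submodule.mem_span_pair] at ha hb
    obtain ⟨_, _, rfl⟩ := ha
    obtain ⟨_, _, rfl⟩ := hb
    exact oddCoeff_combination h h' _ _ _ _
  constructor
  · rintro (h | ⟨u, v, hL, l₁, l₂, hl₁, n₁, hl₂, n₂, hdvd⟩)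
    · obtain ⟨u, v, hu, hv, hL, -⟩ := L.exists_basis
      have hz : restrictLine u v (quarticForm α β) = C 0 * 0 ^ 2 := by
        apply MvPolynomial.funext
        intro p
        rw [eval_restrictLine, eval_quarticForm]
        simp only [map_zero, zero_mul]
        by_cases hw : p 0 • u + p 1 • v = 0
        · rw [hw]; simp [quarticFun]
        · refine (mk_mem_quarticSurface hw).1 (h _ ?_)
          rw [Projectivization.submodule_mk, Submodule.span_singleton_le_iff_mem]
          exact L.1.add_mem (L.1.smul_mem _ hu) (L.1.smul_mem _ hv)
      have := oddCoeff_eq_zero_of_sq hz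
      exact fin u v hL this.1 this.2
    · obtain ⟨q, hq⟩ := hdvd (quarticForm α β) (by
        rw [vanishingIdeal_quarticSurface]; exact Ideal.mem_span_singleton_self _)
      -- Both the restriction and `(l₁ l₂)²` are homogeneous of degree 4, so the cofactor is a
      -- constant.
      have hsq : ∃ c : k, q = C c ∨ restrictLine u v (quarticForm α β) = 0 := by
        by_cases hR : restrictLine u v (quarticForm α β) = 0
        · exact ⟨0, Or.inr hR⟩
        have hm : (l₁ * l₂) ^ 2 ≠ 0 := pow_ne_zero _ (mul_ne_zero n₁ n₂)
        have q0 : q ≠ 0 := by rintro rfl; exact hR (by rw [hq, mul_zero])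
        have hd := totalDegree_mul_of_isDomain hm q0
        have d1 : ((l₁ * l₂) ^ 2).totalDegree = 4 := ((hl₁.mul hl₂).pow 2).totalDegree hm
        have d2 : (restrictLine u v (quarticForm α β)).totalDegree = 4 := by
          refine IsHomogeneous.totalDegree ?_ hR
          rw [restrictLine_quarticForm]
          have hX := fun i => isHomogeneous_X k (i : Fin 2)
          have hC := fun c : k => isHomogeneous_C (Fin 2) c
          exact ((((((hC _).mul ((hX 0).pow 4)).add (((hC _).mul ((hX 0).pow 3)).mul (hX 1))).add
            (((hC _).mul ((hX 0).pow 2)).mul ((hX 1).pow 2))).add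
            (((hC _).mul (hX 0)).mul ((hX 1).pow 3))).add ((hC _).mul ((hX 1).pow 4)))
        rw [← hq, d1, d2] at hd
        exact ⟨_, Or.inl (totalDegree_eq_zero_iff_eq_C.1 (by omega))⟩
      obtain ⟨c, rfl | h0⟩ := hsq
      · have := oddCoeff_eq_zero_of_sq (hq.trans (mul_comm _ _))
        exact fin u v hL this.1 this.2
      · have := oddCoeff_eq_zero_of_sq (c := 0) (m := 0) (h0.trans (by simp))
        exact fin u v hL this.1 this.2
  · intro h
    obtain ⟨u, v, hu, hv, hL, -⟩ := L.exists_basis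
    obtain ⟨a, ha⟩ := IsAlgClosed.exists_pow_nat_eq (quarticFun α β u) (n := 2) (by norm_num)
    obtain ⟨b, hb⟩ := IsAlgClosed.exists_pow_nat_eq (midCoeff α u v) (n := 2) (by norm_num)
    obtain ⟨c, hc⟩ := IsAlgClosed.exists_pow_nat_eq (quarticFun α β v) (n := 2) (by norm_num)
    obtain ⟨p, q, r, s, rfl, rfl, rfl⟩ := exists_factorization a b c
    have hR : restrictLine u v (quarticForm α β) =
        ((C p * X 0 + C q * X 1) * (C r * X 0 + C s * X 1)) ^ 2 := by
      rw [restrictLine_quarticForm, h u hu v hv, h v hv u hu, ← ha, ← hb, ← hc]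
      have two : (2 : MvPolynomial (Fin 2) k) = 0 := CharTwo.two_eq_zero
      simp only [map_add, map_mul, map_pow, map_zero]
      grind
    by_cases h0 : (C p * X 0 + C q * X 1 : MvPolynomial (Fin 2) k) * (C r * X 0 + C s * X 1) = 0
    · left
      intro x hx
      change eval x.rep (quarticForm α β) = 0
      have hxL : x.rep ∈ L.1 := by
        apply hx
        rw [Projectivization.submodule_eq]
        exact Submodule.mem_span_singleton_self _
      rw [hL, Submodule.mem_span_pair] at hxL
      obtain ⟨i, j, e⟩ := hxL
      have := eval_restrictLine u v (quarticForm α β) ![i, j]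
      rw [hR, h0] at this
      rw [← e]
      simpa using this.symm
    · right
      have hX := fun i => isHomogeneous_X k (i : Fin 2)
      have hC := fun c : k => isHomogeneous_C (Fin 2) c
      rw [mul_eq_zero, not_or] at h0
      refine ⟨u, v, hL, _, _, ?_, h0.1, ?_, h0.2, ?_⟩
      · exact ((hC p).mul (hX 0)).add ((hC q).mul (hX 1))
      · exact ((hC r).mul (hX 0)).add ((hC s).mul (hX 1))
      · intro G hG
        rw [vanishingIdeal_quarticSurface, Ideal.mem_span_singleton] at hG
        obtain ⟨t, rfl⟩ := hG
        rw [map_mul, ← hR]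
        exact dvd_mul_right _ _

/-- The lines meeting both `x = y = 0` and `z = w = 0`. -/
def quadricLines (k : Type*) [Field k] : Set (Line k) :=
  {L | (plucker L).rep 0 = 0 ∧ (plucker L).rep 5 = 0}

/-- The lines with Plücker coordinates `p₁₃ = 0` and `p₁₄ = p₂₃`. -/
def coneLines (k : Type*) [Field k] : Set (Line k) :=
  {L | (plucker L).rep 1 = 0 ∧ (plucker L).rep 2 = (plucker L).rep 3}

/-- The condition is `u₀² p₃₄ + u₂² p₁₂ = 0` on `L`. If `p₁₃ ≠ 0`, then `u₀` and `u₂` are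
independent on `L`, so `p₁₂ = p₃₄ = 0`. If `p₁₃ = 0`, they are proportional; when neither vanishes
identically the condition becomes `p₁₄ = p₂₃`. -/
theorem Bit_quarticSurface (α β : k) :
    Bit (quarticSurface α β) =
      betaPlane (Pi.single 0 1) ∪ betaPlane (Pi.single 2 1) ∪ quadricLines k ∪ coneLines k := by
  ext L
  rw [mem_Bit_quarticSurface_iff]
  constructor
  · intro h
    by_cases h0 : ∀ v ∈ L.1, v 0 = 0
    · exact Or.inl (Or.inl (Or.inl fun v hv => by simpa using h0 v hv))
    by_cases h2 : ∀ v ∈ L.1, v 2 = 0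
    · exact Or.inl (Or.inl (Or.inr fun v hv => by simpa using h2 v hv))
    push Not at h0 h2
    obtain ⟨a, ha, ha0⟩ := h0
    obtain ⟨b, hb, hb2⟩ := h2
    by_cases h1 : (plucker L).rep 1 = 0
    · right
      refine ⟨h1, ?_⟩
      rw [← L.forall_minors_iff] at h1
      have e := h1 a ha b hb
      obtain ⟨v, hv, hm⟩ := L.exists_minors_ne_zero ha (fun h => ha0 (by rw [h]; rfl))
      obtain ⟨c, hc⟩ := L.exists_minors_eq ha hv
      have c0 : c ≠ 0 := by rintro rfl; exact hm (by simpa using hc)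
      have ev := h1 a ha v hv
      have hodd := h a ha v hv
      have h2 := congrFun hc 2
      have h3 := congrFun hc 3
      simp [minors, oddCoeff] at e ev hodd h2 h3
      apply mul_left_cancel₀ c0
      rw [← h2, ← h3]
      have ha2 : a 2 ≠ 0 := by
        intro h
        rw [h] at e
        simp [ha0, hb2] at e
      apply mul_left_cancel₀ (mul_ne_zero ha0 ha2)
      grind
    · left; right
      obtain ⟨u, v, hu, hv, -, hm⟩ := L.exists_basis
      set D := (plucker L).rep 1 with hD
      -- This basis of `L` has `(x, z)`-coordinates `(D, 0)` and `(0, D)`; the two odd coefficients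
      -- then reduce to `D³` times a single coordinate each.
      have hu' : v 2 • u + (-u 2) • v ∈ L.1 := L.1.add_mem (L.1.smul_mem _ hu) (L.1.smul_mem _ hv)
      have hv' : (-v 0) • u + u 0 • v ∈ L.1 := L.1.add_mem (L.1.smul_mem _ hu) (L.1.smul_mem _ hv)
      have hmm := minors_smul_add u v (v 2) (-u 2) (-v 0) (u 0)
      have e1 : u 0 * v 2 - u 2 * v 0 = D := by rw [hD, ← hm]; simp [minors]
      have e2 : v 2 * u 0 - -u 2 * -v 0 = D := by rw [← e1]; ring
      rw [e2, hm] at hmm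
      have o1 := h _ hu' _ hv'
      have o2 := h _ hv' _ hu'
      set u' := v 2 • u + (-u 2) • v with hu'd
      set v' := (-v 0) • u + u 0 • v with hv'd
      have c1 : u' 0 = D := by rw [hu'd, ← e1]; simp; ring
      have c2 : u' 2 = 0 := by rw [hu'd]; simp; ring
      have c3 : v' 0 = 0 := by rw [hv'd]; simp; ring
      have c4 : v' 2 = D := by rw [hv'd, ← e1]; simp; ring
      simp [oddCoeff, c1, c2, c3, c4, h1] at o1 o2
      have m0 := congrFun hmm 0
      have m5 := congrFun hmm 5
      simp [minors, c1, c2, c3, c4, o1, o2, h1] at m0 m5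
      exact ⟨m0, m5⟩
  · rintro (((h | h) | ⟨h0, h5⟩) | ⟨h1, h2⟩) u hu v hv
    · have e1 := h u hu
      have e2 := h v hv
      simp at e1 e2
      simp [oddCoeff, e1, e2]
    · have e1 := h u hu
      have e2 := h v hv
      simp at e1 e2
      simp [oddCoeff, e1, e2]
    · rw [← L.forall_minors_iff] at h0 h5
      have e1 := h0 u hu v hv
      have e2 := h5 u hu v hv
      simp [minors] at e1 e2
      simp only [oddCoeff]
      grind
    · rw [← L.forall_minors_iff] at h1
      rw [← L.forall_minors_sub_iff] at h2
      have e1 := h1 u hu v hv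
      have e2 := h2 u hu v hv
      simp [minors] at e1 e2
      simp only [oddCoeff]
      grind

end BitangentLines

/-! ### The components of the bitangent surface -/

section Components

variable {k : Type*} [Field k]

theorem evalMap_sigma₁ (β : k) (v : Fin 4 → k) :
    evalMap (sigma₁ β) v =
      ![v 0 * v 2 ^ 2, v 1 * v 2 ^ 2, β * v 0 ^ 2 * v 2, β * v 0 ^ 2 * v 3] := by
  ext i; fin_cases i <;> simp [evalMap, sigma₁]

theorem evalMap_sigma₂ (v : Fin 4 → k) :
    evalMap sigma₂ v = ![v 0 ^ 2 * v 2, v 0 ^ 2 * v 3, v 0 * v 2 ^ 2, v 1 * v 2 ^ 2] := by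
  ext i; fin_cases i <;> simp [evalMap, sigma₂]

/-- The map `σ₁` multiplies `(x, y)` by `z²` and `(z, w)` by `β x²`, so it moves the point along the
line joining `[x, y, 0, 0]` and `[0, 0, z, w]`, whose coordinates appear on the right. -/
theorem minors_sigma₁ (β : k) (v : Fin 4 → k) :
    minors v (evalMap (sigma₁ β) v) = (β * v 0 ^ 2 - v 2 ^ 2) •
      ![0, v 0 * v 2, v 0 * v 3, v 1 * v 2, v 1 * v 3, 0] := by
  rw [evalMap_sigma₁]
  ext i; fin_cases i <;> simp [minors] <;> ring

/-- Up to a factor that vanishes at fixed points, the line depends only on `x`, `z` and `x w + y z`.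
These become the parameters of the cone. -/
theorem minors_sigma₂ [CharP k 2] (v : Fin 4 → k) :
    minors v (evalMap sigma₂ v) = (v 0 * v 3 + v 1 * v 2) •
      ![v 0 ^ 2, 0, v 0 * v 2, v 0 * v 2, v 0 * v 3 + v 1 * v 2, v 2 ^ 2] := by
  rw [evalMap_sigma₂]
  ext i; fin_cases i <;> simp [minors] <;> grind

/-- For the skew-symmetric Plücker matrix `M` of the basis `u`, `v` one has `aᵀ M = (a·u) v - (a·v)
u`. This vanishes exactly when `a` kills the line, and it is linear in the Plücker coordinates. -/
theorem isClosed_betaPlane (a : Fin 4 → k) : IsClosed (betaPlane a) := by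
  have h : betaPlane a = ⋂ j : Fin 4, {L : Line k | eval (plucker L).rep
      (∑ i : Fin 4, C (a i) * (![![0, X 0, X 1, X 2], ![-X 0, 0, X 3, X 4], ![-X 1, -X 3, 0, X 5],
        ![-X 2, -X 4, -X 5, 0]] i j : MvPolynomial (Fin 6) k)) = 0} := by
    ext L
    simp only [Set.mem_iInter, Set.mem_ofPred_eq]
    obtain ⟨u, v, hu, hv, hL, hm⟩ := L.exists_basis
    have key : ∀ j : Fin 4, eval (plucker L).rep
      (∑ i : Fin 4, C (a i) * (![![0, X 0, X 1, X 2], ![-X 0, 0, X 3, X 4], ![-X 1, -X 3, 0, X 5],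
        ![-X 2, -X 4, -X 5, 0]] i j : MvPolynomial (Fin 6) k)) =
        (a ⬝ᵥ u) * v j - (a ⬝ᵥ v) * u j := by
      intro j
      rw [← hm]
      fin_cases j <;> simp [Fin.sum_univ_four, dotProduct, minors] <;> ring
    constructor
    · intro h j
      rw [key, h u hu, h v hv]; ring
    · intro h
      have hli := linearIndependent_of_minors_ne_zero (u := u) (v := v)
        (by rw [hm]; exact (plucker L).rep_nonzero)
      rw [LinearIndependent.pair_iff] at hli
      have := hli (-(a ⬝ᵥ v)) (a ⬝ᵥ u) (by
        ext j
        have := h j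
        rw [key] at this
        simp only [Pi.add_apply, Pi.smul_apply, smul_eq_mul, Pi.zero_apply]
        linear_combination this)
      intro w hw
      rw [hL, Submodule.mem_span_pair] at hw
      obtain ⟨s, t, rfl⟩ := hw
      rw [dotProduct_add, dotProduct_smul, dotProduct_smul, this.2, neg_eq_zero.1 this.1]
      simp
  rw [h]
  refine isClosed_iInter fun j => isClosed_plucker (d := 1) ?_
  refine IsHomogeneous.sum _ _ _ fun i _ => ?_
  refine IsHomogeneous.mul (m := 0) (n := 1) (isHomogeneous_C _ _) ?_
  have hX := fun i => isHomogeneous_X k (i : Fin 6)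
  have h0 : (0 : MvPolynomial (Fin 6) k).IsHomogeneous 1 := isHomogeneous_zero _ _ _
  fin_cases i <;> fin_cases j <;>
    first | exact h0 | exact hX _ | exact (hX _).neg

theorem isClosed_quadricLines : IsClosed (quadricLines k) := by
  have h : quadricLines k = {L | eval (plucker L).rep (X 0) = 0} ∩
      {L | eval (plucker L).rep (X 5) = 0} := by
    ext L; simp [quadricLines]
  rw [h]
  exact (isClosed_plucker (isHomogeneous_X k _)).inter (isClosed_plucker (isHomogeneous_X k _))

theorem isClosed_coneLines : IsClosed (coneLines k) := by
  have h : coneLines k = {L | eval (plucker L).rep (X 1) = 0} ∩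
      {L | eval (plucker L).rep (X 2 - X 3) = 0} := by
    ext L; simp [coneLines, sub_eq_zero]
  rw [h]
  exact (isClosed_plucker (isHomogeneous_X k _)).inter
    (isClosed_plucker ((isHomogeneous_X k _).sub (isHomogeneous_X k _)))

/-- A line of `quadricLines` joins a point of `z = w = 0` and a point of `x = y = 0`. -/
theorem exists_of_mem_quadricLines {L : Line k} (hL : L ∈ quadricLines k) :
    ∃ x y z w : k, (x ≠ 0 ∨ y ≠ 0) ∧ (z ≠ 0 ∨ w ≠ 0) ∧ ![x, y, 0, 0] ∈ L.1 ∧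
      ![0, 0, z, w] ∈ L.1 := by
  obtain ⟨h0, h5⟩ := hL
  rw [← L.forall_minors_iff] at h0 h5
  -- If the minor `(i, j)` vanishes on `L`, the projection of `L` to these two coordinates has rank
  -- at most one and hence a nonzero kernel.
  have main : ∀ i j : Fin 4, (∀ u ∈ L.1, ∀ v ∈ L.1, u i * v j = u j * v i) →
      ∃ u ∈ L.1, u ≠ 0 ∧ u i = 0 ∧ u j = 0 := by
    intro i j h
    obtain ⟨u, v, hu, hv, -, hm⟩ := L.exists_basis
    have hli := linearIndependent_of_minors_ne_zero (u := u) (v := v)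
      (by rw [hm]; exact (plucker L).rep_nonzero)
    rw [LinearIndependent.pair_iff] at hli
    have hu0 : u ≠ 0 := fun h0 => one_ne_zero (hli 1 0 (by simp [h0])).1
    by_cases hui : u i = 0
    · by_cases huj : u j = 0
      · exact ⟨u, hu, hu0, hui, huj⟩
      · refine ⟨(-v j) • u + u j • v, L.1.add_mem (L.1.smul_mem _ hu) (L.1.smul_mem _ hv),
          fun h0 => huj (hli _ _ h0).2, ?_, ?_⟩
        · have := h u hu v hv
          simp only [Pi.add_apply, Pi.smul_apply, smul_eq_mul]
          linear_combination -this
        · simp; ring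
    · refine ⟨(-v i) • u + u i • v, L.1.add_mem (L.1.smul_mem _ hu) (L.1.smul_mem _ hv),
          fun h0 => hui (hli _ _ h0).2, ?_, ?_⟩
      · simp; ring
      · have := h u hu v hv
        simp only [Pi.add_apply, Pi.smul_apply, smul_eq_mul]
        linear_combination this
  obtain ⟨u, hu, u0, u2, u3⟩ := main 2 3 (fun u hu v hv => by
    have := h5 u hu v hv
    simp [minors] at this
    linear_combination this)
  obtain ⟨v, hv, v0, v1, v2⟩ := main 0 1 (fun u hu v hv => by
    have := h0 u hu v hv
    simp [minors] at this
    linear_combination this)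
  have eu : u = ![u 0, u 1, 0, 0] := by ext i; fin_cases i <;> simp [u2, u3]
  have ev : v = ![0, 0, v 2, v 3] := by ext i; fin_cases i <;> simp [v1, v2]
  refine ⟨u 0, u 1, v 2, v 3, ?_, ?_, eu ▸ hu, ev ▸ hv⟩
  · by_contra! hcon
    apply u0
    rw [eu, hcon.1, hcon.2]; ext i; fin_cases i <;> rfl
  · by_contra! hcon
    apply v0
    rw [ev, hcon.1, hcon.2]; ext i; fin_cases i <;> rfl

/-- The Plücker coordinates of the line joining `[x, y, 0, 0]` and `[0, 0, z, w]`. -/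
def quadricParam (k : Type*) [Field k] : Fin 6 → MvPolynomial (Fin 4) k :=
  ![0, X 0 * X 2, X 0 * X 3, X 1 * X 2, X 1 * X 3, 0]

/-- The Plücker coordinates of the lines of the quadric cone. -/
def coneParam (k : Type*) [Field k] : Fin 6 → MvPolynomial (Fin 3) k :=
  ![X 0 ^ 2, 0, X 0 * X 2, X 0 * X 2, X 1, X 2 ^ 2]

theorem eval_quadricParam (v : Fin 4 → k) : (fun i => eval v (quadricParam k i)) =
    ![0, v 0 * v 2, v 0 * v 3, v 1 * v 2, v 1 * v 3, 0] := by
  ext i; fin_cases i <;> simp [quadricParam]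

theorem eval_coneParam (v : Fin 3 → k) : (fun i => eval v (coneParam k i)) =
    ![v 0 ^ 2, 0, v 0 * v 2, v 0 * v 2, v 1, v 2 ^ 2] := by
  ext i; fin_cases i <;> simp [coneParam]

theorem quadricLines_parametrization {L : Line k} (hL : L ∈ quadricLines k) :
    ∃ (v : Fin 4 → k) (c : k), c ≠ 0 ∧
      (fun i => eval v (quadricParam k i)) = c • (plucker L).rep := by
  obtain ⟨x, y, z, w, hxy, hzw, hu, hv⟩ := exists_of_mem_quadricLines hL
  obtain ⟨c, hc⟩ := L.exists_minors_eq hu hv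
  have e : minors ![x, y, 0, 0] ![0, 0, z, w] = ![0, x * z, x * w, y * z, y * w, 0] := by
    ext i; fin_cases i <;> simp [minors]
  refine ⟨![x, y, z, w], c, ?_, ?_⟩
  · rintro rfl
    rw [e, zero_smul] at hc
    have h1 := congrFun hc 1
    have h2 := congrFun hc 2
    have h3 := congrFun hc 3
    have h4 := congrFun hc 4
    simp at h1 h2 h3 h4
    tauto
  · rw [eval_quadricParam, ← hc, e]; rfl

variable [CharP k 2] [IsAlgClosed k]

/-- On these lines the Plücker relation is `p₁₂ p₃₄ = p₁₄²`. Square roots are unique in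
characteristic 2, so roots `x`, `z` of `p₁₂`, `p₃₄` satisfy `x z = p₁₄` without a choice of sign. -/
theorem coneLines_parametrization {L : Line k} (hL : L ∈ coneLines k) :
    ∃ (v : Fin 3 → k) (c : k), c ≠ 0 ∧
      (fun i => eval v (coneParam k i)) = c • (plucker L).rep := by
  obtain ⟨h1, h2⟩ := hL
  have hr := plucker_relation L
  obtain ⟨x, hx⟩ := IsAlgClosed.exists_pow_nat_eq ((plucker L).rep 0) (n := 2) (by norm_num)
  obtain ⟨z, hz⟩ := IsAlgClosed.exists_pow_nat_eq ((plucker L).rep 5) (n := 2) (by norm_num)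
  have hxz : x * z = (plucker L).rep 2 := by
    rw [h1, ← h2, ← hx, ← hz] at hr
    have two : (2 : k) = 0 := CharTwo.two_eq_zero
    have : (x * z - (plucker L).rep 2) ^ 2 = 0 := by
      linear_combination hr - x * z * (plucker L).rep 2 * two
    exact sub_eq_zero.1 (pow_eq_zero_iff (two_ne_zero)|>.1 this)
  refine ⟨![x, (plucker L).rep 4, z], 1, one_ne_zero, ?_⟩
  rw [eval_coneParam]
  ext i; fin_cases i <;> simp [hx, hz, hxz, h1, h2]

/-- At the point `[a x, a y, z, w]` of the line the quartic is the square of `β x² a² + e a + z²`. A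
root `a` gives a point of the surface, and `e ≠ 0`, which is `hq`, keeps it from being fixed by
`σ₁`. -/
theorem exists_sigma₁_line (α : k) {β : k} (hβ : β ≠ 0) {x y z w : k} (hx : x ≠ 0) (hz : z ≠ 0)
    (hq : α ^ 2 * x ^ 2 * z ^ 2 + x ^ 2 * z * w + x * y * z ^ 2 + y ^ 2 * w ^ 2 ≠ 0) :
    ∃ L : Line k, (∃ p ∈ quarticSurface α β,
      L.1 = Submodule.span k {p.rep, evalMap (sigma₁ β) p.rep}) ∧
      ∃ c : k, c ≠ 0 ∧ ![0, x * z, x * w, y * z, y * w, 0] = c • (plucker L).rep := by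
  obtain ⟨e, he⟩ := IsAlgClosed.exists_pow_nat_eq
    (α ^ 2 * x ^ 2 * z ^ 2 + x ^ 2 * z * w + x * y * z ^ 2 + y ^ 2 * w ^ 2) (n := 2) (by norm_num)
  have e0 : e ≠ 0 := by rintro rfl; exact hq (by rw [← he]; ring)
  obtain ⟨a, ha⟩ := exists_quadratic_root (a := β * x ^ 2) (b := e) (c := z ^ 2)
    (mul_ne_zero hβ (pow_ne_zero 2 hx))
  have a0 : a ≠ 0 := by rintro rfl; apply hz; simpa using ha
  have hv : (![a * x, a * y, z, w] : Fin 4 → k) ≠ 0 := fun h => hz (congrFun h 2)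
  have hF : quarticFun α β ![a * x, a * y, z, w] = 0 := by
    have : quarticFun α β ![a * x, a * y, z, w] = (β * x ^ 2 * a ^ 2 + e * a + z ^ 2) ^ 2 := by
      simp [quarticFun]
      grind
    rw [this, ha]; ring
  set p := Projectivization.mk k _ hv
  obtain ⟨c, hc, hcv⟩ := mk_rep_smul hv
  have hr : p.rep = c⁻¹ • ![a * x, a * y, z, w] := by
    rw [hcv, inv_smul_smul₀ hc]
  have hm := minors_sigma₁ β p.rep
  have hd : β * p.rep 0 ^ 2 - p.rep 2 ^ 2 = c⁻¹ ^ 2 * (-e * a) := by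
    rw [hr]
    simp
    have two : (2 : k) = 0 := CharTwo.two_eq_zero
    linear_combination (c ^ 2)⁻¹ * ha - (c ^ 2)⁻¹ * z ^ 2 * two
  have hw : ![0, p.rep 0 * p.rep 2, p.rep 0 * p.rep 3, p.rep 1 * p.rep 2, p.rep 1 * p.rep 3, 0] =
      (c⁻¹ ^ 2 * a) • ![0, x * z, x * w, y * z, y * w, 0] := by
    rw [hr]
    ext i; fin_cases i <;> simp <;> ring
  rw [hd, hw, smul_smul] at hm
  have hn : c⁻¹ ^ 2 * (-e * a) * (c⁻¹ ^ 2 * a) ≠ 0 := by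
    simp [hc, e0, a0]
  have hmne : minors p.rep (evalMap (sigma₁ β) p.rep) ≠ 0 := by
    rw [hm]
    refine smul_ne_zero hn fun h => ?_
    have := congrFun h 1
    simp [hx, hz] at this
  refine ⟨lineThrough _ _ hmne, ⟨p, (mk_mem_quarticSurface hv).2 hF, rfl⟩, ?_⟩
  obtain ⟨d, hd0, hd⟩ := plucker_lineThrough hmne
  refine ⟨(c⁻¹ ^ 2 * (-e * a) * (c⁻¹ ^ 2 * a))⁻¹ * d, mul_ne_zero (inv_ne_zero hn) hd0, ?_⟩
  rw [mul_smul, ← hd, hm, inv_smul_smul₀ hn]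

/-- Once `x`, `z` and `m = x w + y z` are given, the quartic equation determines `(y w)²`, hence `r
= y w`. Then `y z` and `x w` have sum `m` and product `r x z`, so they are the roots of `t² + m t +
r x z`. -/
theorem exists_sigma₂_line (α β : k) {x z m : k} (hx : x ≠ 0) (hz : z ≠ 0) (hm0 : m ≠ 0) :
    ∃ L : Line k, (∃ p ∈ quarticSurface α β,
      L.1 = Submodule.span k {p.rep, evalMap sigma₂ p.rep}) ∧
      ∃ c : k, c ≠ 0 ∧ ![x ^ 2, 0, x * z, x * z, m, z ^ 2] = c • (plucker L).rep := by
  obtain ⟨r, hr⟩ := IsAlgClosed.exists_pow_nat_eq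
    (β ^ 2 * x ^ 4 + α ^ 2 * x ^ 2 * z ^ 2 + x * z * m + z ^ 4) (n := 2) (by norm_num)
  obtain ⟨t, ht⟩ := exists_quadratic_root (a := (1 : k)) (b := m) (c := r * x * z) one_ne_zero
  have two : (2 : k) = 0 := CharTwo.two_eq_zero
  obtain ⟨y, hy⟩ : ∃ y, y * z = t := ⟨t / z, by field_simp⟩
  obtain ⟨w, hw⟩ : ∃ w, x * w = m + t := ⟨(m + t) / x, by field_simp⟩
  have hmw : x * w + y * z = m := by rw [hw, hy]; linear_combination t * two
  have hyw : y * w = r := by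
    apply mul_left_cancel₀ (mul_ne_zero hx hz)
    linear_combination x * w * hy + t * hw + ht - r * x * z * two
  have hv : (![x, y, z, w] : Fin 4 → k) ≠ 0 := fun h => hx (congrFun h 0)
  have hF : quarticFun α β ![x, y, z, w] = 0 := by
    simp [quarticFun]
    linear_combination (y * w + r) * hyw + hr + x * z * hmw
      + (β ^ 2 * x ^ 4 + α ^ 2 * x ^ 2 * z ^ 2 + x * z * m + z ^ 4) * two
  set p := Projectivization.mk k _ hv
  obtain ⟨c, hc, hcv⟩ := mk_rep_smul hv
  have hr : p.rep = c⁻¹ • ![x, y, z, w] := by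
    rw [hcv, inv_smul_smul₀ hc]
  have hm := minors_sigma₂ p.rep
  have hd : p.rep 0 * p.rep 3 + p.rep 1 * p.rep 2 = c⁻¹ ^ 2 * m := by
    rw [hr, ← hmw]
    simp
    ring
  have hw : ![p.rep 0 ^ 2, 0, p.rep 0 * p.rep 2, p.rep 0 * p.rep 2,
      p.rep 0 * p.rep 3 + p.rep 1 * p.rep 2, p.rep 2 ^ 2] =
      (c⁻¹ ^ 2) • ![x ^ 2, 0, x * z, x * z, m, z ^ 2] := by
    rw [hd, hr]
    ext i; fin_cases i <;> simp <;> ring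
  rw [hw, hd, smul_smul] at hm
  have hn : c⁻¹ ^ 2 * m * c⁻¹ ^ 2 ≠ 0 := by
    simp [hc, hm0]
  have hmne : minors p.rep (evalMap sigma₂ p.rep) ≠ 0 := by
    rw [hm]
    refine smul_ne_zero hn fun h => ?_
    have := congrFun h 0
    simp [hx] at this
  refine ⟨lineThrough _ _ hmne, ⟨p, (mk_mem_quarticSurface hv).2 hF, rfl⟩, ?_⟩
  obtain ⟨d, hd0, hd⟩ := plucker_lineThrough hmne
  refine ⟨(c⁻¹ ^ 2 * m * c⁻¹ ^ 2)⁻¹ * d, mul_ne_zero (inv_ne_zero hn) hd0, ?_⟩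
  rw [mul_smul, ← hd, hm, inv_smul_smul₀ hn]

end Components

/-! ### The congruences of `σ₁` and `σ₂`, and irreducibility of the four families. -/

section Congruences

variable {k : Type*} [Field k] [CharP k 2] [IsAlgClosed k]

omit [CharP k 2] [IsAlgClosed k] in
theorem exists_sigma₁_open_ne_zero (α : k) : ∃ H : MvPolynomial (Fin 4) k, H ≠ 0 ∧
    ∀ v : Fin 4 → k, eval v H ≠ 0 → v 0 ≠ 0 ∧ v 2 ≠ 0 ∧
      α ^ 2 * v 0 ^ 2 * v 2 ^ 2 + v 0 ^ 2 * v 2 * v 3 + v 0 * v 1 * v 2 ^ 2 +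
        v 1 ^ 2 * v 3 ^ 2 ≠ 0 := by
  refine ⟨X 0 * X 2 * (C (α ^ 2) * X 0 ^ 2 * X 2 ^ 2 + X 0 ^ 2 * X 2 * X 3 + X 0 * X 1 * X 2 ^ 2 +
    X 1 ^ 2 * X 3 ^ 2), ?_, ?_⟩
  · intro h
    -- At this point the polynomial takes the value 1.
    have := congrArg (eval ![1, 1 - α ^ 2, 1, 0]) h
    simp at this
  · intro v hv
    simp only [map_mul, map_add, map_pow, eval_X, eval_C, mul_ne_zero_iff] at hv
    exact ⟨hv.1.1, hv.1.2, hv.2⟩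

theorem involutionCongruence_sigma₁ (α : k) {β : k} (hβ : β ≠ 0) :
    involutionCongruence (quarticSurface α β) (sigma₁ β) = quadricLines k := by
  have : Infinite k := IsAlgClosed.instInfinite
  apply Set.Subset.antisymm
  · refine closure_minimal ?_ isClosed_quadricLines
    rintro L ⟨p, -, hL⟩
    obtain ⟨c, hc, e⟩ := Line.minors_eq_of_span hL
    rw [minors_sigma₁] at e
    have e0 := congrFun e 0
    have e5 := congrFun e 5
    simp [hc] at e0 e5
    exact ⟨e0, e5⟩
  · obtain ⟨H, hH, hv⟩ := exists_sigma₁_open_ne_zero α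
    refine subset_closure_of_parametrization (P := quadricParam k) hH
      (fun L hL => quadricLines_parametrization hL) fun v h => ?_
    obtain ⟨h0, h2, hq⟩ := hv v h
    obtain ⟨L, hL, c, hc, e⟩ := exists_sigma₁_line α hβ h0 h2 hq
    exact ⟨L, hL, c, hc, by rw [eval_quadricParam, e]⟩

theorem involutionCongruence_sigma₂ (α β : k) :
    involutionCongruence (quarticSurface α β) sigma₂ = coneLines k := by
  have : Infinite k := IsAlgClosed.instInfinite
  apply Set.Subset.antisymm
  · refine closure_minimal ?_ isClosed_coneLines
    rintro L ⟨p, -, hL⟩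
    obtain ⟨c, hc, e⟩ := Line.minors_eq_of_span hL
    rw [minors_sigma₂] at e
    have e1 := congrFun e 1
    have e2 := congrFun e 2
    have e3 := congrFun e 3
    simp [hc] at e1 e2 e3
    exact ⟨e1, mul_left_cancel₀ hc (e2.symm.trans e3)⟩
  · refine subset_closure_of_parametrization (P := coneParam k) (H := X 0 * X 1 * X 2)
      (by simp [X_ne_zero]) (fun L hL => coneLines_parametrization hL) fun v h => ?_
    simp only [map_mul, eval_X, mul_ne_zero_iff] at h
    obtain ⟨L, hL, c, hc, e⟩ := exists_sigma₂_line α β h.1.1 h.2 h.1.2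
    exact ⟨L, hL, c, hc, by rw [eval_coneParam, e]⟩

theorem isIrreducible_quadricLines : IsIrreducible (quadricLines k) := by
  have : Infinite k := IsAlgClosed.instInfinite
  -- The family does not depend on `α` and `β`; the values `0` and `1` serve to produce its general
  -- lines.
  obtain ⟨H, hH, hv⟩ := exists_sigma₁_open_ne_zero (0 : k)
  refine isIrreducible_of_parametrization (P := quadricParam k) hH
    (fun L hL => quadricLines_parametrization hL) fun v h => ?_
  obtain ⟨h0, h2, hq⟩ := hv v h
  obtain ⟨L, hL, c, hc, e⟩ := exists_sigma₁_line 0 one_ne_zero h0 h2 hq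
  refine ⟨L, ?_, c, hc, by rw [eval_quadricParam, e]⟩
  rw [← involutionCongruence_sigma₁ 0 one_ne_zero]
  exact subset_closure hL

theorem isIrreducible_coneLines : IsIrreducible (coneLines k) := by
  have : Infinite k := IsAlgClosed.instInfinite
  refine isIrreducible_of_parametrization (P := coneParam k) (H := X 0 * X 1 * X 2)
    (by simp [X_ne_zero]) (fun L hL => coneLines_parametrization hL) fun v h => ?_
  simp only [map_mul, eval_X, mul_ne_zero_iff] at h
  obtain ⟨L, hL, c, hc, e⟩ := exists_sigma₂_line 0 1 h.1.1 h.2 h.1.2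
  refine ⟨L, ?_, c, hc, by rw [eval_coneParam, e]⟩
  rw [← involutionCongruence_sigma₂ 0 1]
  exact subset_closure hL

omit [CharP k 2] in
theorem isIrreducible_betaPlane_zero :
    IsIrreducible (betaPlane (Pi.single 0 1 : Fin 4 → k)) := by
  have : Infinite k := IsAlgClosed.instInfinite
  refine isIrreducible_of_parametrization (m := 3) (P := ![0, 0, 0, X 0, X 1, X 2]) (H := X 0)
    (X_ne_zero _) (fun L hL => ?_) fun v h => ?_
  · obtain ⟨u, v, hu, hv, -, hm⟩ := L.exists_basis
    have e1 := hL u hu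
    have e2 := hL v hv
    simp at e1 e2
    refine ⟨![(plucker L).rep 3, (plucker L).rep 4, (plucker L).rep 5], 1, one_ne_zero, ?_⟩
    rw [← hm]
    ext i; fin_cases i <;> simp [minors, e1, e2]
  · rw [eval_X] at h
    have e : minors ![0, 1, 0, -v 2 / v 0] ![0, 0, v 0, v 1] = ![0, 0, 0, v 0, v 1, v 2] := by
      ext i; fin_cases i <;> simp [minors]; field_simp
    have hm : minors ![0, 1, 0, -v 2 / v 0] ![0, 0, v 0, v 1] ≠ 0 := by
      rw [e]; exact fun h' => h (congrFun h' 3)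
    refine ⟨lineThrough _ _ hm, ?_, ?_⟩
    · intro w hw
      obtain ⟨a, b, rfl⟩ := Submodule.mem_span_pair.1 hw
      simp
    · obtain ⟨c, hc, e'⟩ := plucker_lineThrough hm
      refine ⟨c, hc, ?_⟩
      rw [← e', e]
      ext i; fin_cases i <;> simp

omit [CharP k 2] in
theorem isIrreducible_betaPlane_two :
    IsIrreducible (betaPlane (Pi.single 2 1 : Fin 4 → k)) := by
  have : Infinite k := IsAlgClosed.instInfinite
  refine isIrreducible_of_parametrization (m := 3) (P := ![X 0, 0, X 1, 0, X 2, 0]) (H := X 0)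
    (X_ne_zero _) (fun L hL => ?_) fun v h => ?_
  · obtain ⟨u, v, hu, hv, -, hm⟩ := L.exists_basis
    have e1 := hL u hu
    have e2 := hL v hv
    simp at e1 e2
    refine ⟨![(plucker L).rep 0, (plucker L).rep 2, (plucker L).rep 4], 1, one_ne_zero, ?_⟩
    rw [← hm]
    ext i; fin_cases i <;> simp [minors, e1, e2]
  · rw [eval_X] at h
    have e : minors ![1, 0, 0, -v 2 / v 0] ![0, v 0, 0, v 1] = ![v 0, 0, v 1, 0, v 2, 0] := by
      ext i; fin_cases i <;> simp [minors]; field_simp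
    have hm : minors ![1, 0, 0, -v 2 / v 0] ![0, v 0, 0, v 1] ≠ 0 := by
      rw [e]; exact fun h' => h (congrFun h' 0)
    refine ⟨lineThrough _ _ hm, ?_, ?_⟩
    · intro w hw
      obtain ⟨a, b, rfl⟩ := Submodule.mem_span_pair.1 hw
      simp
    · obtain ⟨c, hc, e'⟩ := plucker_lineThrough hm
      refine ⟨c, hc, ?_⟩
      rw [← e', e]
      ext i; fin_cases i <;> simp

omit [CharP k 2] [IsAlgClosed k] in
theorem lineThrough_mem_betaPlane_iff {u v a : Fin 4 → k} (h : minors u v ≠ 0) :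
    lineThrough u v h ∈ betaPlane a ↔ a ⬝ᵥ u = 0 ∧ a ⬝ᵥ v = 0 := by
  constructor
  · intro hL
    exact ⟨hL u (Submodule.subset_span (by simp)), hL v (Submodule.subset_span (by simp))⟩
  · rintro ⟨h1, h2⟩ w hw
    obtain ⟨s, t, rfl⟩ := Submodule.mem_span_pair.1 hw
    rw [dotProduct_add, dotProduct_smul, dotProduct_smul, h1, h2]
    simp

omit [CharP k 2] [IsAlgClosed k] in
theorem lineThrough_mem_quadricLines_iff {u v : Fin 4 → k} (h : minors u v ≠ 0) :
    lineThrough u v h ∈ quadricLines k ↔ minors u v 0 = 0 ∧ minors u v 5 = 0 := by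
  obtain ⟨c, hc, e⟩ := plucker_lineThrough h
  have e0 := congrFun e 0
  have e5 := congrFun e 5
  rw [e0, e5]
  simp [quadricLines, hc]

omit [CharP k 2] [IsAlgClosed k] in
theorem lineThrough_mem_coneLines_iff {u v : Fin 4 → k} (h : minors u v ≠ 0) :
    lineThrough u v h ∈ coneLines k ↔ minors u v 1 = 0 ∧ minors u v 2 = minors u v 3 := by
  obtain ⟨c, hc, e⟩ := plucker_lineThrough h
  have e1 := congrFun e 1
  have e2 := congrFun e 2
  have e3 := congrFun e 3
  rw [e1, e2, e3]
  simp [coneLines, hc]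

omit [IsAlgClosed k] in
/-- No two of the four components contain one another. -/
theorem components_incomparable :
    (¬ betaPlane (Pi.single 0 1) ⊆ betaPlane (Pi.single 2 1 : Fin 4 → k) ∧
     ¬ betaPlane (Pi.single 0 1) ⊆ quadricLines k ∧ ¬ betaPlane (Pi.single 0 1) ⊆ coneLines k) ∧
    (¬ betaPlane (Pi.single 2 1) ⊆ betaPlane (Pi.single 0 1 : Fin 4 → k) ∧
     ¬ betaPlane (Pi.single 2 1) ⊆ quadricLines k ∧ ¬ betaPlane (Pi.single 2 1) ⊆ coneLines k) ∧
    (¬ quadricLines k ⊆ betaPlane (Pi.single 0 1) ∧ ¬ quadricLines k ⊆ betaPlane (Pi.single 2 1) ∧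
     ¬ quadricLines k ⊆ coneLines k) ∧
    (¬ coneLines k ⊆ betaPlane (Pi.single 0 1) ∧ ¬ coneLines k ⊆ betaPlane (Pi.single 2 1) ∧
     ¬ coneLines k ⊆ quadricLines k) := by
  -- One line is chosen in each family so as to avoid the three others.
  have h1 : minors ![0, 1, 0, 1] ![0, 0, 1, 0] ≠ (0 : Fin 6 → k) := fun h => by
    simpa [minors] using congrFun h 3
  have h2 : minors ![1, 0, 0, 0] ![0, 1, 0, 1] ≠ (0 : Fin 6 → k) := fun h => by
    simpa [minors] using congrFun h 0
  have h3 : minors ![1, 0, 0, 0] ![0, 0, 1, 0] ≠ (0 : Fin 6 → k) := fun h => by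
    simpa [minors] using congrFun h 1
  have h4 : minors ![1, 0, 1, 0] ![0, 1, 0, 1] ≠ (0 : Fin 6 → k) := fun h => by
    simpa [minors] using congrFun h 0
  have a1 : lineThrough _ _ h1 ∈ betaPlane (Pi.single 0 1 : Fin 4 → k) := by
    rw [lineThrough_mem_betaPlane_iff]; simp
  have a2 : lineThrough _ _ h2 ∈ betaPlane (Pi.single 2 1 : Fin 4 → k) := by
    rw [lineThrough_mem_betaPlane_iff]; simp
  have a3 : lineThrough _ _ h3 ∈ quadricLines k := by
    rw [lineThrough_mem_quadricLines_iff]; simp [minors]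
  have a4 : lineThrough _ _ h4 ∈ coneLines k := by
    rw [lineThrough_mem_coneLines_iff]
    simp [minors, CharTwo.neg_eq]
  refine ⟨⟨?_, ?_, ?_⟩, ⟨?_, ?_, ?_⟩, ⟨?_, ?_, ?_⟩, ⟨?_, ?_, ?_⟩⟩ <;> intro hsub
  · have := hsub a1
    rw [lineThrough_mem_betaPlane_iff] at this; simp at this
  · have := hsub a1
    rw [lineThrough_mem_quadricLines_iff] at this; simp [minors] at this
  · have := hsub a1
    rw [lineThrough_mem_coneLines_iff] at this; simp [minors] at this
  · have := hsub a2
    rw [lineThrough_mem_betaPlane_iff] at this; simp at this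
  · have := hsub a2
    rw [lineThrough_mem_quadricLines_iff] at this; simp [minors] at this
  · have := hsub a2
    rw [lineThrough_mem_coneLines_iff] at this; simp [minors] at this
  · have := hsub a3
    rw [lineThrough_mem_betaPlane_iff] at this; simp at this
  · have := hsub a3
    rw [lineThrough_mem_betaPlane_iff] at this; simp at this
  · have := hsub a3
    rw [lineThrough_mem_coneLines_iff] at this; simp [minors] at this
  · have := hsub a4
    rw [lineThrough_mem_betaPlane_iff] at this; simp at this
  · have := hsub a4
    rw [lineThrough_mem_betaPlane_iff] at this; simp at this
  · have := hsub a4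
    rw [lineThrough_mem_quadricLines_iff] at this; simp [minors] at this

theorem componentsOf_Bit_quarticSurface (α β : k) :
    componentsOf (Bit (quarticSurface α β)) =
      {betaPlane (Pi.single 0 1), betaPlane (Pi.single 2 1), quadricLines k, coneLines k} := by
  obtain ⟨⟨a, b, c⟩, ⟨d, e, f⟩, ⟨g, h, i⟩, ⟨j, l, m⟩⟩ := components_incomparable (k := k)
  refine componentsOf_eq_of_four (Bit_quarticSurface α β) (isClosed_betaPlane _)
    (isClosed_betaPlane _) isClosed_quadricLines isClosed_coneLines isIrreducible_betaPlane_zero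
    isIrreducible_betaPlane_two isIrreducible_quadricLines isIrreducible_coneLines ?_
  rintro X (rfl | rfl | rfl | rfl) Y (rfl | rfl | rfl | rfl) hXY <;> first | rfl | contradiction

omit [IsAlgClosed k] in
theorem ncard_components :
    ({betaPlane (Pi.single 0 1), betaPlane (Pi.single 2 1), quadricLines k, coneLines k} :
      Set (Set (Line k))).ncard = 4 := by
  obtain ⟨⟨a, b, c⟩, ⟨d, e, f⟩, ⟨g, h, i⟩, ⟨j, l, m⟩⟩ := components_incomparable (k := k)
  have ne : ∀ {A B : Set (Line k)}, ¬ A ⊆ B → A ≠ B := fun h e => h e.subset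
  rw [Set.ncard_insert_of_notMem, Set.ncard_insert_of_notMem, Set.ncard_pair (ne i)]
  · simp [ne e, ne f]
  · simp [ne a, ne b, ne c]

end Congruences

/-! ### Tropes, involutions and quadrics -/

section Tropes

variable {k : Type*} [Field k] [CharP k 2] [IsAlgClosed k]

/-- Modulo the linear form the quartic is `Q²`. The point `v` of the plane with `Q(v) ≠ 0` shows
that the conic is not the whole plane. -/
theorem isTrope_of_quarticForm_eq {α β : k} {a : Fin 4 → k} (ha : a ≠ 0)
    {Q R l : MvPolynomial (Fin 4) k} (hl : ∑ i, C (a i) * X i = l) (hQ : Q.IsHomogeneous 2)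
    (v : Fin 4 → k) (hv : eval v l = 0) (hQv : eval v Q ≠ 0)
    (h : quarticForm α β = Q ^ 2 + l * R) : IsTrope (quarticSurface α β) a := by
  refine ⟨ha, Q, hQ, ?_, ?_⟩
  · rw [hl, Ideal.mem_span_singleton]
    rintro ⟨t, rfl⟩
    exact hQv (by rw [map_mul, hv, zero_mul])
  · rw [hl, vanishingIdeal_quarticSurface, ← Ideal.span_insert, h]
    rw [mul_comm l, Ideal.span_pair_add_mul_right]

theorem isTrope_zero (α β : k) : IsTrope (quarticSurface α β) (Pi.single 0 1) := by
  have two : (2 : MvPolynomial (Fin 4) k) = 0 := CharTwo.two_eq_zero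
  refine isTrope_of_quarticForm_eq (l := X 0) (Q := X 1 * X 3 + X 2 ^ 2)
    (R := C (β ^ 2) * X 0 ^ 3 + C (α ^ 2) * X 0 * X 2 ^ 2 + X 0 * X 2 * X 3 + X 1 * X 2 ^ 2)
    (by simp) ?_ ?_ ![0, 0, 1, 0] (by simp) (by simp) ?_
  · simp [Fin.sum_univ_four]
  · exact ((isHomogeneous_X k _).mul (isHomogeneous_X k _)).add ((isHomogeneous_X k _).pow 2)
  · simp only [quarticForm]
    linear_combination - X 1 * X 3 * X 2 ^ 2 * two

theorem isTrope_two (α β : k) : IsTrope (quarticSurface α β) (Pi.single 2 1) := by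
  have two : (2 : MvPolynomial (Fin 4) k) = 0 := CharTwo.two_eq_zero
  refine isTrope_of_quarticForm_eq (l := X 2) (Q := X 1 * X 3 + C β * X 0 ^ 2)
    (R := C (α ^ 2) * X 0 ^ 2 * X 2 + X 0 ^ 2 * X 3 + X 0 * X 1 * X 2 + X 2 ^ 3)
    (by simp) ?_ ?_ ![0, 1, 0, 1] (by simp) (by simp) ?_
  · simp [Fin.sum_univ_four]
  · exact ((isHomogeneous_X k _).mul (isHomogeneous_X k _)).add
      ((isHomogeneous_C _ _).mul ((isHomogeneous_X k _).pow 2))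
  · simp only [quarticForm, map_pow]
    linear_combination - X 1 * X 3 * C β * X 0 ^ 2 * two

theorem isCremonaInvolution_sigma₁ {β : k} (hβ : β ≠ 0) : IsCremonaInvolution (sigma₁ β) := by
  have hX := fun i => isHomogeneous_X k (i : Fin 4)
  have hC := isHomogeneous_C (Fin 4) β
  refine ⟨⟨3, fun i => ?_⟩, ⟨0, 2, fun h => ?_⟩, C (β ^ 2) * X 0 ^ 4 * X 2 ^ 4, ?_, fun i => ?_⟩
  · fin_cases i
    · exact (hX 0).mul ((hX 2).pow 2)
    · exact (hX 1).mul ((hX 2).pow 2)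
    · exact (hC.mul ((hX 0).pow 2)).mul (hX 2)
    · exact (hC.mul ((hX 0).pow 2)).mul (hX 3)
  · classical
    -- At `[1, 0, t, 0]` the supposed identity reads `t³ = β t`. If every nonzero `t` had `t² = β`,
    -- injectivity of squaring would leave only `1`.
    obtain ⟨t, ht⟩ : ∃ t : k, t ≠ 0 ∧ t ^ 2 ≠ β := by
      by_contra! hcon
      have h1 := hcon 1 one_ne_zero
      have : Infinite k := IsAlgClosed.instInfinite
      obtain ⟨s, hs⟩ := Infinite.exists_notMem_finset ({0, 1} : Finset k)
      simp only [Finset.mem_insert, Finset.mem_singleton, not_or] at hs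
      have h2 := hcon s hs.1
      apply hs.2
      grind
    have := congrArg (eval ![1, 0, t, 0]) h
    simp [sigma₁] at this
    tauto
  · simp [X_ne_zero, hβ]
  · fin_cases i <;> simp [sigma₁] <;> ring

omit [CharP k 2] [IsAlgClosed k] in
theorem isCremonaInvolution_sigma₂ : IsCremonaInvolution (sigma₂ (k := k)) := by
  have hX := fun i => isHomogeneous_X k (i : Fin 4)
  refine ⟨⟨3, fun i => ?_⟩, ⟨0, 1, fun h => ?_⟩, X 0 ^ 4 * X 2 ^ 4, ?_, fun i => ?_⟩
  · fin_cases i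
    · exact ((hX 0).pow 2).mul (hX 2)
    · exact ((hX 0).pow 2).mul (hX 3)
    · exact (hX 0).mul ((hX 2).pow 2)
    · exact (hX 1).mul ((hX 2).pow 2)
  · have := congrArg (eval ![1, 0, 0, 1]) h
    simp [sigma₂] at this
  · simp [X_ne_zero]
  · fin_cases i <;> simp [sigma₂] <;> ring

/-- A criterion for a bitangent involution of the quartic surface, where `E` is a form that does
not vanish identically on it. -/
theorem isBitangentInvolution_of_form {α β : k} {T : Fin 4 → MvPolynomial (Fin 4) k}
    (hT : IsCremonaInvolution T) {E : MvPolynomial (Fin 4) k} {d : ℕ} (hE : E.IsHomogeneous d)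
    {H : MvPolynomial (Fin 3) k} (hH : H ≠ 0)
    (hHE : ∀ x y z w : k, x ≠ 0 → y ≠ 0 → z ≠ 0 → eval ![x, y, z] H ≠ 0 →
      quarticFun α β ![x, y, z, w] = 0 → eval ![x, y, z, w] E ≠ 0)
    (hS : ∀ v : Fin 4 → k, eval v E ≠ 0 → quarticFun α β v = 0 →
      eval (evalMap T v) E ≠ 0 ∧ quarticFun α β (evalMap T v) = 0 ∧
      minors v (evalMap T v) ≠ 0 ∧ (∃ c : k, c ≠ 0 ∧ evalMap T (evalMap T v) = c • v) ∧
      ∃ c : k, c ≠ 0 ∧ ∀ s t, quarticFun α β (s • v + t • evalMap T v) = c * (s * t) ^ 2) :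
    IsBitangentInvolution (quarticSurface α β) T := by
  have : Infinite k := IsAlgClosed.instInfinite
  refine ⟨hT, {p | eval p.rep E ≠ 0}, isOpen_eval_ne_zero hE, ?_, ?_⟩
  · refine quarticSurface_subset_closure hH ?_
    intro x y z w hx hy hz hh hF p c hc e
    refine ⟨fun h => ?_, ?_⟩
    · exact hHE x y z w hx hy hz hh hF ((eval_rep_eq_zero_iff hE hc e).1 h)
    · rw [← eval_quarticForm] at hF
      exact (eval_rep_eq_zero_iff (quarticForm_isHomogeneous α β) hc e).2 hF
  · rintro p ⟨hpE, hpX⟩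
    have hF : quarticFun α β p.rep = 0 := by
      rw [← eval_quarticForm]; exact hpX
    obtain ⟨h1, h2, h3, h4, c, hc, h5⟩ := hS p.rep hpE hF
    have h0 : evalMap T p.rep ≠ 0 := by
      intro h
      apply h3
      rw [h]
      ext i; fin_cases i <;> simp [minors]
    refine ⟨h0, ⟨?_, (mk_mem_quarticSurface h0).2 h2⟩, ?_, h4, ?_⟩
    · obtain ⟨b, hb, e⟩ := mk_rep_smul h0
      intro h
      exact h1 ((eval_rep_eq_zero_iff hE hb e).1 h)
    · intro h
      obtain ⟨b, hb, e⟩ := mk_rep_smul h0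
      rw [h] at e
      apply h3
      rw [e]
      ext i; fin_cases i <;> simp [minors] <;> ring
    · rw [vanishingIdeal_quarticSurface, Ideal.map_span, Set.image_singleton,
        Ideal.span_singleton_eq_span_singleton]
      have : restrictLine p.rep (evalMap T p.rep) (quarticForm α β) = C c * (X 0 * X 1) ^ 2 := by
        apply MvPolynomial.funext
        intro q
        rw [eval_restrictLine, eval_quarticForm, h5]
        simp
      rw [this]
      exact associated_unit_mul_left _ _ ((isUnit_iff_ne_zero.2 hc).map C)

/-- Off `x z (β x² + z²) = 0` the map is defined, without fixed points, and preserves this open set.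
Along the line only `s² t²` survives in the quartic, with a nonzero fourth power as coefficient; `s
= 0`, `t = 1` shows that the image lies on the surface. -/
theorem isBitangentInvolution_sigma₁ (α : k) {β : k} (hβ : β ≠ 0) :
    IsBitangentInvolution (quarticSurface α β) (sigma₁ β) := by
  have hX := fun i => isHomogeneous_X k (i : Fin 4)
  have hEh : (X 0 * X 2 * (C β * X 0 ^ 2 + X 2 ^ 2) : MvPolynomial (Fin 4) k).IsHomogeneous 4 :=
    ((hX 0).mul (hX 2)).mul (((isHomogeneous_C (Fin 4) β).mul ((hX 0).pow 2)).add ((hX 2).pow 2))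
  refine isBitangentInvolution_of_form (isCremonaInvolution_sigma₁ hβ) hEh
    (H := C β * X 0 ^ 2 + X 2 ^ 2) ?_ ?_ ?_
  · intro h
    have := congrArg (eval ![1, 0, 0]) h
    simp [hβ] at this
  · intro x y z w hx hy hz h _
    simp at h ⊢
    exact ⟨⟨hx, hz⟩, h⟩
  · intro v hv hF
    simp only [map_mul, map_add, map_pow, eval_X, eval_C, mul_ne_zero_iff] at hv
    obtain ⟨⟨h0, h2⟩, he⟩ := hv
    have hF' : β ^ 2 * v 0 ^ 4 + α ^ 2 * v 0 ^ 2 * v 2 ^ 2 + v 0 ^ 2 * v 2 * v 3 +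
        v 0 * v 1 * v 2 ^ 2 + v 1 ^ 2 * v 3 ^ 2 + v 2 ^ 4 = 0 := hF
    have he' : β * v 0 ^ 2 - v 2 ^ 2 ≠ 0 := by rwa [CharTwo.sub_eq_add]
    have e5 : ∀ s t, quarticFun α β (s • v + t • evalMap (sigma₁ β) v) =
        (β * v 0 ^ 2 + v 2 ^ 2) ^ 4 * (s * t) ^ 2 := by
      intro s t
      rw [evalMap_sigma₁]
      simp [quarticFun]
      grind
    refine ⟨?_, ?_, ?_, ?_, _, pow_ne_zero 4 he, e5⟩
    · rw [evalMap_sigma₁]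
      simp only [map_mul, map_add, map_pow, eval_X, eval_C]
      have : (![v 0 * v 2 ^ 2, v 1 * v 2 ^ 2, β * v 0 ^ 2 * v 2, β * v 0 ^ 2 * v 3] : Fin 4 → k) 0
        = v 0 * v 2 ^ 2 := rfl
      have h2' : (![v 0 * v 2 ^ 2, v 1 * v 2 ^ 2, β * v 0 ^ 2 * v 2, β * v 0 ^ 2 * v 3] : Fin 4 → k) 2
        = β * v 0 ^ 2 * v 2 := rfl
      rw [this, h2']
      have e : β * (v 0 * v 2 ^ 2) ^ 2 + (β * v 0 ^ 2 * v 2) ^ 2 =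
        β * v 0 ^ 2 * v 2 ^ 2 * (β * v 0 ^ 2 + v 2 ^ 2) := by ring
      rw [e]
      simp [h0, h2, hβ, he]
    · have := e5 0 1
      simpa using this
    · rw [minors_sigma₁]
      refine smul_ne_zero he' fun h => ?_
      have := congrFun h 1
      simp [h0, h2] at this
    · refine ⟨β ^ 2 * v 0 ^ 4 * v 2 ^ 4, by simp [h0, h2, hβ], ?_⟩
      rw [evalMap_sigma₁, evalMap_sigma₁]
      ext i; fin_cases i <;> simp <;> ring

theorem isBitangentInvolution_sigma₂ (α : k) {β : k} (hβ : β ≠ 0) :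
    IsBitangentInvolution (quarticSurface α β) sigma₂ := by
  have hX := fun i => isHomogeneous_X k (i : Fin 4)
  have hEh : (X 0 * X 2 * (X 0 * X 3 + X 1 * X 2) : MvPolynomial (Fin 4) k).IsHomogeneous 4 :=
    ((hX 0).mul (hX 2)).mul (((hX 0).mul (hX 3)).add ((hX 1).mul (hX 2)))
  -- `H` is `x²` times the quartic form after substituting `w = y z / x`; where it does not vanish,
  -- a point of the surface with `x ≠ 0` has `x w + y z ≠ 0`.
  refine isBitangentInvolution_of_form isCremonaInvolution_sigma₂ hEh
    (H := X 1 ^ 4 * X 2 ^ 2 + C (β ^ 2) * X 0 ^ 6 + C (α ^ 2) * X 0 ^ 4 * X 2 ^ 2 +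
      X 0 ^ 2 * X 2 ^ 4) ?_ ?_ ?_
  · intro h
    have := congrArg (eval ![1, 0, 0]) h
    simp [hβ] at this
  · intro x y z w hx hy hz h hF
    simp at h ⊢
    refine ⟨⟨hx, hz⟩, fun hq => h ?_⟩
    simp [quarticFun] at hF
    grind
  · intro v hv hF
    simp only [map_mul, map_add, eval_X, mul_ne_zero_iff] at hv
    obtain ⟨⟨h0, h2⟩, he⟩ := hv
    have hF' : β ^ 2 * v 0 ^ 4 + α ^ 2 * v 0 ^ 2 * v 2 ^ 2 + v 0 ^ 2 * v 2 * v 3 +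
        v 0 * v 1 * v 2 ^ 2 + v 1 ^ 2 * v 3 ^ 2 + v 2 ^ 4 = 0 := hF
    have e5 : ∀ s t, quarticFun α β (s • v + t • evalMap sigma₂ v) =
        (v 0 * v 3 + v 1 * v 2) ^ 4 * (s * t) ^ 2 := by
      intro s t
      rw [evalMap_sigma₂]
      simp [quarticFun]
      grind
    refine ⟨?_, ?_, ?_, ?_, _, pow_ne_zero 4 he, e5⟩
    · rw [evalMap_sigma₂]
      have e : eval ![v 0 ^ 2 * v 2, v 0 ^ 2 * v 3, v 0 * v 2 ^ 2, v 1 * v 2 ^ 2]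
          (X 0 * X 2 * (X 0 * X 3 + X 1 * X 2)) =
          (v 0 ^ 2 * v 2) * (v 0 * v 2 ^ 2) * (v 0 ^ 2 * v 2 ^ 2 * (v 0 * v 3 + v 1 * v 2)) := by
        simp only [map_mul, map_add, eval_X, Matrix.cons_val]
        ring
      rw [e]
      simp [h0, h2, he]
    · have := e5 0 1
      simpa using this
    · rw [minors_sigma₂]
      refine smul_ne_zero he fun h => ?_
      have := congrFun h 0
      simp [h0] at this
    · refine ⟨v 0 ^ 4 * v 2 ^ 4, by simp [h0, h2], ?_⟩
      rw [evalMap_sigma₂, evalMap_sigma₂]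
      ext i; fin_cases i <;> simp <;> ring

end Tropes

/-! ### The smooth quadric and the quadric cone in Plücker space. -/

section Quadrics

variable {k : Type*} [Field k]

/-- The space of vectors with `p₁₂ = p₃₄ = 0`. -/
def quadricSpan (k : Type*) [Field k] : Submodule k (Fin 6 → k) :=
  LinearMap.range ({
    toFun := fun v => ![0, v 0, v 1, v 2, v 3, 0]
    map_add' := fun u v => by ext i; fin_cases i <;> simp
    map_smul' := fun c v => by ext i; fin_cases i <;> simp } : (Fin 4 → k) →ₗ[k] (Fin 6 → k))

theorem mem_quadricSpan {q : Fin 6 → k} : q ∈ quadricSpan k ↔ q 0 = 0 ∧ q 5 = 0 := by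
  constructor
  · rintro ⟨v, rfl⟩
    simp
  · rintro ⟨h0, h5⟩
    refine ⟨![q 1, q 2, q 3, q 4], ?_⟩
    ext i; fin_cases i <;> simp [h0, h5]

theorem finrank_quadricSpan : Module.finrank k (quadricSpan k) = 4 := by
  rw [quadricSpan, LinearMap.finrank_range_of_inj]
  · simp
  · intro u v h
    ext i
    fin_cases i
    · exact congrFun h 1
    · exact congrFun h 2
    · exact congrFun h 3
    · exact congrFun h 4

/-- The space of vectors with `p₁₃ = 0` and `p₁₄ = p₂₃`. -/
def coneSpan (k : Type*) [Field k] : Submodule k (Fin 6 → k) :=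
  LinearMap.range ({
    toFun := fun v => ![v 0, 0, v 1, v 1, v 2, v 3]
    map_add' := fun u v => by ext i; fin_cases i <;> simp
    map_smul' := fun c v => by ext i; fin_cases i <;> simp } : (Fin 4 → k) →ₗ[k] (Fin 6 → k))

theorem mem_coneSpan {q : Fin 6 → k} : q ∈ coneSpan k ↔ q 1 = 0 ∧ q 2 = q 3 := by
  constructor
  · rintro ⟨v, rfl⟩
    simp
  · rintro ⟨h1, h2⟩
    refine ⟨![q 0, q 2, q 4, q 5], ?_⟩
    ext i; fin_cases i <;> simp [h1, h2]

theorem finrank_coneSpan : Module.finrank k (coneSpan k) = 4 := by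
  rw [coneSpan, LinearMap.finrank_range_of_inj]
  · simp
  · intro u v h
    ext i
    fin_cases i
    · exact congrFun h 0
    · exact congrFun h 2
    · exact congrFun h 4
    · exact congrFun h 5

/-- On `p₁₂ = p₃₄ = 0` the Plücker relation is the form `p₁₃ p₂₄ - p₁₄ p₂₃`, whose polar form is
nondegenerate: pairing with each coordinate vector isolates one coordinate. -/
theorem isSmoothQuadricSurface_quadricLines :
    IsSmoothQuadricSurface (plucker '' quadricLines k) := by
  refine ⟨quadricSpan k, QuadraticMap.linMulLin (LinearMap.proj 1) (LinearMap.proj 4) -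
    QuadraticMap.linMulLin (LinearMap.proj 2) (LinearMap.proj 3), finrank_quadricSpan, ?_, ?_⟩
  · ext p
    simp only [Set.mem_image, Set.mem_ofPred_eq, mem_quadricSpan, sub_apply,
      QuadraticMap.linMulLin_apply, LinearMap.proj_apply]
    constructor
    · rintro ⟨L, hL, rfl⟩
      refine ⟨hL, ?_⟩
      have := plucker_relation L
      rw [hL.1] at this
      linear_combination -this
    · rintro ⟨hp, hq⟩
      obtain ⟨L, rfl⟩ := exists_plucker_eq (p := p) (by rw [hp.1]; linear_combination -hq)
      exact ⟨L, hp, rfl⟩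
  · ext v
    simp only [singularVectors, Set.mem_ofPred_eq, mem_quadricSpan, Set.mem_singleton_iff,
      QuadraticMap.polar, sub_apply, QuadraticMap.linMulLin_apply,
      LinearMap.proj_apply, Pi.add_apply]
    constructor
    · rintro ⟨⟨h0, h5⟩, hq, h⟩
      have h1 := h (Pi.single 4 1) (by simp)
      have h2 := h (Pi.single 3 1) (by simp)
      have h3 := h (Pi.single 2 1) (by simp)
      have h4 := h (Pi.single 1 1) (by simp)
      simp at h1 h2 h3 h4
      ext i
      fin_cases i
      · exact h0
      · simp; linear_combination h1
      · simp; linear_combination -h2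
      · simp; linear_combination -h3
      · simp; linear_combination h4
      · exact h5
    · rintro rfl
      simp

/-- The form is `p₁₂ p₃₄ + p₁₄²`. The square does not contribute to the polar form in characteristic
2, so the radical is `p₁₂ = p₃₄ = 0`; vanishing of the form itself gives `p₁₄ = 0`, and only the
`p₂₄`-axis remains as vertex. -/
theorem isQuadricCone_coneLines [CharP k 2] : IsQuadricCone (plucker '' coneLines k) := by
  refine ⟨coneSpan k, QuadraticMap.linMulLin (LinearMap.proj 0) (LinearMap.proj 5) +
    QuadraticMap.linMulLin (LinearMap.proj 2) (LinearMap.proj 2), finrank_coneSpan, ?_,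
    Pi.single 4 1, by simp, ?_⟩
  · ext p
    simp only [Set.mem_image, Set.mem_ofPred_eq, mem_coneSpan, add_apply,
      QuadraticMap.linMulLin_apply, LinearMap.proj_apply]
    constructor
    · rintro ⟨L, hL, rfl⟩
      refine ⟨hL, ?_⟩
      have := plucker_relation L
      rw [hL.1, ← hL.2] at this
      linear_combination this
    · rintro ⟨hp, hq⟩
      obtain ⟨L, rfl⟩ := exists_plucker_eq (p := p) (by
        rw [hp.1, ← hp.2]; linear_combination hq)
      exact ⟨L, hp, rfl⟩
  · ext v
    have two : (2 : k) = 0 := CharTwo.two_eq_zero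
    simp only [singularVectors, Set.mem_ofPred_eq, mem_coneSpan, SetLike.mem_coe,
      Submodule.mem_span_singleton,
      QuadraticMap.polar, add_apply, QuadraticMap.linMulLin_apply,
      LinearMap.proj_apply, Pi.add_apply]
    constructor
    · rintro ⟨⟨h1, h2⟩, hq, h⟩
      have h5 := h (Pi.single 0 1) (by simp)
      have h0 := h (Pi.single 5 1) (by simp)
      simp at h0 h5
      have h0' : v 0 = 0 := by linear_combination h0
      have h5' : v 5 = 0 := by linear_combination h5
      rw [h0'] at hq
      have h2' : v 2 = 0 := by simpa using hq
      refine ⟨v 4, ?_⟩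
      ext i
      fin_cases i <;> simp [h0', h1, h2', h5', ← h2]
    · rintro ⟨a, rfl⟩
      refine ⟨by simp, by simp, ?_⟩
      rintro w -
      simp

end Quadrics

/-! ### The bidegree of the bitangent surface -/

section Bidegree

variable {k : Type*} [Field k] [CharP k 2] [IsAlgClosed k]

/-- With `x z ≠ 0` the point lies on neither plane. The quadric contributes the line through the
projections of `v` to `z = w = 0` and `x = y = 0`; on the cone, `p₁₃ = 0` and `p₁₄ = p₂₃` force the
line to contain `[0, x, 0, z]`. -/
theorem encard_Bit_through_point (α β : k) {v : Fin 4 → k} (h0 : v 0 ≠ 0) (h2 : v 2 ≠ 0) :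
    {L | L ∈ Bit (quarticSurface α β) ∧ v ∈ L.1}.encard = 2 := by
  have two : (2 : k) = 0 := CharTwo.two_eq_zero
  have m1 : minors ![v 0, v 1, 0, 0] ![0, 0, v 2, v 3] ≠ 0 := fun h => by
    have := congrFun h 1
    simp [minors, h0, h2] at this
  have m2 : minors v ![0, v 0, 0, v 2] ≠ 0 := fun h => by
    have := congrFun h 0
    simp [minors, h0] at this
  have hset : {L | L ∈ Bit (quarticSurface α β) ∧ v ∈ L.1} =
      {lineThrough _ _ m1, lineThrough _ _ m2} := by
    ext L
    simp only [Set.mem_ofPred_eq, Set.mem_insert_iff, Set.mem_singleton_iff, Bit_quarticSurface]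
    constructor
    · rintro ⟨((h | h) | h) | h, hv⟩
      · have := h v hv
        simp [h0] at this
      · have := h v hv
        simp [h2] at this
      · left
        obtain ⟨x, y, z, w, hxy, hzw, hu, hw⟩ := exists_of_mem_quadricLines h
        have hm : minors ![x, y, 0, 0] ![0, 0, z, w] ≠ 0 := fun h => by
          have e1 := congrFun h 1
          have e2 := congrFun h 2
          have e3 := congrFun h 3
          have e4 := congrFun h 4
          simp [minors] at e1 e2 e3 e4
          tauto
        have hL := Line.eq_lineThrough hm hu hw
        rw [hL] at hv
        obtain ⟨s, t, e⟩ := Submodule.mem_span_pair.1 hv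
        apply Line.eq_lineThrough m1
        · have : ![v 0, v 1, 0, 0] = s • ![x, y, 0, 0] := by
            rw [← e]; ext i; fin_cases i <;> simp
          rw [this]; exact L.1.smul_mem _ hu
        · have : ![0, 0, v 2, v 3] = t • ![0, 0, z, w] := by
            rw [← e]; ext i; fin_cases i <;> simp
          rw [this]; exact L.1.smul_mem _ hw
      · right
        apply Line.eq_lineThrough m2 hv
        obtain ⟨v', hv', hm⟩ := Line.exists_minors_ne_zero hv (fun h => h0 (by rw [h]; rfl))
        obtain ⟨r1, r2⟩ := h
        rw [← L.forall_minors_iff] at r1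
        rw [← L.forall_minors_sub_iff] at r2
        have e1 := r1 v hv v' hv'
        have e2 := r2 v hv v' hv'
        simp only [minors, Matrix.cons_val] at e1 e2
        have key : v 0 • v' - v' 0 • v =
            ((v 0 * v' 1 - v' 0 * v 1) / v 0) • ![0, v 0, 0, v 2] := by
          ext i
          fin_cases i
          · simp; ring
          · simp; field_simp
          · simp; linear_combination e1
          · simp
            field_simp
            have : v' 2 = v 2 * v' 0 / v 0 := by field_simp; linear_combination e1
            rw [this] at e2
            field_simp at e2
            linear_combination e2 + (v 1 * v 2 * v' 0 - v 0 * v' 1 * v 2) * two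
        have hne : (v 0 * v' 1 - v' 0 * v 1) / v 0 ≠ 0 := by
          intro hz
          rw [hz, zero_smul] at key
          apply hm
          have : v' = (v' 0 / v 0) • v := by
            ext i
            have := congrFun key i
            simp at this ⊢
            field_simp
            linear_combination this
          rw [this]
          ext i; fin_cases i <;> simp [minors] <;> ring
        have hmem : ((v 0 * v' 1 - v' 0 * v 1) / v 0) • ![0, v 0, 0, v 2] ∈ L.1 := by
          rw [← key]
          exact L.1.sub_mem (L.1.smul_mem _ hv') (L.1.smul_mem _ hv)
        exact (L.1.smul_mem_iff hne).1 hmem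
    · rintro (rfl | rfl)
      · refine ⟨Or.inl (Or.inr ?_), ?_⟩
        · rw [lineThrough_mem_quadricLines_iff]
          simp [minors]
        · refine Submodule.mem_span_pair.2 ⟨1, 1, ?_⟩
          ext i; fin_cases i <;> simp
      · refine ⟨Or.inr ?_, Submodule.subset_span (by simp)⟩
        rw [lineThrough_mem_coneLines_iff]
        simp [minors, CharTwo.neg_eq]
        ring
  rw [hset, Set.encard_pair]
  intro h
  have : lineThrough _ _ m2 ∈ quadricLines k := by
    rw [← h, lineThrough_mem_quadricLines_iff]
    simp [minors]
  rw [lineThrough_mem_quadricLines_iff] at this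
  simp [minors, h0] at this

/-- Each family contributes one line: the sections by `x = 0` and by `z = 0`, the line joining the
points where the plane meets `z = w = 0` and `x = y = 0`, and one line of the cone. -/
theorem encard_Bit_in_plane (α β : k) {a : Fin 4 → k} (ha : ∀ i, a i ≠ 0) :
    (Bit (quarticSurface α β) ∩ betaPlane a).encard = 4 := by
  have two : (2 : k) = 0 := CharTwo.two_eq_zero
  have h0 := ha 0
  have h1 := ha 1
  have h2 := ha 2
  have h3 := ha 3
  have m1 : minors ![0, a 2, -a 1, 0] ![0, a 3, 0, -a 1] ≠ 0 := fun h => by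
    have := congrFun h 5
    simp [minors, h1] at this
  have m2 : minors ![a 1, -a 0, 0, 0] ![0, -a 3, 0, a 1] ≠ 0 := fun h => by
    have := congrFun h 2
    simp [minors, h1] at this
  have m3 : minors ![a 1, -a 0, 0, 0] ![0, 0, a 3, -a 2] ≠ 0 := fun h => by
    have := congrFun h 1
    simp [minors, h1, h3] at this
  have m4 : minors ![a 3 ^ 2, 0, a 1 * a 3, a 0 * a 3 + a 1 * a 2] ![0, a 3, 0, a 1] ≠ 0 :=
    fun h => by
      have := congrFun h 0
      simp [minors, h3] at this
  have hset : Bit (quarticSurface α β) ∩ betaPlane a = {lineThrough _ _ m1, lineThrough _ _ m2,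
      lineThrough _ _ m3, lineThrough _ _ m4} := by
    ext L
    simp only [Set.mem_inter_iff, Set.mem_insert_iff, Set.mem_singleton_iff, Bit_quarticSurface]
    constructor
    · rintro ⟨((h | h) | h) | h, hv⟩
      · left
        apply Line.eq_of_le
        intro v hvL
        have e1 := h v hvL
        have e2 := hv v hvL
        simp [dotProduct, Fin.sum_univ_four] at e1 e2
        refine Submodule.mem_span_pair.2 ⟨-v 2 / a 1, -v 3 / a 1, ?_⟩
        ext i
        fin_cases i
        · simp [e1]
        · simp; field_simp; rw [e1] at e2; linear_combination -e2
        · simp; field_simp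
        · simp; field_simp
      · right; left
        apply Line.eq_of_le
        intro v hvL
        have e1 := h v hvL
        have e2 := hv v hvL
        simp [dotProduct, Fin.sum_univ_four] at e1 e2
        refine Submodule.mem_span_pair.2 ⟨v 0 / a 1, v 3 / a 1, ?_⟩
        ext i
        fin_cases i
        · simp; field_simp
        · simp; field_simp; rw [e1] at e2; linear_combination -e2
        · simp [e1]
        · simp; field_simp
      · right; right; left
        obtain ⟨x, y, z, w, hxy, hzw, hu, hw⟩ := exists_of_mem_quadricLines h
        have e1 := hv _ hu
        have e2 := hv _ hw
        simp [dotProduct, Fin.sum_univ_four] at e1 e2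
        have x0 : x ≠ 0 := by
          rintro rfl
          simp [h1] at e1
          simp [e1] at hxy
        have z0 : z ≠ 0 := by
          rintro rfl
          simp [h3] at e2
          simp [e2] at hzw
        apply Line.eq_lineThrough m3
        · have : ![a 1, -a 0, 0, 0] = (a 1 / x) • ![x, y, 0, 0] := by
            ext i; fin_cases i
            · simp; field_simp
            · simp; field_simp; linear_combination -e1
            · simp
            · simp
          rw [this]; exact L.1.smul_mem _ hu
        · have : ![0, 0, a 3, -a 2] = (a 3 / z) • ![0, 0, z, w] := by
            ext i; fin_cases i
            · simp
            · simp
            · simp; field_simp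
            · simp; field_simp; linear_combination -e2
          rw [this]; exact L.1.smul_mem _ hw
      · right; right; right
        obtain ⟨r1, r2⟩ := h
        -- The rows of the Plücker matrix are points of the plane; with the cone equations this
        -- expresses every Plücker coordinate as a multiple of `q 0`.
        obtain ⟨s1, s2, s3, -⟩ := L.rows_mem
        have e1 := hv _ s1
        have e2 := hv _ s2
        have e3 := hv _ s3
        have hne := (plucker L).rep_nonzero
        set q := (plucker L).rep
        simp [dotProduct, Fin.sum_univ_four, r1] at e1 e2 e3
        have q2 : q 2 = a 1 / a 3 * q 0 := by
          field_simp; linear_combination e1 - a 1 * q 0 * two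
        have q4 : q 4 = (a 0 * a 3 + a 1 * a 2) / a 3 ^ 2 * q 0 := by
          rw [← r2, q2] at e2
          field_simp at e2 ⊢
          linear_combination e2 - a 2 * a 1 * q 0 * two
        have q5 : q 5 = (a 1 / a 3) ^ 2 * q 0 := by
          rw [← r2, q2] at e3
          field_simp at e3 ⊢
          linear_combination e3
        have q0 : q 0 ≠ 0 := by
          intro q0
          apply hne
          ext i
          fin_cases i
          · exact q0
          · exact r1
          · simp [q2, q0]
          · simp [← r2, q2, q0]
          · simp [q4, q0]
          · simp [q5, q0]
        apply Line.eq_lineThrough m4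
        · have : ![a 3 ^ 2, 0, a 1 * a 3, a 0 * a 3 + a 1 * a 2] =
              (a 3 ^ 2 / q 0) • ![-q 0, 0, q 3, q 4] := by
            rw [← r2, q2, q4, CharTwo.neg_eq]
            ext i; fin_cases i
            · simp; field_simp
            · simp
            · simp; field_simp
            · simp; field_simp
          rw [this]; exact L.1.smul_mem _ s2
        · have : ![0, a 3, 0, a 1] = (a 3 / q 0) • ![0, q 0, q 1, q 2] := by
            rw [r1, q2]
            ext i; fin_cases i
            · simp
            · simp; field_simp
            · simp
            · simp; field_simp
          rw [this]; exact L.1.smul_mem _ s1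
    · rintro (rfl | rfl | rfl | rfl)
      · rw [lineThrough_mem_betaPlane_iff]
        refine ⟨Or.inl (Or.inl (Or.inl ?_)), ?_⟩
        · rw [lineThrough_mem_betaPlane_iff]; simp
        simp [dotProduct, Fin.sum_univ_four]
        constructor <;> ring
      · rw [lineThrough_mem_betaPlane_iff]
        refine ⟨Or.inl (Or.inl (Or.inr ?_)), ?_⟩
        · rw [lineThrough_mem_betaPlane_iff]; simp
        simp [dotProduct, Fin.sum_univ_four]
        constructor <;> ring
      · rw [lineThrough_mem_betaPlane_iff]
        refine ⟨Or.inl (Or.inr ?_), ?_⟩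
        · rw [lineThrough_mem_quadricLines_iff]; simp [minors]
        simp [dotProduct, Fin.sum_univ_four]
        constructor <;> ring
      · rw [lineThrough_mem_betaPlane_iff]
        refine ⟨Or.inr ?_, ?_⟩
        · rw [lineThrough_mem_coneLines_iff]; simp [minors, CharTwo.neg_eq]; ring
        simp [dotProduct, Fin.sum_univ_four]
        constructor
        · linear_combination (a 0 * a 3 ^ 2 + a 1 * a 2 * a 3) * two
        · linear_combination a 1 * a 3 * two
  have b1 : lineThrough _ _ m1 ∈ betaPlane (Pi.single 0 1 : Fin 4 → k) := by
    rw [lineThrough_mem_betaPlane_iff]; simp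
  have b2 : lineThrough _ _ m2 ∈ betaPlane (Pi.single 2 1 : Fin 4 → k) := by
    rw [lineThrough_mem_betaPlane_iff]; simp
  have b3 : lineThrough _ _ m3 ∈ quadricLines k := by
    rw [lineThrough_mem_quadricLines_iff]; simp [minors]
  have n12 : lineThrough _ _ m1 ≠ lineThrough _ _ m2 := fun h => by
    rw [h, lineThrough_mem_betaPlane_iff] at b1; simp [h1] at b1
  have n13 : lineThrough _ _ m1 ≠ lineThrough _ _ m3 := fun h => by
    rw [h, lineThrough_mem_betaPlane_iff] at b1; simp [h1] at b1
  have n14 : lineThrough _ _ m1 ≠ lineThrough _ _ m4 := fun h => by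
    rw [h, lineThrough_mem_betaPlane_iff] at b1; simp [h3] at b1
  have n23 : lineThrough _ _ m2 ≠ lineThrough _ _ m3 := fun h => by
    rw [h, lineThrough_mem_betaPlane_iff] at b2; simp [h3] at b2
  have n24 : lineThrough _ _ m2 ≠ lineThrough _ _ m4 := fun h => by
    rw [h, lineThrough_mem_betaPlane_iff] at b2; simp [h1, h3] at b2
  have n34 : lineThrough _ _ m3 ≠ lineThrough _ _ m4 := fun h => by
    rw [h, lineThrough_mem_quadricLines_iff] at b3; simp [minors, h3] at b3
  rw [hset, Set.encard_insert_of_notMem (by simp [n12, n13, n14]),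
    Set.encard_insert_of_notMem (by simp [n23, n24]), Set.encard_pair n34]
  norm_num

end Bidegree

/-! ### Changes of coordinates -/

section Coordinates

variable {k : Type*} [Field k] (g : (Fin 4 → k) ≃ₗ[k] (Fin 4 → k))

/-- The image of a point under a projective transformation. -/
def mapPoint (p : PSpace k 4) : PSpace k 4 :=
  Projectivization.map (g : (Fin 4 → k) →ₗ[k] (Fin 4 → k)) g.injective p

/-- The image of a line under a projective transformation. -/
def mapLine (L : Line k) : Line k :=
  ⟨L.1.map (g : (Fin 4 → k) →ₗ[k] (Fin 4 → k)), by rw [LinearEquiv.finrank_map_eq]; exact L.2⟩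

/-- Composition of a polynomial with a linear change of coordinates. -/
def pullback (G : MvPolynomial (Fin 4) k) : MvPolynomial (Fin 4) k :=
  aeval (fun i => ∑ j, C (g (Pi.single j 1) i) * X j) G

theorem sum_smul_single (v : Fin 4 → k) : v = ∑ j, v j • (Pi.single j 1 : Fin 4 → k) := by
  ext i
  simp [Finset.sum_apply, Pi.single_apply]

theorem eval_pullback (G : MvPolynomial (Fin 4) k) (v : Fin 4 → k) :
    eval v (pullback g G) = eval (g v) G := by
  rw [pullback, ← aeval_eq_eval, ← aeval_eq_eval, ← AlgHom.comp_apply, comp_aeval]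
  congr 2
  ext i
  nth_rewrite 2 [sum_smul_single v]
  rw [map_sum]
  simp [Finset.sum_apply, mul_comm]

/-- The linear form with the given coefficients. -/
def linearForm (c : Fin 4 → k) : MvPolynomial (Fin 4) k := ∑ j, C (c j) * X j

theorem linearForm_isHomogeneous (c : Fin 4 → k) : (linearForm c).IsHomogeneous 1 := by
  refine IsHomogeneous.sum _ _ _ fun j _ => ?_
  have := (isHomogeneous_C (Fin 4) (c j)).mul (isHomogeneous_X k j)
  rwa [zero_add] at this

variable {g} in
theorem pullback_isHomogeneous {G : MvPolynomial (Fin 4) k} {d : ℕ} (hG : G.IsHomogeneous d) :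
    (pullback g G).IsHomogeneous d := by
  have := hG.aeval (fun i => ∑ j, C (g (Pi.single j 1) i) * X j) (n := 1)
    (fun i => linearForm_isHomogeneous fun j => g (Pi.single j 1) i)
  rwa [one_mul] at this

theorem exists_map_rep (p : PSpace k 4) :
    ∃ c : k, c ≠ 0 ∧ g p.rep = c • (mapPoint g p).rep := by
  have h : g p.rep ≠ 0 := by simpa using p.rep_nonzero
  have e : mapPoint g p = Projectivization.mk k (g p.rep) h := by
    conv_lhs => rw [← Projectivization.mk_rep p]
    rfl
  rw [e]
  exact mk_rep_smul h

theorem mapPoint_symm (p : PSpace k 4) : mapPoint g.symm (mapPoint g p) = p := by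
  obtain ⟨c, hc, e⟩ := exists_map_rep g p
  obtain ⟨d, hd, e'⟩ := exists_map_rep g.symm (mapPoint g p)
  have : p.rep = (c * d) • (mapPoint g.symm (mapPoint g p)).rep := by
    rw [mul_smul, ← e', ← map_smul, ← e, g.symm_apply_apply]
  rw [← mk_eq_of_smul p.rep_nonzero this, Projectivization.mk_rep]

theorem mapLine_symm (L : Line k) : mapLine g.symm (mapLine g L) = L := by
  apply Subtype.ext
  ext v
  simp [mapLine]

theorem mem_mapLine {L : Line k} {v : Fin 4 → k} : g v ∈ (mapLine g L).1 ↔ v ∈ L.1 := by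
  simp [mapLine]

theorem submodule_le_iff {p : PSpace k 4} {L : Line k} : p.submodule ≤ L.1 ↔ p.rep ∈ L.1 := by
  rw [Projectivization.submodule_eq, Submodule.span_singleton_le_iff_mem]

theorem mapPoint_rep_mem_iff {p : PSpace k 4} {L : Line k} :
    (mapPoint g p).rep ∈ (mapLine g L).1 ↔ p.rep ∈ L.1 := by
  obtain ⟨c, hc, e⟩ := exists_map_rep g p
  rw [← mem_mapLine g (v := p.rep), e, Submodule.smul_mem_iff _ hc]

theorem restrictLine_pullback [Infinite k] (u v : Fin 4 → k) (G : MvPolynomial (Fin 4) k) :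
    restrictLine u v (pullback g G) = restrictLine (g u) (g v) G := by
  apply MvPolynomial.funext
  intro p
  rw [eval_restrictLine, eval_restrictLine, eval_pullback]
  simp

theorem mapLine_mem_Bit [Infinite k] {X : Set (PSpace k 4)} {L : Line k} (hL : L ∈ Bit X) :
    mapLine g L ∈ Bit (mapPoint g '' X) := by
  rcases hL with h | ⟨u, v, hL, l₁, l₂, hl₁, n₁, hl₂, n₂, hdvd⟩
  · left
    intro p hp
    have e : mapPoint g (mapPoint g.symm p) = p := mapPoint_symm g.symm p
    refine ⟨mapPoint g.symm p, h _ ?_, e⟩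
    rw [submodule_le_iff] at hp ⊢
    rw [← mapPoint_rep_mem_iff g, e]
    exact hp
  · right
    refine ⟨g u, g v, ?_, l₁, l₂, hl₁, n₁, hl₂, n₂, ?_⟩
    · change L.1.map _ = _
      rw [hL, Submodule.map_span, Set.image_pair]
      rfl
    · suffices vanishingIdeal (mapPoint g '' X) ≤
          (Ideal.span {(l₁ * l₂) ^ 2}).comap (restrictLine (g u) (g v)) by
        intro G hG
        exact Ideal.mem_span_singleton.1 (this hG)
      refine Ideal.span_le.2 ?_
      rintro G ⟨d, hG, hGX⟩
      rw [SetLike.mem_coe, Ideal.mem_comap, Ideal.mem_span_singleton, ← restrictLine_pullback]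
      refine hdvd _ (Ideal.subset_span ⟨d, pullback_isHomogeneous hG, fun p hp => ?_⟩)
      obtain ⟨c, hc, e⟩ := exists_map_rep g p
      rw [eval_pullback]
      exact (eval_rep_eq_zero_iff hG hc e).1 (hGX _ ⟨p, hp, rfl⟩)

theorem mapLine_mem_Bit_iff [Infinite k] {X : Set (PSpace k 4)} {L : Line k} :
    mapLine g L ∈ Bit (mapPoint g '' X) ↔ L ∈ Bit X := by
  refine ⟨fun h => ?_, mapLine_mem_Bit g⟩
  have := mapLine_mem_Bit g.symm h
  rw [mapLine_symm, Set.image_image] at this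
  simpa [mapPoint_symm] using this

theorem mapLine_injective : Function.Injective (mapLine g) := fun L L' h => by
  rw [← mapLine_symm g L, h, mapLine_symm]

theorem exists_eq_mapLine (L : Line k) : ∃ L', mapLine g L' = L :=
  ⟨mapLine g.symm L, mapLine_symm g.symm L⟩

/-- The coordinates of the plane obtained by pulling back a plane. -/
def dualMap (a : Fin 4 → k) : Fin 4 → k := fun j => a ⬝ᵥ g (Pi.single j 1)

theorem dualMap_dotProduct (a v : Fin 4 → k) : dualMap g a ⬝ᵥ v = a ⬝ᵥ g v := by
  nth_rewrite 2 [sum_smul_single v]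
  rw [map_sum, dotProduct_sum]
  simp only [map_smul, dotProduct_smul, smul_eq_mul]
  rw [dotProduct]
  exact Finset.sum_congr rfl fun i _ => mul_comm _ _

theorem mapLine_mem_betaPlane_iff {a : Fin 4 → k} {L : Line k} :
    mapLine g L ∈ betaPlane (dualMap g.symm a) ↔ L ∈ betaPlane a := by
  constructor
  · intro h v hv
    have := h (g v) ((mem_mapLine g).2 hv)
    rwa [dualMap_dotProduct, g.symm_apply_apply] at this
  · rintro h _ ⟨v, hv, rfl⟩
    rw [dualMap_dotProduct]
    simpa using h v hv

theorem hasBidegree_of_map_eq [CharP k 2] [IsAlgClosed k] {X : Set (PSpace k 4)} {α β : k}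
    (h : mapPoint g '' X = quarticSurface α β) : HasBidegree (Bit X) 2 4 := by
  have : Infinite k := IsAlgClosed.instInfinite
  constructor
  · have hh : (MvPolynomial.X 0 * MvPolynomial.X 2 : MvPolynomial (Fin 4) k).IsHomogeneous 2 :=
      (isHomogeneous_X _ _).mul (isHomogeneous_X _ _)
    refine ⟨{p | eval p.rep (pullback g (MvPolynomial.X 0 * MvPolynomial.X 2)) ≠ 0},
      isOpen_eval_ne_zero (pullback_isHomogeneous hh), ?_, ?_⟩
    · have hv : g.symm ![1, 0, 1, 0] ≠ 0 := by
        rw [Ne, LinearEquiv.map_eq_zero_iff]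
        exact fun h => one_ne_zero (congrFun h 0)
      refine ⟨Projectivization.mk k _ hv, fun h0 => ?_⟩
      obtain ⟨c, hc, e⟩ := mk_rep_smul hv
      rw [eval_rep_eq_zero_iff (pullback_isHomogeneous hh) hc e, eval_pullback,
        g.apply_symm_apply] at h0
      simp at h0
    · intro p hp
      simp only [Set.mem_ofPred_eq, eval_pullback, map_mul, eval_X, mul_ne_zero_iff] at hp
      have key := encard_Bit_through_point α β hp.1 hp.2
      rw [← h] at key
      rw [← (mapLine_injective g).encard_image]
      have e : mapLine g '' (Bit X ∩ alphaPlane p) =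
          {L | L ∈ Bit (mapPoint g '' X) ∧ g p.rep ∈ L.1} := by
        ext L
        obtain ⟨L', rfl⟩ := exists_eq_mapLine g L
        rw [(mapLine_injective g).mem_set_image, Set.mem_ofPred_eq, mapLine_mem_Bit_iff,
          mem_mapLine, ← submodule_le_iff]
        rfl
      rw [e, key]
      rfl
  · have hh : ∀ i : Fin 4, (linearForm (g.symm (Pi.single i 1))).IsHomogeneous 1 := fun i =>
      linearForm_isHomogeneous _
    have he : ∀ (a : Fin 4 → k) (i : Fin 4), eval a (linearForm (g.symm (Pi.single i 1))) =
        dualMap g.symm a i := by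
      intro a i
      simp [linearForm, dualMap, dotProduct, mul_comm]
    have hP := IsHomogeneous.prod Finset.univ (fun i : Fin 4 =>
      linearForm (g.symm (Pi.single i 1))) (fun _ => 1) (fun i _ => hh i)
    refine ⟨{p | eval p.rep (∏ i : Fin 4, linearForm (g.symm (Pi.single i 1))) ≠ 0},
      isOpen_eval_ne_zero hP, ?_, ?_⟩
    · have hd : ∀ i, dualMap g.symm (dualMap g 1) i = 1 := by
        intro i
        rw [dualMap, dualMap_dotProduct, g.apply_symm_apply]
        simp
      have hv : dualMap g 1 ≠ 0 := by
        intro h0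
        have := hd 0
        rw [h0] at this
        simp [dualMap] at this
      refine ⟨Projectivization.mk k _ hv, fun h0 => ?_⟩
      obtain ⟨c, hc, e⟩ := mk_rep_smul hv
      rw [eval_rep_eq_zero_iff hP hc e, map_prod] at h0
      simp only [he, hd] at h0
      simp at h0
    · intro p hp
      simp only [Set.mem_ofPred_eq, map_prod, he, Finset.prod_ne_zero_iff, Finset.mem_univ,
        true_implies] at hp
      have key := encard_Bit_in_plane α β hp
      rw [← h] at key
      rw [← (mapLine_injective g).encard_image]
      have e : mapLine g '' (Bit X ∩ betaPlane p.rep) =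
          Bit (mapPoint g '' X) ∩ betaPlane (dualMap g.symm p.rep) := by
        ext L
        obtain ⟨L', rfl⟩ := exists_eq_mapLine g L
        rw [(mapLine_injective g).mem_set_image, Set.mem_inter_iff, Set.mem_inter_iff,
          mapLine_mem_Bit_iff, mapLine_mem_betaPlane_iff]
      rw [e, key]
      rfl

end Coordinates

/-! ### The normal form of the Kummer surface -/

section NormalForm

variable {k : Type*} [Field k]

/-- Rescaling the four coordinates fixes the mixed coefficients and that of `B⁴`; the equation for
`l` is what the coefficient of `S² Ξ²` requires, while `m` and `d` are absorbed into `β` and `α`. -/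
theorem quarticFun_normalize {α β c e m d l A S B Ξ : k} (he : e ≠ 0) (hl0 : l ≠ 0)
    (hl : l ^ 3 * c ^ 4 = e ^ 2) (hβ : β ^ 2 * e ^ 2 = m * l ^ 4) (hα : α ^ 2 * e ^ 2 = d * l ^ 2) :
    e ^ 2 * quarticFun α β ![A / l, S * (c ^ 2 * l / e), B, Ξ * (c ^ 2 * l ^ 2 / e ^ 2)] =
      S ^ 2 * Ξ ^ 2 + c ^ 2 * A ^ 2 * B * Ξ + c ^ 2 * e * A * S * B ^ 2 + e ^ 2 * B ^ 4 +
        d * A ^ 2 * B ^ 2 + m * A ^ 4 := by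
  have h1 : e ^ 2 * quarticFun α β ![A / l, S * (c ^ 2 * l / e), B, Ξ * (c ^ 2 * l ^ 2 / e ^ 2)] =
      (β ^ 2 * e ^ 2) * (A / l) ^ 4 + (α ^ 2 * e ^ 2) * (A / l) ^ 2 * B ^ 2 +
        c ^ 2 * A ^ 2 * B * Ξ + c ^ 2 * e * A * S * B ^ 2 +
        S ^ 2 * Ξ ^ 2 * (l ^ 3 * c ^ 4) ^ 2 / e ^ 4 + e ^ 2 * B ^ 4 := by
    simp [quarticFun]
    field_simp
  rw [h1, hβ, hα, hl]
  field_simp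
  ring

/-- A quartic surface of the shape taken by the Kummer surface can be brought into normal form. -/
theorem exists_normalization [IsAlgClosed k] {c e m d : k} (hc : c ≠ 0) (he : e ≠ 0) (hm : m ≠ 0)
    (A S B Ξ : (Fin 4 → k) →ₗ[k] k)
    (hinj : ∀ v, A v = 0 → S v = 0 → B v = 0 → Ξ v = 0 → v = 0) :
    ∃ (α β : k) (g : (Fin 4 → k) ≃ₗ[k] (Fin 4 → k)), β ≠ 0 ∧
      (∀ v, (g v 0 = 0 ↔ A v = 0) ∧ (g v 1 = 0 ↔ S v = 0) ∧ (g v 2 = 0 ↔ B v = 0)) ∧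
      ∀ v, e ^ 2 * quarticFun α β (g v) =
        S v ^ 2 * Ξ v ^ 2 + c ^ 2 * A v ^ 2 * B v * Ξ v + c ^ 2 * e * A v * S v * B v ^ 2 +
          e ^ 2 * B v ^ 4 + d * A v ^ 2 * B v ^ 2 + m * A v ^ 4 := by
  obtain ⟨l, hl⟩ := IsAlgClosed.exists_pow_nat_eq (e ^ 2 / c ^ 4) (n := 3) (by norm_num)
  have hl' : l ^ 3 * c ^ 4 = e ^ 2 := by rw [hl]; field_simp
  have hl0 : l ≠ 0 := by
    rintro rfl
    simp at hl'
    exact he (by simpa using hl'.symm)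
  obtain ⟨β, hβ⟩ := IsAlgClosed.exists_pow_nat_eq (m * l ^ 4 / e ^ 2) (n := 2) (by norm_num)
  obtain ⟨α, hα⟩ := IsAlgClosed.exists_pow_nat_eq (d * l ^ 2 / e ^ 2) (n := 2) (by norm_num)
  have hβ' : β ^ 2 * e ^ 2 = m * l ^ 4 := by rw [hβ]; field_simp
  have hα' : α ^ 2 * e ^ 2 = d * l ^ 2 := by rw [hα]; field_simp
  have hβ0 : β ≠ 0 := by
    rintro rfl
    have : m * l ^ 4 = 0 := by rw [← hβ']; ring
    simp [hm, hl0] at this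
  let T : (Fin 4 → k) →ₗ[k] (Fin 4 → k) :=
    { toFun := fun v => ![A v / l, S v * (c ^ 2 * l / e), B v, Ξ v * (c ^ 2 * l ^ 2 / e ^ 2)]
      map_add' := fun u v => by ext i; fin_cases i <;> simp <;> ring
      map_smul' := fun r v => by ext i; fin_cases i <;> simp <;> ring }
  have hT : ∀ v, T v = ![A v / l, S v * (c ^ 2 * l / e), B v, Ξ v * (c ^ 2 * l ^ 2 / e ^ 2)] :=
    fun v => rfl
  have hTi : Function.Injective T := by
    rw [← LinearMap.ker_eq_bot, LinearMap.ker_eq_bot']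
    intro v hv
    rw [hT] at hv
    have h0 := congrFun hv 0
    have h1 := congrFun hv 1
    have h2 := congrFun hv 2
    have h3 := congrFun hv 3
    simp [hl0, hc, he] at h0 h1 h2 h3
    exact hinj v h0 h1 h2 h3
  refine ⟨α, β, LinearEquiv.ofInjectiveEndo T hTi, hβ0, ?_, ?_⟩
  · intro v
    rw [LinearEquiv.coe_ofInjectiveEndo, hT]
    simp [hl0, hc, he]
  · intro v
    rw [LinearEquiv.coe_ofInjectiveEndo, hT, quarticFun_normalize he hl0 hl' hβ' hα']

end NormalForm

/-! ### The equation of the Kummer quartic when `h` has a single root. -/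

namespace GenusTwoCurve

variable {k : Type*} [Field k] (C : GenusTwoCurve k)

theorem eval_f (x : k) : C.f.eval x = C.f.coeff 0 + C.f.coeff 1 * x + C.f.coeff 2 * x ^ 2 +
    C.f.coeff 3 * x ^ 3 + C.f.coeff 4 * x ^ 4 + C.f.coeff 5 * x ^ 5 := by
  rw [Polynomial.eval_eq_sum_range' (n := 6) (by rw [C.natDegree_f]; norm_num)]
  simp [Finset.sum_range_succ]

theorem coeff_five_ne_zero : C.f.coeff 5 ≠ 0 := by
  rw [← C.natDegree_f]
  exact Polynomial.leadingCoeff_ne_zero.2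
    (fun h => by have := C.natDegree_f; rw [h] at this; simp at this)

/-- The product of the translated coordinates, as a linear form. -/
def prodForm (a : k) : (Fin 4 → k) →ₗ[k] k :=
  LinearMap.proj 2 + a • LinearMap.proj 1 + a ^ 2 • LinearMap.proj 0

theorem prodForm_apply (a : k) (v : Fin 4 → k) :
    prodForm a v = v 2 + a * v 1 + a ^ 2 * v 0 := by
  simp [prodForm]

variable [CharP k 2]

/-- The numerator `F₀(x₁, x₂)` in characteristic two. -/
def kummerNumerator (x₁ x₂ : k) : k :=
  (x₁ + x₂) * (C.f.coeff 1 + C.f.coeff 3 * (x₁ * x₂) + C.f.coeff 5 * (x₁ * x₂) ^ 2)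

theorem kummerVector_eq (x₁ y₁ x₂ y₂ : k) :
    C.kummerVector x₁ y₁ x₂ y₂ = ![1, x₁ + x₂, x₁ * x₂,
      (C.kummerNumerator x₁ x₂ + (C.h.eval x₁ * y₂ + C.h.eval x₂ * y₁)) / (x₁ + x₂) ^ 2] := by
  have two : (2 : k) = 0 := CharTwo.two_eq_zero
  simp only [kummerVector, kummerNumerator, CharTwo.sub_eq_add, two]
  congr 4
  ring

/-- The relation satisfied by `N = h(x₁) y₂ + h(x₂) y₁`. -/
theorem numerator_relation {x₁ y₁ x₂ y₂ : k} (e₁ : y₁ ^ 2 + C.h.eval x₁ * y₁ = C.f.eval x₁)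
    (e₂ : y₂ ^ 2 + C.h.eval x₂ * y₂ = C.f.eval x₂) :
    (C.h.eval x₁ * y₂ + C.h.eval x₂ * y₁) ^ 2 +
      C.h.eval x₁ * C.h.eval x₂ * (C.h.eval x₁ * y₂ + C.h.eval x₂ * y₁) +
      C.h.eval x₁ ^ 2 * C.f.eval x₂ + C.h.eval x₂ ^ 2 * C.f.eval x₁ = 0 := by
  rw [← e₁, ← e₂]
  grind

/-- Say `h(x₁) ≠ 0`. Choose `y₁` on the curve above `x₁` and solve the linear equation for `y₂`; the
relation then becomes `h(x₁)²` times the equation of the curve at `(x₂, y₂)`. -/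
theorem exists_of_numerator_relation [IsAlgClosed k] {x₁ x₂ N : k}
    (hN : N ^ 2 + C.h.eval x₁ * C.h.eval x₂ * N + C.h.eval x₁ ^ 2 * C.f.eval x₂ +
      C.h.eval x₂ ^ 2 * C.f.eval x₁ = 0) (hh : C.h.eval x₁ ≠ 0 ∨ C.h.eval x₂ ≠ 0) :
    ∃ y₁ y₂ : k, y₁ ^ 2 + C.h.eval x₁ * y₁ = C.f.eval x₁ ∧
      y₂ ^ 2 + C.h.eval x₂ * y₂ = C.f.eval x₂ ∧ C.h.eval x₁ * y₂ + C.h.eval x₂ * y₁ = N := by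
  have two : (2 : k) = 0 := CharTwo.two_eq_zero
  have main : ∀ h₁ h₂ f₁ f₂ : k, h₁ ≠ 0 →
      N ^ 2 + h₁ * h₂ * N + h₁ ^ 2 * f₂ + h₂ ^ 2 * f₁ = 0 →
      ∃ y₁ y₂, y₁ ^ 2 + h₁ * y₁ = f₁ ∧ y₂ ^ 2 + h₂ * y₂ = f₂ ∧ h₁ * y₂ + h₂ * y₁ = N := by
    intro h₁ h₂ f₁ f₂ hne e
    obtain ⟨y₁, hy₁⟩ := exists_quadratic_root (a := (1 : k)) (b := h₁) (c := f₁) one_ne_zero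
    have e₁ : y₁ ^ 2 + h₁ * y₁ = f₁ := by linear_combination hy₁ - f₁ * two
    obtain ⟨y₂, hy₂⟩ : ∃ y₂, h₁ * y₂ = N + h₂ * y₁ := ⟨(N + h₂ * y₁) / h₁, by field_simp⟩
    refine ⟨y₁, y₂, e₁, ?_, by linear_combination hy₂ + h₂ * y₁ * two⟩
    apply mul_left_cancel₀ (pow_ne_zero 2 hne)
    have : N = h₁ * y₂ + h₂ * y₁ := by linear_combination -hy₂ - h₂ * y₁ * two
    rw [this, ← e₁] at e
    grind
  rcases hh with h | h
  · exact main _ _ _ _ h hN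
  · obtain ⟨y₂, y₁, e₂, e₁, e⟩ := main (C.h.eval x₂) (C.h.eval x₁) (C.f.eval x₂) (C.f.eval x₁) h
      (by linear_combination hN)
    exact ⟨y₁, y₂, e₁, e₂, by linear_combination e⟩

/-- By `hK` the quartic at `[1, x₁ + x₂, x₁ x₂, ξ]` is, up to `κ (x₁ + x₂)²`, the relation for `N =
ξ (x₁ + x₂)² + F₀`. For the converse a general point determines `x₁`, `x₂` as roots of a quadratic
polynomial, and `N` lifts to `y₁`, `y₂` because `hh` prevents `h` from vanishing at both. -/
theorem map_kummerSurface_eq [IsAlgClosed k] {g : (Fin 4 → k) ≃ₗ[k] (Fin 4 → k)} {α β κ : k}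
    (hκ : κ ≠ 0)
    (hK : ∀ x₁ x₂ ξ : k, (x₁ + x₂) ^ 2 *
      (κ * quarticFun α β (g ![1, x₁ + x₂, x₁ * x₂, ξ])) =
        (ξ * (x₁ + x₂) ^ 2 + C.kummerNumerator x₁ x₂) ^ 2 + C.h.eval x₁ * C.h.eval x₂ *
          (ξ * (x₁ + x₂) ^ 2 + C.kummerNumerator x₁ x₂) + C.h.eval x₁ ^ 2 * C.f.eval x₂ +
          C.h.eval x₂ ^ 2 * C.f.eval x₁)
    (hne : ∀ v, g v 0 ≠ 0 → g v 1 ≠ 0 → g v 2 ≠ 0 → v 0 ≠ 0 ∧ v 1 ≠ 0)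
    (hh : ∀ x₁ x₂, C.h.eval x₁ = 0 → C.h.eval x₂ = 0 → x₁ = x₂) :
    mapPoint g '' C.kummerSurface = quarticSurface α β := by
  have two : (2 : k) = 0 := CharTwo.two_eq_zero
  have hsum : ∀ {x₁ x₂ : k}, x₁ ≠ x₂ → x₁ + x₂ ≠ 0 := fun {x₁ x₂} h h0 =>
    h (CharTwo.add_eq_zero.1 h0)
  apply Set.Subset.antisymm
  · rintro _ ⟨p, hp, rfl⟩
    have hF : eval p.rep (pullback g (quarticForm α β)) = 0 := by
      refine mem_closure_iff_eval.1 hp _ 4 (pullback_isHomogeneous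
        (quarticForm_isHomogeneous α β)) ?_
      rintro q ⟨x₁, y₁, x₂, y₂, e₁, e₂, hx, hq⟩
      have hqr : q.rep ∈ Submodule.span k {C.kummerVector x₁ y₁ x₂ y₂} := by
        rw [← hq, Projectivization.submodule_eq]
        exact Submodule.mem_span_singleton_self _
      obtain ⟨c, hc⟩ := Submodule.mem_span_singleton.1 hqr
      have s0 := hsum hx
      rw [← hc, eval_smul_of_isHomogeneous (pullback_isHomogeneous
        (quarticForm_isHomogeneous α β)), eval_pullback, eval_quarticForm, C.kummerVector_eq]
      have := hK x₁ x₂ ((C.kummerNumerator x₁ x₂ + (C.h.eval x₁ * y₂ + C.h.eval x₂ * y₁)) /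
        (x₁ + x₂) ^ 2)
      rw [div_mul_cancel₀ _ (pow_ne_zero 2 s0)] at this
      have e : C.kummerNumerator x₁ x₂ + (C.h.eval x₁ * y₂ + C.h.eval x₂ * y₁) +
          C.kummerNumerator x₁ x₂ = C.h.eval x₁ * y₂ + C.h.eval x₂ * y₁ := by
        linear_combination C.kummerNumerator x₁ x₂ * two
      rw [e, C.numerator_relation e₁ e₂] at this
      have h0 := (mul_eq_zero.1 ((mul_eq_zero.1 this).resolve_left
        (pow_ne_zero 2 s0))).resolve_left hκ
      rw [h0, mul_zero]
    rw [eval_pullback] at hF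
    obtain ⟨c, hc, e⟩ := exists_map_rep g p
    exact (eval_rep_eq_zero_iff (quarticForm_isHomogeneous α β) hc e).2 hF
  · intro q hq
    refine ⟨mapPoint g.symm q, ?_, mapPoint_symm g.symm q⟩
    refine mem_closure_iff_eval.2 fun G d hG hGD => ?_
    have hdvd : quarticForm α β ∣ pullback g.symm G := by
      refine quarticForm_dvd_of_vanishing (H := 1) one_ne_zero ?_
      intro x y z w hx hy hz _ hF
      rw [eval_pullback]
      obtain ⟨v, hv⟩ : ∃ v, g v = ![x, y, z, w] := ⟨g.symm _, g.apply_symm_apply _⟩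
      rw [← hv, g.symm_apply_apply]
      obtain ⟨v0, v1⟩ := hne v (by simpa [hv] using hx) (by simpa [hv] using hy)
        (by simpa [hv] using hz)
      obtain ⟨x₁, hx₁⟩ := exists_quadratic_root (a := (1 : k)) (b := v 1 / v 0) (c := v 2 / v 0)
        one_ne_zero
      obtain ⟨x₂, hx₂⟩ : ∃ x₂, x₁ + x₂ = v 1 / v 0 := ⟨v 1 / v 0 - x₁, by ring⟩
      have hp : x₁ * x₂ = v 2 / v 0 := by
        rw [← hx₂] at hx₁
        linear_combination hx₁ - (x₁ ^ 2 + v 2 / v 0) * two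
      have s0 : x₁ + x₂ ≠ 0 := by rw [hx₂]; exact div_ne_zero v1 v0
      have hx : x₁ ≠ x₂ := by
        rintro rfl
        exact s0 (CharTwo.add_self_eq_zero x₁)
      have hvec : v = v 0 • ![1, x₁ + x₂, x₁ * x₂, v 3 / v 0] := by
        rw [hx₂, hp]
        ext i
        fin_cases i <;> simp <;> field_simp
      have hF' : quarticFun α β (g ![1, x₁ + x₂, x₁ * x₂, v 3 / v 0]) = 0 := by
        have e : g v = v 0 • g ![1, x₁ + x₂, x₁ * x₂, v 3 / v 0] := by
          rw [← map_smul, ← hvec]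
        rw [← hv, e, ← eval_quarticForm,
          eval_smul_of_isHomogeneous (quarticForm_isHomogeneous α β), eval_quarticForm] at hF
        exact (mul_eq_zero.1 hF).resolve_left (pow_ne_zero _ v0)
      have hN := hK x₁ x₂ (v 3 / v 0)
      rw [hF', mul_zero, mul_zero] at hN
      obtain ⟨y₁, y₂, e₁, e₂, e⟩ := C.exists_of_numerator_relation hN.symm (by
        by_contra! hcon
        exact hx (hh x₁ x₂ hcon.1 hcon.2))
      have hkv : C.kummerVector x₁ y₁ x₂ y₂ = ![1, x₁ + x₂, x₁ * x₂, v 3 / v 0] := by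
        rw [C.kummerVector_eq, e]
        have : (C.kummerNumerator x₁ x₂ + (v 3 / v 0 * (x₁ + x₂) ^ 2 +
            C.kummerNumerator x₁ x₂)) / (x₁ + x₂) ^ 2 = v 3 / v 0 := by
          rw [div_eq_iff (pow_ne_zero 2 s0)]
          linear_combination C.kummerNumerator x₁ x₂ * two
        rw [this]
      have hk0 : C.kummerVector x₁ y₁ x₂ y₂ ≠ 0 := by
        rw [hkv]; exact fun h => one_ne_zero (congrFun h 0)
      have hz := hGD (Projectivization.mk k _ hk0)
        ⟨x₁, y₁, x₂, y₂, e₁, e₂, hx, Projectivization.submodule_mk _ _⟩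
      obtain ⟨c, hc, ec⟩ := mk_rep_smul hk0
      rw [eval_rep_eq_zero_iff hG hc ec, hkv] at hz
      rw [hvec, eval_smul_of_isHomogeneous hG, hz, mul_zero]
    obtain ⟨c, hc, e⟩ := exists_map_rep g.symm q
    rw [eval_rep_eq_zero_iff hG hc e, ← eval_pullback]
    obtain ⟨t, ht⟩ := hdvd
    rw [ht, map_mul, show eval q.rep (quarticForm α β) = 0 from hq, zero_mul]

theorem eval_derivative_f (a : k) : C.f.derivative.eval a =
    C.f.coeff 1 + C.f.coeff 3 * a ^ 2 + C.f.coeff 5 * a ^ 4 := by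
  have two : (2 : k) = 0 := CharTwo.two_eq_zero
  rw [Polynomial.eval_eq_sum_range' (n := 5)
    (lt_of_le_of_lt (Polynomial.natDegree_derivative_le _) (by rw [C.natDegree_f]; norm_num))]
  simp [Finset.sum_range_succ, Polynomial.coeff_derivative]
  linear_combination (C.f.coeff 2 * a + C.f.coeff 3 * a ^ 2 + 2 * C.f.coeff 4 * a ^ 3 +
    2 * C.f.coeff 5 * a ^ 4) * two

theorem eval_f_taylor (a X : k) : C.f.eval (X + a) = C.f.eval a + C.f.derivative.eval a * X +
    (C.f.coeff 2 + a * C.f.coeff 3) * X ^ 2 + C.f.coeff 3 * X ^ 3 +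
    (C.f.coeff 4 + a * C.f.coeff 5) * X ^ 4 + C.f.coeff 5 * X ^ 5 := by
  rw [eval_derivative_f, eval_f, eval_f]
  grind

/-- The translation of the numerator that moves the root of `h` to the origin. -/
theorem kummerNumerator_translate (a X Y ξ : k) :
    ξ * (X + a + (Y + a)) ^ 2 + C.kummerNumerator (X + a) (Y + a) =
      (ξ + C.f.coeff 3 * a + C.f.coeff 5 * a ^ 2 * (X + Y)) * (X + Y) ^ 2 +
        (X + Y) * (C.f.derivative.eval a + C.f.coeff 3 * (X * Y) +
          C.f.coeff 5 * (X * Y) ^ 2) := by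
  rw [eval_derivative_f, kummerNumerator]
  grind

theorem prodForm_kummer (a X Y ξ : k) :
    prodForm a ![1, X + a + (Y + a), (X + a) * (Y + a), ξ] = X * Y := by
  rw [prodForm_apply]
  simp
  grind

/-- In translated variables `h = c X²`, and the quartic has the common shape with `A = X Y` and `B =
1`. Smoothness at the point above `a` gives `f'(a) ≠ 0`. -/
theorem exists_normalForm_of_double_root [IsAlgClosed k] {a c : k} (hc : c ≠ 0)
    (hh : C.h = Polynomial.C c * (Polynomial.X - Polynomial.C a) ^ 2) :
    ∃ (α β : k) (g : (Fin 4 → k) ≃ₗ[k] (Fin 4 → k)), β ≠ 0 ∧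
      mapPoint g '' C.kummerSurface = quarticSurface α β := by
  have two : (2 : k) = 0 := CharTwo.two_eq_zero
  obtain ⟨b, hb⟩ := IsAlgClosed.exists_pow_nat_eq (C.f.eval a) (n := 2) (by norm_num)
  have hha : ∀ X, C.h.eval (X + a) = c * X ^ 2 := fun X => by rw [hh]; simp
  have he : C.f.derivative.eval a ≠ 0 := by
    have := C.smooth a b (by rw [hh]; simpa using hb)
    rw [hh] at this
    simpa [two, Polynomial.derivative_pow] using this
  set e := C.f.derivative.eval a with hedef
  have h5 := C.coeff_five_ne_zero
  -- The constant term `b²` of the translated `f` contributes `c² b² (X + Y)⁴`; adding `c b` to the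
  -- last coordinate absorbs it, at the price of the summand `c³ b` in `d`.
  set Ξ : (Fin 4 → k) →ₗ[k] k := LinearMap.proj 3 + (C.f.coeff 3 * a + c * b) • LinearMap.proj 0 +
    (C.f.coeff 5 * a ^ 2) • LinearMap.proj 1 with hΞ
  have hΞa : ∀ v, Ξ v = v 3 + (C.f.coeff 3 * a + c * b) * v 0 + C.f.coeff 5 * a ^ 2 * v 1 :=
    fun v => by simp [hΞ]
  obtain ⟨α, β, g, hβ, hg, hq⟩ := exists_normalization (c := c) (e := e) (m := C.f.coeff 5 ^ 2)
    (d := C.f.coeff 3 ^ 2 + c ^ 2 * (C.f.coeff 2 + a * C.f.coeff 3) + c ^ 3 * b)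
    hc he (pow_ne_zero 2 h5) (prodForm a) (LinearMap.proj 1) (LinearMap.proj 0) Ξ (by
      intro v hA hS hB hX
      rw [prodForm_apply] at hA
      rw [hΞa] at hX
      simp only [LinearMap.proj_apply] at hS hB
      simp only [hS, hB, mul_zero, add_zero] at hA hX
      ext i; fin_cases i <;> simp [hS, hB, hA, hX])
  refine ⟨α, β, g, hβ, C.map_kummerSurface_eq (pow_ne_zero 2 he) ?_ ?_ ?_⟩
  · intro x₁ x₂ ξ
    obtain ⟨X, rfl⟩ : ∃ X, x₁ = X + a := ⟨x₁ - a, by ring⟩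
    obtain ⟨Y, rfl⟩ : ∃ Y, x₂ = Y + a := ⟨x₂ - a, by ring⟩
    rw [hq, C.kummerNumerator_translate, hha, hha, C.eval_f_taylor a X, C.eval_f_taylor a Y,
      ← hedef, prodForm_kummer, hΞa, ← hb]
    have hs : X + a + (Y + a) = X + Y := by linear_combination a * two
    simp only [LinearMap.proj_apply, hs, Matrix.cons_val]
    obtain ⟨ζ, hζ⟩ : ∃ ζ, ζ = ξ + C.f.coeff 3 * a + C.f.coeff 5 * a ^ 2 * (X + Y) := ⟨_, rfl⟩
    have h1 : ξ + (C.f.coeff 3 * a + c * b) * 1 + C.f.coeff 5 * a ^ 2 * (X + Y) = ζ + c * b := by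
      rw [hζ]; ring
    rw [← hζ, h1]
    clear h1 hζ hs hq hg hΞa
    grind
  · intro v _ h1 h2
    exact ⟨fun h => h2 ((hg v).2.2.2 h), fun h => h1 ((hg v).2.1.2 h)⟩
  · intro x₁ x₂ h₁ h₂
    rw [hh] at h₁ h₂
    simp [hc, sub_eq_zero] at h₁ h₂
    rw [h₁, h₂]

/-- Now `h = c X`, and `1` and `X Y` exchange roles: `A = 1`, `B = X Y`. The leading coefficient of
`f` takes the place of `f'(a)`, and smoothness enters through `m = (c b - f'(a))² ≠ 0`. -/
theorem exists_normalForm_of_simple_root [IsAlgClosed k] {a c : k} (hc : c ≠ 0)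
    (hh : C.h = Polynomial.C c * (Polynomial.X - Polynomial.C a)) :
    ∃ (α β : k) (g : (Fin 4 → k) ≃ₗ[k] (Fin 4 → k)), β ≠ 0 ∧
      mapPoint g '' C.kummerSurface = quarticSurface α β := by
  have two : (2 : k) = 0 := CharTwo.two_eq_zero
  obtain ⟨b, hb⟩ := IsAlgClosed.exists_pow_nat_eq (C.f.eval a) (n := 2) (by norm_num)
  have hha : ∀ X, C.h.eval (X + a) = c * X := fun X => by rw [hh]; simp
  set e := C.f.derivative.eval a with hedef
  have hm : c * b - e ≠ 0 := by
    have := C.smooth a b (by rw [hh]; simpa using hb)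
    rw [hh] at this
    simpa [two, ← hedef] using this
  have hm' : e ^ 2 + c ^ 2 * C.f.eval a ≠ 0 := by
    have h : e ^ 2 + c ^ 2 * C.f.eval a = (c * b - e) ^ 2 := by
      rw [← hb]; linear_combination c * b * e * two
    rw [h]; exact pow_ne_zero 2 hm
  have h5 := C.coeff_five_ne_zero
  set Ξ : (Fin 4 → k) →ₗ[k] k := LinearMap.proj 3 + (C.f.coeff 3 * a) • LinearMap.proj 0 +
    (C.f.coeff 5 * a ^ 2) • LinearMap.proj 1 with hΞ
  have hΞa : ∀ v, Ξ v = v 3 + (C.f.coeff 3 * a) * v 0 + C.f.coeff 5 * a ^ 2 * v 1 :=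
    fun v => by simp [hΞ]
  obtain ⟨α, β, g, hβ, hg, hq⟩ := exists_normalization (c := c) (e := C.f.coeff 5)
    (m := e ^ 2 + c ^ 2 * C.f.eval a)
    (d := C.f.coeff 3 ^ 2 + c ^ 2 * (C.f.coeff 4 + a * C.f.coeff 5))
    hc h5 hm' (LinearMap.proj 0) (LinearMap.proj 1) (prodForm a) Ξ (by
      intro v hB hS hA hX
      rw [prodForm_apply] at hA
      rw [hΞa] at hX
      simp only [LinearMap.proj_apply] at hS hB
      simp only [hS, hB, mul_zero, add_zero] at hA hX
      ext i; fin_cases i <;> simp [hS, hB, hA, hX])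
  refine ⟨α, β, g, hβ, C.map_kummerSurface_eq (pow_ne_zero 2 h5) ?_ ?_ ?_⟩
  · intro x₁ x₂ ξ
    obtain ⟨X, rfl⟩ : ∃ X, x₁ = X + a := ⟨x₁ - a, by ring⟩
    obtain ⟨Y, rfl⟩ : ∃ Y, x₂ = Y + a := ⟨x₂ - a, by ring⟩
    rw [hq, C.kummerNumerator_translate, hha, hha, C.eval_f_taylor a X, C.eval_f_taylor a Y,
      ← hedef, prodForm_kummer, hΞa]
    have hs : X + a + (Y + a) = X + Y := by linear_combination a * two
    simp only [LinearMap.proj_apply, hs, Matrix.cons_val]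
    obtain ⟨ζ, hζ⟩ : ∃ ζ, ζ = ξ + C.f.coeff 3 * a + C.f.coeff 5 * a ^ 2 * (X + Y) := ⟨_, rfl⟩
    have h1 : ξ + C.f.coeff 3 * a * 1 + C.f.coeff 5 * a ^ 2 * (X + Y) = ζ := by
      rw [hζ]; ring
    rw [← hζ, h1]
    clear h1 hζ hs hq hg hΞa
    grind
  · intro v h0 h1 _
    exact ⟨fun h => h0 ((hg v).1.2 h), fun h => h1 ((hg v).2.1.2 h)⟩
  · intro x₁ x₂ h₁ h₂
    rw [hh] at h₁ h₂
    simp [hc, sub_eq_zero] at h₁ h₂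
    rw [h₁, h₂]

theorem exists_normalForm [IsAlgClosed k] (hC : C.HasTwoRank 1) :
    ∃ (α β : k) (g : (Fin 4 → k) ≃ₗ[k] (Fin 4 → k)), β ≠ 0 ∧
      mapPoint g '' C.kummerSurface = quarticSurface α β := by
  obtain ⟨a, c, hc, h | h⟩ := C.h_eq_of_hasTwoRank_one hC
  · exact C.exists_normalForm_of_simple_root hc h
  · exact C.exists_normalForm_of_double_root hc h

end GenusTwoCurve

end KummerBit

end

theorem mainTheorem2 {k : Type*} [Field k] [IsAlgClosed k] [CharP k 2]
    (C : KummerBit.GenusTwoCurve k) (hC : C.HasTwoRank 1) :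
    -- the bitangent surface of the Kummer quartic surface of `C` has bidegree `(2, 4)`
    KummerBit.HasBidegree (KummerBit.Bit C.kummerSurface) 2 4 ∧
    -- in suitable coordinates the Kummer quartic surface has the normal form `X₁`
    (∃ (α β : k) (g : (Fin 4 → k) ≃ₗ[k] (Fin 4 → k)), β ≠ 0 ∧
      Projectivization.map (g : (Fin 4 → k) →ₗ[k] (Fin 4 → k)) g.injective '' C.kummerSurface =
        KummerBit.quarticSurface α β) ∧
    -- in all such coordinates, the components of the bitangent surface are as follows
    (∀ (α β : k) (g : (Fin 4 → k) ≃ₗ[k] (Fin 4 → k)), β ≠ 0 →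
      ∀ X₁ : Set (KummerBit.PSpace k 4), X₁ = KummerBit.quarticSurface α β →
      Projectivization.map (g : (Fin 4 → k) →ₗ[k] (Fin 4 → k)) g.injective '' C.kummerSurface =
        X₁ →
      ∀ B₁ B₂ S₁ S₂ : Set (KummerBit.Line k),
        -- the lines in the planes `x = 0` and `z = 0`
        B₁ = KummerBit.betaPlane (Pi.single 0 1) →
        B₂ = KummerBit.betaPlane (Pi.single 2 1) →
        -- the congruences `S(σ₁)` and `S(σ₂)`
        S₁ = KummerBit.involutionCongruence X₁ (KummerBit.sigma₁ β) →
        S₂ = KummerBit.involutionCongruence X₁ KummerBit.sigma₂ →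
        KummerBit.Bit X₁ = B₁ ∪ B₂ ∪ S₁ ∪ S₂ ∧
        KummerBit.componentsOf (KummerBit.Bit X₁) = {B₁, B₂, S₁, S₂} ∧
        (KummerBit.componentsOf (KummerBit.Bit X₁)).ncard = 4 ∧
        KummerBit.IsTrope X₁ (Pi.single 0 1) ∧
        KummerBit.IsTrope X₁ (Pi.single 2 1) ∧
        KummerBit.IsBitangentInvolution X₁ (KummerBit.sigma₁ β) ∧
        KummerBit.IsBitangentInvolution X₁ KummerBit.sigma₂ ∧
        KummerBit.IsSmoothQuadricSurface (KummerBit.plucker '' S₁) ∧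
        KummerBit.IsQuadricCone (KummerBit.plucker '' S₂)) := by
  refine ⟨?_, C.exists_normalForm hC, ?_⟩
  · obtain ⟨α, β, g, -, hg⟩ := C.exists_normalForm hC
    exact KummerBit.hasBidegree_of_map_eq g hg
  · rintro α β g hβ _ rfl - _ _ _ _ rfl rfl rfl rfl
    rw [KummerBit.involutionCongruence_sigma₁ α hβ, KummerBit.involutionCongruence_sigma₂ α β,
      KummerBit.componentsOf_Bit_quarticSurface]
    exact ⟨KummerBit.Bit_quarticSurface α β, rfl, KummerBit.ncard_components,
      KummerBit.isTrope_zero α β, KummerBit.isTrope_two α β,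
      KummerBit.isBitangentInvolution_sigma₁ α hβ, KummerBit.isBitangentInvolution_sigma₂ α hβ,
      KummerBit.isSmoothQuadricSurface_quadricLines, KummerBit.isQuadricCone_coneLines⟩
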